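/- **Problem and assumptions.** Let $f:\mathbb R^n\to\mathbb R$, $g:\mathbb R^n\to\mathbb R^\ell$, $h:\mathbb R^n\to(-\infty,\infty]$, let $\mathcal K\subseteq\mathbb R^\ell$ be a nonempty closed convex cone with dual cone $\mathcal K^*$, and write $u\preceq_{\mathcal K}v$ for $v-u\in\mathcal K$. Consider $$\phi^*:=\inf\{\phi(z):=f(z)+h(z)\;:\;g(z)\preceq_{\mathcal K}0\},\qquad \phi_*:=\inf_{z\in\mathbb R^n}\phi(z).$$ Assume: (B1) $h$ is proper, lower semicontinuous, convex, and $K_h$-Lipschitz on its domain $\mathcal H=\mathrm{dom}\,h$ ($K_h>0$); $\mathcal H$ is compact with diameter $D_h$. (B2) $f$ is not convex on $\mathcal H$, is differentiable on $\mathcal H$, and there are $m_f,L_f>0$ with $-\frac{m_f}2\|z'-z\|^2\le f(z')-f(z)-\langle\nabla f(z),z'-z\rangle$ and $\|\nabla f(z')-\nabla f(z)\|\le L_f\|z'-z\|$ for all $z,z'\in\mathcal H$. (B3) $g$ is differentiable and $\mathcal K$-convex, i.e. $g(tz'+(1-t)z)-tg(z')-(1-t)g(z)\preceq_{\mathcal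 K}0$ for all $z,z'\in\mathbb R^n$, $t\in[0,1]$; and $\|\nabla g(z')-\nabla g(z)\|\le L_g\|z'-z\|$ for all $z,z'\in\mathbb R^n$, with $L_g>0$ (here $\nabla g(z)$ is the adjoint of $g'(z)$, with the operator norm). (B4) There are $\bar z\in\mathrm{int}\,\mathcal H$ and $\tau\in(0,1]$ with $g(\bar z)\preceq_{\mathcal K}0$ and $\max\{\|\nabla g(z)p\|,|\langle p,g(\bar z)\rangle|\}\ge\tau\|p\|$ for all $z\in\mathcal H$, $p\in\mathcal K^*$. A quadruple $(\hat z,\hat p,\hat w,\hat q)$ is *$(\hat\rho,\hat\eta)$-approximate stationary* if $\hat w\in\nabla f(\hat z)+\partial h(\hat z)+\nabla g(\hat z)\hat p$, $\langle g(\hat z)+\hat q,\hat p\rangle=0$, $g(\hat z)+\hat q\preceq_{\mathcal K}0$, $\hat p\in\mathcal K^*$, $\|\hat w\|\le\hat\rho$ and $\|\hat q\|\le\hat\eta$. **ACG algorithm.** Input: $M_s,\mu,\tilde\sigma>0$, functions $\psi_s,\psi_n$ and $x_0\in\mathrm{dom}\,\psi_n$; write $\psi=\psi_s+\psi_n$ and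 $\ell_{\psi_s}(z;x)=\psi_s(x)+\langle\nabla\psi_s(x),z-x\rangle$. Set $y_0=x_0$, $A_0=0$, $\Gamma_0\equiv0$. For $j=1,2,\dots$ let $$A_j=A_{j-1}+\frac{\mu A_{j-1}+1+\sqrt{(\mu A_{j-1}+1)^2+4M_s(\mu A_{j-1}+1)A_{j-1}}}{2M_s},\qquad \tilde x_{j-1}=\frac{A_{j-1}}{A_j}x_{j-1}+\frac{A_j-A_{j-1}}{A_j}y_{j-1},$$ $$\Gamma_j=\frac{A_{j-1}}{A_j}\Gamma_{j-1}+\frac{A_j-A_{j-1}}{A_j}\ell_{\psi_s}(\cdot;\tilde x_{j-1}),\qquad y_j=\operatorname*{argmin}_y\Big\{\Gamma_j(y)+\psi_n(y)+\frac{\|y-y_0\|^2}{2A_j}\Big\},$$ $$x_j=\frac{A_{j-1}}{A_j}x_{j-1}+\frac{A_j-A_{j-1}}{A_j}y_j,\qquad u_j=\frac{y_0-y_j}{A_j},\qquad \eta_j=\psi(x_j)-\Gamma_j(y_j)-\psi_n(y_j)-\langle u_j,x_j-y_j\rangle,$$ and stop with output $(x_j,u_j,\eta_j)$ at the first $j\ge1$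 with $\|u_j\|^2+2\eta_j\le\tilde\sigma^2\|x_0-x_j+u_j\|^2$. **NL-IAPIAL method.** Put $B_f^{(1)}=\sup_{\mathcal H}\|\nabla f\|$, $B_g^{(0)}=\sup_{\mathcal H}\|g\|$, $B_g^{(1)}=\sup_{\mathcal H}\|\nabla g\|$, and $$\widetilde{\mathcal L}_c(z;p)=f(z)+\frac{\mathrm{dist}^2(p+cg(z),-\mathcal K)-\|p\|^2}{2c},\qquad \mathcal L_c(z;p)=\widetilde{\mathcal L}_c(z;p)+h(z),$$ $$\widetilde L(c,p)=L_f+L_g\|p\|+c\big(B_g^{(0)}L_g+[B_g^{(1)}]^2\big).$$ Input: $0<\lambda\le1/(2m_f)$, $\sigma\in(0,1/\sqrt2]$, $c_1>0$, $(z_0,p_0)\in\mathcal H\times\mathbb R^\ell$ and $\hat\rho,\hat\eta>0$. Set $\hat k=0$, $k=1$. 1. Let $L^\psi_{k-1}=\lambda\widetilde L(c_k,p_{k-1})+1$. Call ACG with $\psi_s=\lambda\widetilde{\mathcal L}_{c_k}(\cdot;p_{k-1})+\frac14\|\cdot-z_{k-1}\|^2$, $\psi_n=\lambda h+\frac14\|\cdot-z_{k-1}\|^2$,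 $M_s=L^\psi_{k-1}-\frac12$, $\mu=\frac12$, $x_0=z_{k-1}$, $\tilde\sigma=\sigma/\sqrt{L^\psi_{k-1}}$; let $(z_k,v_k,\varepsilon_k)$ be its output. 2. Let $r_k=v_k+z_{k-1}-z_k$ and $$\hat z_k=\operatorname*{argmin}_u\Big\{\lambda\big[\langle\nabla_z\widetilde{\mathcal L}_{c_k}(z_k;p_{k-1}),u-z_k\rangle+h(u)\big]-\langle r_k,u-z_k\rangle+\tfrac12L^\psi_{k-1}\|u-z_k\|^2\Big\},$$ $\hat p_k=\Pi_{\mathcal K^*}(p_{k-1}+c_kg(\hat z_k))$, $\hat q_k=(p_{k-1}-\hat p_k)/c_k$, $\hat w_k=\frac1\lambda[r_k+L^\psi_{k-1}(z_k-\hat z_k)]+\nabla_z\widetilde{\mathcal L}_{c_k}(\hat z_k;p_{k-1})-\nabla_z\widetilde{\mathcal L}_{c_k}(z_k;p_{k-1})$. If $\|\hat w_k\|\le\hat\rho$ and $\|\hat q_k\|\le\hat\eta$, stop and output $(\hat z_k,\hat p_k,\hat w_k,\hat q_k)$. 3. Let $p_k=\Pi_{\mathcal K^*}(p_{k-1}+c_kg(z_k))$.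 If $k>\hat k+1$ and $$\frac{\mathcal L_{c_k}(z_{\hat k+1};p_{\hat k+1})-\mathcal L_{c_k}(z_k;p_k)}{k-\hat k-1}\le\frac{\lambda(1-\sigma^2)\hat\rho^2}{4(1+2\sigma)^2},$$ set $c_{k+1}=2c_k$ and $\hat k=k$; otherwise set $c_{k+1}=c_k$. Increase $k$ by one and go to 1. The *inner iterations* are all ACG iterations, summed over all ACG calls. **Constants.** Let $\bar d=\mathrm{dist}(\bar z,\partial\mathcal H)$, $R_\phi=\phi^*-\phi_*+D_h^2/\lambda$, $\log_1^+t=\max\{\log t,1\}$, $$\kappa_0=2[K_h+B_f^{(1)}]D_h+\Big[\frac{\sigma^2}{2(1-\sigma)^2}+2\,\frac{1+\sigma}{1-\sigma}\Big]\frac{D_h^2}{\lambda},\qquad C_0=\frac{\max\{\|p_0\|,\kappa_0\}}{\min\{1,\bar d\}\,\tau},$$ $$\kappa_1=L_f+L_gC_0,\qquad \kappa_2=B_g^{(0)}L_g+[B_g^{(1)}]^2,$$ $$\kappa_3=\frac{16(1+2\sigma)^2\max\{\|p_0\|,\kappa_0\}^2}{\lambda(1-\sigma^2)\min\{1,\bar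 d^2\}\tau^2},\qquad \kappa_4=\frac{\sigma D_h}{\lambda(1-\sigma)B_g^{(1)}}+2C_0$$ (the first summand of $\kappa_4$ is read as $0$ if $B_g^{(1)}=0$), and $$\bar c=\frac{\kappa_3}{\hat\rho^2}+\frac{\kappa_4}{\hat\eta},\qquad \mathcal T=[\lambda(\kappa_1+c_1\kappa_2)+1]\,\frac{\max\{c_1,2\bar c\}}{c_1}.$$ **Theorem 3.4.** Let $\sigma\in(0,1/\sqrt2]$. (i) For every $M\in\mathbb R$ there is a constant $C>0$, depending only on $\sigma$ and $M$, such that for all $n,\ell$, all problem data satisfying (B1)–(B4), and all $\lambda\in(0,1/(2m_f)]$, $c_1>0$, $(z_0,p_0)\in\mathcal H\times\mathbb R^\ell$ and $\hat\rho,\hat\eta>0$ with $C_0^2/c_1\le MR_\phi$ and $\lambda\hat\rho^2\le MR_\phi$, the NL-IAPIAL method terminates, its output is a $(\hat\rho,\hat\eta)$-approximate stationary quadruple, and its total number of inner iterations is at most $$C\Big(1+\frac{R_\phi}{\lambda\hat\rho^2}\sqrt{\mathcal T}\,\log_1^+\mathcal T\Big).$$ (ii) For all fixed problem data satisfying (B1)–(B4),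 all fixed $\lambda\in(0,1/(2m_f)]$, $c_1>0$, $p_0\in\mathbb R^\ell$, and every $\rho_{\max}>0$ there is a constant $C>0$ such that for all $z_0\in\mathcal H$, $\hat\rho\in(0,\rho_{\max}]$ and $\hat\eta>0$ the method terminates with a $(\hat\rho,\hat\eta)$-approximate stationary quadruple after at most $$C\Big(\hat\eta^{-1/2}\hat\rho^{-2}+\hat\rho^{-3}\Big)\log_1^+\Big(\frac1{\hat\rho}+\frac1{\hat\eta}\Big)$$ inner iterations. -/

import Mathlib

open scoped InnerProductSpace

universe u v

namespace NLIAPIAL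

noncomputable section

/-! ### Convex analysis for functions with values in `(-∞, ∞]` -/

section ConvexAnalysis

variable {E : Type u} [NormedAddCommGroup E] [InnerProductSpace ℝ E]

/-- The effective domain of an extended-real-valued function. -/
def dom (h : E → EReal) : Set E := {z | h z < ⊤}

/-- Proper lower semicontinuous convex functions `E → (-∞, ∞]`
(convexity is convexity of the epigraph). -/
structure IsClosedProperConvex (h : E → EReal) : Prop where
  ne_bot : ∀ z, h z ≠ ⊥
  proper : (dom h).Nonempty
  lsc : LowerSemicontinuous h
  convex : Convex ℝ {q : E × ℝ | h q.1 ≤ (q.2 : EReal)}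

/-- The `ε`-subdifferential `∂_ε h(z)`. -/
def epsSubdiff (ε : ℝ) (h : E → EReal) (z : E) : Set E :=
  {w | ∀ z', h z + ((⟪w, z' - z⟫_ℝ - ε : ℝ) : EReal) ≤ h z'}

/-- The subdifferential `∂h(z) = ∂_0 h(z)`. -/
def subdiff (h : E → EReal) (z : E) : Set E := epsSubdiff 0 h z

/-- A global minimizer of `Φ` (any one; it is unique in every use made of it below). -/
def argmin (Φ : E → EReal) : E := Classical.epsilon fun y => ∀ y', Φ y ≤ Φ y'

/-- The metric projection onto a (nonempty closed convex) set. -/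
def proj (S : Set E) (x : E) : E :=
  Classical.epsilon fun p => p ∈ S ∧ ∀ q ∈ S, ‖x - p‖ ≤ ‖x - q‖

/-- The affine approximation `ℓ_ψ(z; x) = ψ(x) + ⟨∇ψ(x), z - x⟩`. The gradient is taken
relative to `D` (which will be a convex set with nonempty interior), so that it also makes sense
at boundary points of `D`; it is the usual gradient wherever `ψ` is differentiable. -/
def affineApprox [CompleteSpace E] (ψ : E → ℝ) (D : Set E) (x z : E) : ℝ :=
  ψ x + ⟪gradientWithin ψ D x, z - x⟫_ℝ

end ConvexAnalysis

/-- `log₁⁺ t = max {log t, 1}`. -/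
def logOnePlus (t : ℝ) : ℝ := max (Real.log t) 1

/-! ### The accelerated composite gradient (ACG) algorithm -/

section ACG

variable {E : Type u} [NormedAddCommGroup E] [InnerProductSpace ℝ E] [CompleteSpace E]

/-- Input of the ACG algorithm for minimizing `ψs + ψn`, started at `x0`. -/
structure ACGInput (E : Type u) where
  M : ℝ
  mu : ℝ
  psiS : E → ℝ
  psiN : E → EReal
  x0 : E
  sigmaT : ℝ

/-- The quantities `A_j, x_j, y_j, Γ_j`. -/
structure ACGState (E : Type u) where
  A : ℝ
  x : E
  y : E
  Gam : E → ℝ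

namespace ACGInput

/-- Initialization: `y_0 = x_0`, `A_0 = 0`, `Γ_0 ≡ 0`. -/
def init (I : ACGInput E) : ACGState E := ⟨0, I.x0, I.x0, fun _ => 0⟩

/-- The new value `A_j` obtained from `A = A_{j-1}`. -/
def nextA (I : ACGInput E) (A : ℝ) : ℝ :=
  A + (I.mu * A + 1 + √((I.mu * A + 1) ^ 2 + 4 * I.M * (I.mu * A + 1) * A)) / (2 * I.M)

/-- One ACG iteration. -/
def step (I : ACGInput E) (s : ACGState E) : ACGState E :=
  let A' := I.nextA s.A
  let xt : E := (s.A / A') • s.x + ((A' - s.A) / A') • s.y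
  let Gam' : E → ℝ := fun z =>
    s.A / A' * s.Gam z + (A' - s.A) / A' * affineApprox I.psiS (dom I.psiN) xt z
  let y' : E := argmin fun y =>
    ((Gam' y + 1 / (2 * A') * ‖y - I.x0‖ ^ 2 : ℝ) : EReal) + I.psiN y
  let x' : E := (s.A / A') • s.x + ((A' - s.A) / A') • y'
  ⟨A', x', y', Gam'⟩

/-- The state after `j` iterations. -/
def state (I : ACGInput E) (j : ℕ) : ACGState E := I.step^[j] I.init

/-- The `j`-th primal iterate `x_j`. -/
def x (I : ACGInput E) (j : ℕ) : E := (I.state j).x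

/-- `u_j = (y_0 - y_j) / A_j`. -/
def u (I : ACGInput E) (j : ℕ) : E := (I.state j).A⁻¹ • (I.x0 - (I.state j).y)

/-- `η_j = ψ(x_j) - Γ_j(y_j) - ψn(y_j) - ⟨u_j, x_j - y_j⟩` (all points lie in `dom ψn`). -/
def eta (I : ACGInput E) (j : ℕ) : ℝ :=
  I.psiS (I.x j) + (I.psiN (I.x j)).toReal - (I.state j).Gam (I.state j).y
    - (I.psiN (I.state j).y).toReal - ⟪I.u j, I.x j - (I.state j).y⟫_ℝ

/-- The stopping test `‖u_j‖² + 2 η_j ≤ σ̃² ‖x_0 - x_j + u_j‖²`. -/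
def Test (I : ACGInput E) (j : ℕ) : Prop :=
  ‖I.u j‖ ^ 2 + 2 * I.eta j ≤ I.sigmaT ^ 2 * ‖I.x0 - I.x j + I.u j‖ ^ 2

/-- The algorithm stops after exactly `j` iterations: `j ≥ 1` is the first index which passes
the test. Its output is then `(x_j, u_j, η_j)`. -/
def StopsAt (I : ACGInput E) (j : ℕ) : Prop :=
  1 ≤ j ∧ I.Test j ∧ ∀ i, 1 ≤ i → i < j → ¬ I.Test i

end ACGInput

end ACG

/-! ### The constrained composite problem -/

section Problem

/-- The data of the problem `inf {f(z) + h(z) : g(z) ⪯_K 0}`, with `K` a nonempty closed convex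
cone, together with the constants that occur in the assumptions on it. -/
structure Problem (E : Type u) (F : Type v) [NormedAddCommGroup F] [InnerProductSpace ℝ F] where
  f : E → ℝ
  g : E → F
  h : E → EReal
  K : ProperCone ℝ F
  Kh : ℝ
  mf : ℝ
  Lf : ℝ
  Lg : ℝ
  zbar : E
  tau : ℝ

variable {E : Type u} [NormedAddCommGroup E] [InnerProductSpace ℝ E] [CompleteSpace E]
variable {F : Type v} [NormedAddCommGroup F] [InnerProductSpace ℝ F] [CompleteSpace F]

namespace Problem

/-- `ℋ = dom h`. -/
def H (P : Problem E F) : Set E := dom P.h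

/-- The set `-K`. -/
def negK (P : Problem E F) : Set F := {y | -y ∈ P.K}

/-- The order `y₁ ⪯_K y₂`, i.e. `y₂ - y₁ ∈ K`. -/
def LeK (P : Problem E F) (y₁ y₂ : F) : Prop := y₂ - y₁ ∈ P.K

/-- The dual cone `K* = {y : ⟨y, x⟩ ≥ 0 for all x ∈ K}`. -/
def dualK (P : Problem E F) : Set F := {y | ∀ x ∈ P.K, 0 ≤ ⟪y, x⟫_ℝ}

/-- `∇f(z)` for `z ∈ ℋ`; it is taken relative to `ℋ`, so that `f` only has to be differentiable
on `ℋ`. -/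
def gradf (P : Problem E F) (z : E) : E := gradientWithin P.f P.H z

/-- `∇g(z)`, the adjoint of the derivative `g'(z)`. -/
def gradg (P : Problem E F) (z : E) : F →L[ℝ] E := ContinuousLinearMap.adjoint (fderiv ℝ P.g z)

/-- The objective `φ = f + h`. -/
def phi (P : Problem E F) (z : E) : EReal := (P.f z : EReal) + P.h z

/-- The standing assumptions on `h`, `f`, `g` and the Slater-like condition. -/
structure Assumptions (P : Problem E F) : Prop where
  h_conv : IsClosedProperConvex P.h
  Kh_pos : 0 < P.Kh
  h_lip : ∀ z ∈ P.H, ∀ z' ∈ P.H, |(P.h z').toReal - (P.h z).toReal| ≤ P.Kh * ‖z' - z‖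
  H_compact : IsCompact P.H
  f_nonconvex : ¬ ConvexOn ℝ P.H P.f
  f_diff : DifferentiableOn ℝ P.f P.H
  mf_pos : 0 < P.mf
  Lf_pos : 0 < P.Lf
  f_curv : ∀ z ∈ P.H, ∀ z' ∈ P.H,
    -(P.mf / 2) * ‖z' - z‖ ^ 2 ≤ P.f z' - P.f z - ⟪P.gradf z, z' - z⟫_ℝ
  f_lip : ∀ z ∈ P.H, ∀ z' ∈ P.H, ‖P.gradf z' - P.gradf z‖ ≤ P.Lf * ‖z' - z‖
  g_conv : ∀ z z' : E, ∀ t : ℝ, 0 ≤ t → t ≤ 1 →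
    P.LeK (P.g (t • z' + (1 - t) • z) - t • P.g z' - (1 - t) • P.g z) 0
  g_diff : Differentiable ℝ P.g
  Lg_pos : 0 < P.Lg
  g_lip : ∀ z z' : E, ‖P.gradg z' - P.gradg z‖ ≤ P.Lg * ‖z' - z‖
  zbar_mem : P.zbar ∈ interior P.H
  tau_pos : 0 < P.tau
  tau_le : P.tau ≤ 1
  zbar_feas : P.LeK (P.g P.zbar) 0
  slater : ∀ z ∈ P.H, ∀ p ∈ P.dualK,
    P.tau * ‖p‖ ≤ max ‖P.gradg z p‖ |⟪p, P.g P.zbar⟫_ℝ|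

/-! #### Constants -/

/-- The diameter `D_h` of `ℋ`. -/
def Dh (P : Problem E F) : ℝ := Metric.diam P.H

/-- `B_f^{(1)} = sup_ℋ ‖∇f‖`. -/
def Bf1 (P : Problem E F) : ℝ := sSup ((fun z => ‖P.gradf z‖) '' P.H)

/-- `B_g^{(0)} = sup_ℋ ‖g‖`. -/
def Bg0 (P : Problem E F) : ℝ := sSup ((fun z => ‖P.g z‖) '' P.H)

/-- `B_g^{(1)} = sup_ℋ ‖∇g‖`. -/
def Bg1 (P : Problem E F) : ℝ := sSup ((fun z => ‖P.gradg z‖) '' P.H)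

/-- `d̄ = dist(z̄, ∂ℋ)`. -/
def dbar (P : Problem E F) : ℝ := Metric.infDist P.zbar (frontier P.H)

/-- The optimal value `φ^* = inf {φ(z) : g(z) ⪯_K 0}`. -/
def phiUpper (P : Problem E F) : ℝ := (⨅ z ∈ {z : E | P.LeK (P.g z) 0}, P.phi z).toReal

/-- `φ_* = inf φ`. -/
def phiLower (P : Problem E F) : ℝ := (⨅ z : E, P.phi z).toReal

/-- `R_φ = φ^* - φ_* + D_h² / λ`. -/
def Rphi (P : Problem E F) (lam : ℝ) : ℝ := P.phiUpper - P.phiLower + P.Dh ^ 2 / lam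

def kappa0 (P : Problem E F) (lam σ : ℝ) : ℝ :=
  2 * (P.Kh + P.Bf1) * P.Dh
    + (σ ^ 2 / (2 * (1 - σ) ^ 2) + 2 * ((1 + σ) / (1 - σ))) * (P.Dh ^ 2 / lam)

/-- `C₀ = max {‖p₀‖, κ₀} / (min {1, d̄} τ)`. -/
def C0 (P : Problem E F) (lam σ : ℝ) (p0 : F) : ℝ :=
  max ‖p0‖ (P.kappa0 lam σ) / (min 1 P.dbar * P.tau)

def kappa1 (P : Problem E F) (lam σ : ℝ) (p0 : F) : ℝ :=
  P.Lf + max ‖p0‖ (P.kappa0 lam σ) * P.Lg / (min 1 P.dbar * P.tau)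

def kappa2 (P : Problem E F) : ℝ := P.Bg0 * P.Lg + P.Bg1 ^ 2

def kappa3 (P : Problem E F) (lam σ : ℝ) (p0 : F) : ℝ :=
  16 * (1 + 2 * σ) ^ 2 * (max ‖p0‖ (P.kappa0 lam σ)) ^ 2
    / (lam * (1 - σ ^ 2) * min 1 (P.dbar ^ 2) * P.tau ^ 2)

/-- If `B_g^{(1)} = 0` (constant `g` on `ℋ`), the first summand is `0` (division by zero). -/
def kappa4 (P : Problem E F) (lam σ : ℝ) (p0 : F) : ℝ :=
  σ * P.Dh / (lam * (1 - σ) * P.Bg1)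
    + 2 * max ‖p0‖ (P.kappa0 lam σ) / (min 1 P.dbar * P.tau)

/-- `c̄ = κ₃ / ρ̂² + κ₄ / η̂`. -/
def cbar (P : Problem E F) (lam σ : ℝ) (p0 : F) (rho eta : ℝ) : ℝ :=
  P.kappa3 lam σ p0 / rho ^ 2 + P.kappa4 lam σ p0 / eta

/-- `𝒯 = [λ(κ₁ + c₁κ₂) + 1] max {c₁, 2c̄} / c₁`. -/
def T (P : Problem E F) (lam σ c1 : ℝ) (p0 : F) (rho eta : ℝ) : ℝ :=
  (lam * (P.kappa1 lam σ p0 + c1 * P.kappa2) + 1)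
    * (max c1 (2 * P.cbar lam σ p0 rho eta) / c1)

/-! #### Augmented Lagrangian -/

/-- The smooth part of the augmented Lagrangian,
`f(z) + (dist²(p + c g(z), -K) - ‖p‖²) / (2c)`. -/
def smoothAL (P : Problem E F) (c : ℝ) (p : F) (z : E) : ℝ :=
  P.f z + 1 / (2 * c) * (Metric.infDist (p + c • P.g z) P.negK ^ 2 - ‖p‖ ^ 2)

/-- The gradient in `z` of the smooth part of the augmented Lagrangian. -/
def gradSmoothAL (P : Problem E F) (c : ℝ) (p : F) (z : E) : E :=
  gradientWithin (P.smoothAL c p) P.H z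

/-- The augmented Lagrangian at points `z ∈ ℋ`. -/
def augLag (P : Problem E F) (c : ℝ) (z : E) (p : F) : ℝ :=
  P.smoothAL c p z + (P.h z).toReal

/-- `L̃(c, p) = L_f + L_g ‖p‖ + c (B_g^{(0)} L_g + [B_g^{(1)}]²)`. -/
def Ltilde (P : Problem E F) (c : ℝ) (p : F) : ℝ :=
  P.Lf + P.Lg * ‖p‖ + c * (P.Bg0 * P.Lg + P.Bg1 ^ 2)

/-- `L^ψ = λ L̃(c, p) + 1`. -/
def Lpsi (P : Problem E F) (lam c : ℝ) (p : F) : ℝ := lam * P.Ltilde c p + 1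

/-! #### Approximate stationary quadruples -/

end Problem

/-- A quadruple `(ẑ, p̂, ŵ, q̂)`. -/
structure Quadruple (E : Type u) (F : Type v) where
  z : E
  p : F
  w : E
  q : F

/-- `(ρ̂, η̂)`-approximate stationary quadruples of the problem. -/
structure Problem.IsApproxStationary (P : Problem E F) (rho eta : ℝ) (Q : Quadruple E F) :
    Prop where
  inclusion : Q.w - P.gradf Q.z - P.gradg Q.z Q.p ∈ subdiff P.h Q.z
  compl : ⟪P.g Q.z + Q.q, Q.p⟫_ℝ = 0
  feas : P.LeK (P.g Q.z + Q.q) 0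
  dual : Q.p ∈ P.dualK
  w_le : ‖Q.w‖ ≤ rho
  q_le : ‖Q.q‖ ≤ eta

/-! ### The NL-IAPIAL method -/

/-- The state at the beginning of outer iteration `k`: the counters `k` and `k̂`, the penalty
parameter `c_k`, the pair `(z_{k-1}, p_{k-1})`, and `(z_{k̂+1}, p_{k̂+1})` (relevant only once
`k > k̂ + 1`). -/
structure OuterState (E : Type u) (F : Type v) where
  k : ℕ
  kHat : ℕ
  c : ℝ
  z : E
  p : F
  zRef : E
  pRef : F

namespace Problem

/-- Initial state. -/
def initState (c1 : ℝ) (z0 : E) (p0 : F) : OuterState E F := ⟨1, 0, c1, z0, p0, z0, p0⟩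

/-- The input of the ACG call in an outer iteration. -/
def acgInput (P : Problem E F) (lam σ : ℝ) (s : OuterState E F) : ACGInput E where
  M := P.Lpsi lam s.c s.p - 1 / 2
  mu := 1 / 2
  psiS := fun z => lam * P.smoothAL s.c s.p z + 1 / 4 * ‖z - s.z‖ ^ 2
  psiN := fun z => (lam : EReal) * P.h z + ((1 / 4 * ‖z - s.z‖ ^ 2 : ℝ) : EReal)
  x0 := s.z
  sigmaT := σ / √(P.Lpsi lam s.c s.p)

/-- The refined quadruple computed from the ACG output `(z_k, v_k)`. -/
def refine (P : Problem E F) (lam : ℝ) (s : OuterState E F) (zk vk : E) : Quadruple E F :=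
  let L := P.Lpsi lam s.c s.p
  let r : E := vk + s.z - zk
  let zhat : E := argmin fun y =>
    (lam : EReal) * (((⟪P.gradSmoothAL s.c s.p zk, y - zk⟫_ℝ : ℝ) : EReal) + P.h y)
      + ((- ⟪r, y - zk⟫_ℝ + L / 2 * ‖y - zk‖ ^ 2 : ℝ) : EReal)
  let w : E := lam⁻¹ • (r + L • (zk - zhat))
  let phat : F := proj P.dualK (s.p + s.c • P.g zhat)
  { z := zhat
    p := phat
    w := w + P.gradSmoothAL s.c s.p zhat - P.gradSmoothAL s.c s.p zk
    q := s.c⁻¹ • (s.p - phat) }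

open Classical in
/-- Multiplier update, penalty update and increase of the counter. -/
def nextState (P : Problem E F) (lam σ rho : ℝ) (s : OuterState E F) (zk : E) :
    OuterState E F :=
  let pk : F := proj P.dualK (s.p + s.c • P.g zk)
  let zRef : E := if s.k = s.kHat + 1 then zk else s.zRef
  let pRef : F := if s.k = s.kHat + 1 then pk else s.pRef
  let Delta : ℝ := 1 / ((s.k : ℝ) - s.kHat - 1) * (P.augLag s.c zRef pRef - P.augLag s.c zk pk)
  if s.kHat + 1 < s.k ∧
      Delta ≤ lam * (1 - σ ^ 2) * rho ^ 2 / (4 * (1 + 2 * σ) ^ 2) then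
    ⟨s.k + 1, s.k, 2 * s.c, zk, pk, zRef, pRef⟩
  else
    ⟨s.k + 1, s.kHat, s.c, zk, pk, zRef, pRef⟩

/-- `P.Run lam σ rho eta s N Q`: started from the state `s`, the (deterministic) method
terminates with output `Q` after a total of exactly `N` inner (ACG) iterations. -/
inductive Run (P : Problem E F) (lam σ rho eta : ℝ) :
    OuterState E F → ℕ → Quadruple E F → Prop
  | done (s : OuterState E F) (j : ℕ) :
      (P.acgInput lam σ s).StopsAt j →
      ‖(P.refine lam s ((P.acgInput lam σ s).x j) ((P.acgInput lam σ s).u j)).w‖ ≤ rho →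
      ‖(P.refine lam s ((P.acgInput lam σ s).x j) ((P.acgInput lam σ s).u j)).q‖ ≤ eta →
      Run P lam σ rho eta s j
        (P.refine lam s ((P.acgInput lam σ s).x j) ((P.acgInput lam σ s).u j))
  | proceed (s : OuterState E F) (j N : ℕ) (Q : Quadruple E F) :
      (P.acgInput lam σ s).StopsAt j →
      ¬ (‖(P.refine lam s ((P.acgInput lam σ s).x j) ((P.acgInput lam σ s).u j)).w‖ ≤ rho ∧
        ‖(P.refine lam s ((P.acgInput lam σ s).x j) ((P.acgInput lam σ s).u j)).q‖ ≤ eta) →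
      Run P lam σ rho eta (P.nextState lam σ rho s ((P.acgInput lam σ s).x j)) N Q →
      Run P lam σ rho eta s (j + N) Q

end Problem

end Problem

end

end NLIAPIAL

/-!
Why the theorem is true.

Write `Π` for the projection onto `K*`. By Moreau's decomposition `½ dist²(·, -K) = ½ ‖Π ·‖²`, a
convex function with gradient `Π`. Hence the smooth part of the augmented Lagrangian has the
gradient `∇f + ∇g Π(p + c g)`, which is `L̃(c, p)`-Lipschitz on `ℋ`
(`Assumptions.gradAL_lipschitz`), and `K`-convexity of `g` makes it no less convex than `f`
(`Assumptions.le_smoothAL`). As `λ m_f ≤ ½`, each ACG call minimizes the sum of a convex function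
with Lipschitz gradient and a `½`-strongly convex one (`Assumptions.acg_regular`).

*Inner iterations.* The estimate-sequence invariant `ACGInput.Inv` says that `A_j ψ(x_j)` is at most
the minimum of the model `A_j (Γ_j + ψₙ) + ½ ‖· - x₀‖²`. So the residual pair is `O(1 / A_j)`
relative to `‖x_j - x₀‖`, and since `A_j` grows geometrically with ratio `1 + √(μ/M)`, the stopping
test holds after `O(√L log₁⁺ L)` iterations (`ACGInput.exists_stopsAt_le`).

*One outer iteration.* The output of ACG is an inexact proximal point (`InexactProx`). The refined
point `ẑ` comes from a proximal gradient step with step size `1/L`, so that `L ‖ẑ - z‖ ≤ σ ‖r‖`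
and the residual `ŵ` is at most `(1 + 2σ) ‖r‖ / λ`; its optimality condition holds exactly at `ẑ`
and up to `ε` at `z` (`InexactProx.refine_spec`). Testing the condition at `z` with a point of the
ball inscribed in `ℋ` around `z̄`, the Slater-like assumption yields
`min{1, d̄} τ ‖p⁺‖ + ‖p⁺‖ (‖p⁺‖ - ‖p‖) / c ≤ κ₀` (`InexactProx.multiplier_estimate`), which keeps
all multipliers in the ball of radius `C₀` (`InexactProx.norm_multiplier_le`).

*Outer iterations.* A proximal step lowers `ℒ_c(·; p)` by a multiple of `‖r‖²`, and the multiplier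
update raises it by at most `4 C₀² / c`. If `c ≥ c̄` and the method does not stop, the sum of the two
is a decrease by more than the threshold of the doubling test (`InexactProx.threshold_lt`), so that
the penalty is never doubled beyond `2 c̄`. For every `c` the value of `ℒ_c` can drop by at most
`O(R_φ + C₀² / c₁)` within a cycle of constant penalty, which bounds the length of a cycle by
`O(R_φ / (λ ρ̂²))`. The costs of the cycles are proportional to `√c`, that is, they grow
geometrically and are dominated by the last one; a potential function (`OuterInv.step`)
does this bookkeeping, and `exists_run` is the resulting count. The second part of the theorem is
the first for a suitable `M`, since `𝒯 = O(1 + ρ̂⁻² + η̂⁻¹)` for a fixed problem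
(`tolerance_bound`).
-/

set_option linter.unusedSectionVars false

namespace NLIAPIAL

/-! ### Convex analysis relative to a convex set -/

section Generic

variable {E : Type u} [NormedAddCommGroup E] [InnerProductSpace ℝ E]

theorem strongConvexOn_half_sq {s : Set E} (hs : Convex ℝ s) (m : ℝ) (c : E) :
    StrongConvexOn s m (fun u => m / 2 * ‖u - c‖ ^ 2) := by
  refine ⟨hs, fun x _ y _ a b _ _ hab => ?_⟩
  have hb : b = 1 - a := by linarith
  have h1 : a • x + b • y - c = a • (x - c) + b • (y - c) := by
    rw [hb]; module
  have h2 : x - y = (x - c) - (y - c) := by abel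
  simp only [smul_eq_mul]
  rw [h1, h2, norm_add_sq_real, norm_sub_sq_real (x - c) (y - c), norm_smul, norm_smul, inner_smul_left,
    inner_smul_right, mul_pow, mul_pow, Real.norm_eq_abs, Real.norm_eq_abs, sq_abs, sq_abs, hb]
  simp only [conj_trivial]
  apply le_of_eq
  ring

/-- Quadratic growth of a strongly convex function away from a minimizer. -/
theorem add_half_sq_le_of_isMinOn {s : Set E} {m : ℝ} {F : E → ℝ} (hF : StrongConvexOn s m F)
    {y : E} (hy : y ∈ s) (hmin : ∀ u ∈ s, F y ≤ F u) {u : E} (hu : u ∈ s) :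
    F y + m / 2 * ‖u - y‖ ^ 2 ≤ F u := by
  have key : ∀ t ∈ Set.Ioo (0 : ℝ) 1, F y + (1 - t) * (m / 2 * ‖u - y‖ ^ 2) ≤ F u := by
    intro t ht
    have h1 := hF.2 hu hy ht.1.le (sub_nonneg.2 ht.2.le) (by ring)
    have h2 := hmin _ (hF.1 hu hy ht.1.le (sub_nonneg.2 ht.2.le) (by ring))
    simp only [smul_eq_mul] at h1
    have h3 : 0 ≤ t * (F u - (F y + (1 - t) * (m / 2 * ‖u - y‖ ^ 2))) := by nlinarith
    have := nonneg_of_mul_nonneg_right h3 ht.1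
    linarith
  have ht : Filter.Tendsto (fun t : ℝ => F y + (1 - t) * (m / 2 * ‖u - y‖ ^ 2))
      (nhdsWithin 0 (Set.Ioo 0 1)) (nhds (F y + (1 - 0) * (m / 2 * ‖u - y‖ ^ 2))) := by
    apply Filter.Tendsto.mono_left _ nhdsWithin_le_nhds
    exact Continuous.tendsto (by fun_prop) 0
  have : (nhdsWithin (0 : ℝ) (Set.Ioo 0 1)).NeBot := by
    rw [nhdsWithin_Ioo_eq_nhdsGT one_pos]; infer_instance
  have := le_of_tendsto ht (Filter.eventually_of_mem self_mem_nhdsWithin key)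
  simpa using this

/-- A function which agrees with a continuous real function on a nonempty compact set and is `⊤`
elsewhere attains its minimum, so that `argmin` is an actual minimizer. -/
theorem argmin_spec {Φ : E → EReal} {H : Set E} {r : E → ℝ} (hH : IsCompact H)
    (hne : H.Nonempty) (hr : ContinuousOn r H) (hΦ : ∀ y ∈ H, Φ y = r y)
    (hΦ' : ∀ y, y ∉ H → Φ y = ⊤) :
    argmin Φ ∈ H ∧ ∀ u ∈ H, r (argmin Φ) ≤ r u := by
  obtain ⟨a, ha, hmin⟩ := hH.exists_isMinOn hne hr
  have hex : ∃ y, ∀ y', Φ y ≤ Φ y' := by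
    refine ⟨a, fun y' => ?_⟩
    by_cases hy : y' ∈ H
    · rw [hΦ a ha, hΦ y' hy]; exact_mod_cast hmin hy
    · rw [hΦ' y' hy]; exact le_top
  have hs : ∀ y', Φ (argmin Φ) ≤ Φ y' := Classical.epsilon_spec hex
  have hmem : argmin Φ ∈ H := by
    by_contra hn
    have := hs a
    rw [hΦ' _ hn, hΦ a ha] at this
    exact absurd this (by simp)
  refine ⟨hmem, fun u hu => ?_⟩
  have := hs u
  rw [hΦ _ hmem, hΦ u hu] at this
  exact_mod_cast this

/-- Convexity of the epigraph, read off from the finite values. -/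
theorem convexOn_toReal_dom {h : E → EReal} (hh : IsClosedProperConvex h) :
    ConvexOn ℝ (dom h) (fun z => (h z).toReal) := by
  have hcoe : ∀ z ∈ dom h, ((h z).toReal : EReal) = h z := fun z hz =>
    EReal.coe_toReal (ne_of_lt hz) (hh.ne_bot z)
  have key : ∀ x ∈ dom h, ∀ y ∈ dom h, ∀ a b : ℝ, 0 ≤ a → 0 ≤ b → a + b = 1 →
      h (a • x + b • y) ≤ ((a * (h x).toReal + b * (h y).toReal : ℝ) : EReal) := by
    intro x hx y hy a b ha hb hab
    have := hh.convex (x := (x, (h x).toReal)) (by simp [hcoe x hx])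
      (y := (y, (h y).toReal)) (by simp [hcoe y hy]) ha hb hab
    simpa using this
  have hconv : Convex ℝ (dom h) := fun x hx y hy a b ha hb hab =>
    (key x hx y hy a b ha hb hab).trans_lt (EReal.coe_lt_top _)
  refine ⟨hconv, fun x hx y hy a b ha hb hab => ?_⟩
  have := key x hx y hy a b ha hb hab
  rw [← hcoe _ (hconv hx hy ha hb hab)] at this
  simpa using (by exact_mod_cast this : (h (a • x + b • y)).toReal ≤ _)

variable [CompleteSpace E]

theorem HasGradientWithinAt.gradientWithin_eq {ψ : E → ℝ} {G : E} {D : Set E} {x : E}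
    (hψ : HasGradientWithinAt ψ G D x) (hD : UniqueDiffWithinAt ℝ D x) :
    gradientWithin ψ D x = G := by
  have := hψ.hasFDerivWithinAt.fderivWithin hD
  rw [gradientWithin, this]; simp

theorem hasDerivWithinAt_segment {H : Set E} (hH : Convex ℝ H) {ψ : E → ℝ} {G : E → E}
    (hψ : ∀ z ∈ H, HasGradientWithinAt ψ (G z) H z) {z z' : E} (hz : z ∈ H) (hz' : z' ∈ H)
    {t : ℝ} (ht : t ∈ Set.Icc (0 : ℝ) 1) :
    HasDerivWithinAt (fun t : ℝ => ψ (z + t • (z' - z))) ⟪G (z + t • (z' - z)), z' - z⟫_ℝ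
      (Set.Icc 0 1) t := by
  have hmem : ∀ s ∈ Set.Icc (0 : ℝ) 1, z + s • (z' - z) ∈ H := fun s hs =>
    hH.add_smul_sub_mem hz hz' hs
  have h1 := (hψ _ (hmem t ht)).hasFDerivWithinAt
  have h2 : HasDerivWithinAt (fun t : ℝ => z + t • (z' - z)) (z' - z) (Set.Icc 0 1) t := by
    simpa using (((hasDerivAt_id t).smul_const (z' - z)).const_add z).hasDerivWithinAt
  exact h1.comp_hasDerivWithinAt t h2 hmem

/-- The descent lemma on a convex set, with gradients taken relative to that set. -/
theorem le_add_half_sq_of_lipschitz_gradient {H : Set E} (hH : Convex ℝ H) {ψ : E → ℝ} {G : E → E}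
    (hψ : ∀ z ∈ H, HasGradientWithinAt ψ (G z) H z) {L : ℝ}
    (hL : ∀ z ∈ H, ∀ z' ∈ H, ‖G z' - G z‖ ≤ L * ‖z' - z‖) {z z' : E} (hz : z ∈ H) (hz' : z' ∈ H) :
    ψ z' ≤ ψ z + ⟪G z, z' - z⟫_ℝ + L / 2 * ‖z' - z‖ ^ 2 := by
  set d := z' - z with hd
  let F : ℝ → ℝ := fun t => ψ (z + t • d) - t * ⟪G z, d⟫_ℝ - L / 2 * ‖d‖ ^ 2 * t ^ 2
  have hF : ∀ t ∈ Set.Icc (0 : ℝ) 1, HasDerivWithinAt F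
      (⟪G (z + t • d), d⟫_ℝ - ⟪G z, d⟫_ℝ - L * ‖d‖ ^ 2 * t) (Set.Icc 0 1) t := by
    intro t ht
    have h1 := hasDerivWithinAt_segment hH hψ hz hz' ht
    have h2 : HasDerivAt (fun t : ℝ => t * ⟪G z, d⟫_ℝ) ⟪G z, d⟫_ℝ t := by
      simpa using (hasDerivAt_id t).mul_const ⟪G z, d⟫_ℝ
    have h3 : HasDerivAt (fun t : ℝ => L / 2 * ‖d‖ ^ 2 * t ^ 2) (L * ‖d‖ ^ 2 * t) t := by
      refine ((hasDerivAt_pow 2 t).const_mul (L / 2 * ‖d‖ ^ 2)).congr_deriv ?_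
      push_cast; ring
    exact (h1.sub h2.hasDerivWithinAt).sub h3.hasDerivWithinAt
  have hanti : AntitoneOn F (Set.Icc 0 1) := by
    apply antitoneOn_of_deriv_nonpos (convex_Icc 0 1)
    · exact fun t ht => (hF t ht).continuousWithinAt
    · intro t ht
      rw [interior_Icc] at ht
      exact ((hF t (Set.Ioo_subset_Icc_self ht)).hasDerivAt
        (Icc_mem_nhds ht.1 ht.2)).differentiableAt.differentiableWithinAt
    · intro t ht
      rw [interior_Icc] at ht
      rw [((hF t (Set.Ioo_subset_Icc_self ht)).hasDerivAt (Icc_mem_nhds ht.1 ht.2)).deriv]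
      have hm := hH.add_smul_sub_mem hz hz' (Set.Ioo_subset_Icc_self ht)
      have h1 := hL z hz _ hm
      have h2 : ⟪G (z + t • d) - G z, d⟫_ℝ ≤ ‖G (z + t • d) - G z‖ * ‖d‖ := real_inner_le_norm _ _
      rw [inner_sub_left] at h2
      have h3 : ‖z + t • (z' - z) - z‖ = t * ‖d‖ := by
        rw [add_sub_cancel_left, norm_smul, Real.norm_of_nonneg ht.1.le]
      rw [h3] at h1
      have h4 := mul_le_mul_of_nonneg_right h1 (norm_nonneg d)
      nlinarith
  have := hanti (Set.left_mem_Icc.2 zero_le_one) (Set.right_mem_Icc.2 zero_le_one) zero_le_one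
  simp only [F, one_smul, zero_smul, add_zero, hd, add_sub_cancel] at this
  rw [← hd] at this
  nlinarith

end Generic

/-! ### Moreau decomposition for a cone and its dual -/

section Moreau

variable {F : Type v} [NormedAddCommGroup F] [InnerProductSpace ℝ F] [CompleteSpace F]

theorem proj_spec {S : Set F} (hc : Convex ℝ S) (hcl : IsClosed S) (hne : S.Nonempty) (x : F) :
    proj S x ∈ S ∧ ∀ q ∈ S, ⟪x - proj S x, q - proj S x⟫_ℝ ≤ 0 := by
  have hex : ∃ p, p ∈ S ∧ ∀ q ∈ S, ‖x - p‖ ≤ ‖x - q‖ := by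
    obtain ⟨p, hp, he⟩ := exists_norm_eq_iInf_of_complete_convex hne hcl.isComplete hc x
    refine ⟨p, hp, fun q hq => ?_⟩
    rw [he]
    exact ciInf_le ⟨0, Set.forall_mem_range.2 fun _ => norm_nonneg _⟩ (⟨q, hq⟩ : S)
  obtain ⟨h1, h2⟩ : proj S x ∈ S ∧ ∀ q ∈ S, ‖x - proj S x‖ ≤ ‖x - q‖ := Classical.epsilon_spec hex
  refine ⟨h1, (norm_eq_iInf_iff_real_inner_le_zero hc h1).1 ?_⟩
  have : Nonempty S := ⟨⟨_, h1⟩⟩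
  refine le_antisymm (le_ciInf fun q => h2 q q.2) ?_
  exact ciInf_le ⟨0, Set.forall_mem_range.2 fun _ => norm_nonneg _⟩ (⟨_, h1⟩ : S)

end Moreau

namespace Problem

section Moreau

variable {E : Type u} {F : Type v} [NormedAddCommGroup F] [InnerProductSpace ℝ F]
  [CompleteSpace F] (P : Problem E F)

theorem dualK_eq_innerDual : P.dualK = (ProperCone.innerDual (P.K : Set F) : Set F) := by
  ext y
  simp only [dualK, Set.mem_ofPred_eq, SetLike.mem_coe, ProperCone.mem_innerDual]
  exact ⟨fun h x hx => by rw [real_inner_comm]; exact h x hx,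
    fun h x hx => by rw [real_inner_comm]; exact h hx⟩

theorem proj_dualK_spec (y : F) : proj P.dualK y ∈ P.dualK ∧
    ∀ q ∈ P.dualK, ⟪y - proj P.dualK y, q - proj P.dualK y⟫_ℝ ≤ 0 := by
  apply proj_spec
  · intro p hp q hq a b ha hb _ x hx
    rw [inner_add_left, inner_smul_left, inner_smul_left]
    exact add_nonneg (mul_nonneg ha (hp x hx)) (mul_nonneg hb (hq x hx))
  · rw [dualK_eq_innerDual]; exact (ProperCone.innerDual (P.K : Set F)).isClosed
  · exact ⟨0, fun x _ => by simp⟩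

theorem proj_mem (y : F) : proj P.dualK y ∈ P.dualK := (P.proj_dualK_spec y).1

theorem inner_sub_proj_self (y : F) : ⟪y - proj P.dualK y, proj P.dualK y⟫_ℝ = 0 := by
  have h0 := (P.proj_dualK_spec y).2 0 (fun x _ => by simp)
  have h2 := (P.proj_dualK_spec y).2 ((2 : ℝ) • proj P.dualK y) (fun x hx => by
    rw [inner_smul_left]
    exact mul_nonneg (by simp) (P.proj_mem y x hx))
  have : (2 : ℝ) • proj P.dualK y - proj P.dualK y = proj P.dualK y := by rw [two_smul]; abel
  rw [this] at h2
  simp only [zero_sub, inner_neg_right] at h0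
  linarith

theorem inner_sub_proj_le (y : F) {q : F} (hq : q ∈ P.dualK) : ⟪y - proj P.dualK y, q⟫_ℝ ≤ 0 := by
  have h := (P.proj_dualK_spec y).2 q hq
  rw [inner_sub_right, P.inner_sub_proj_self] at h
  linarith

theorem sub_proj_mem_negK (y : F) : y - proj P.dualK y ∈ P.negK := by
  change -(y - proj P.dualK y) ∈ P.K
  rw [← ProperCone.innerDual_innerDual P.K, ProperCone.mem_innerDual]
  intro q hq
  rw [← dualK_eq_innerDual] at hq
  have := P.inner_sub_proj_le y hq
  rw [inner_neg_right, real_inner_comm]; linarith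

theorem infDist_negK_le {y s : F} (hs : s ∈ P.negK) : Metric.infDist y P.negK ≤ ‖y - s‖ := by
  rw [← dist_eq_norm]; exact Metric.infDist_le_dist_of_mem hs

theorem inner_proj_le_of_mem_negK (y : F) {s : F} (hs : s ∈ P.negK) :
    ⟪proj P.dualK y, s⟫_ℝ ≤ 0 := by
  have := P.proj_mem y (-s) hs
  rw [inner_neg_right] at this; linarith

/-- Moreau: the distance to `-K` is the norm of the projection onto `K*`. -/
theorem infDist_negK (y : F) : Metric.infDist y P.negK = ‖proj P.dualK y‖ := by
  apply le_antisymm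
  · simpa using P.infDist_negK_le (y := y) (P.sub_proj_mem_negK y)
  · refine (Metric.le_infDist ⟨_, P.sub_proj_mem_negK y⟩).2 fun s hs => ?_
    rw [dist_eq_norm]
    have h1 := P.inner_proj_le_of_mem_negK y hs
    have h2 := P.inner_sub_proj_self y
    have h3 : ‖proj P.dualK y‖ ^ 2 ≤ ⟪proj P.dualK y, y - s⟫_ℝ := by
      rw [inner_sub_left, real_inner_self_eq_norm_sq, real_inner_comm] at h2
      rw [inner_sub_right]
      linarith
    have h4 := real_inner_le_norm (proj P.dualK y) (y - s)
    rcases (norm_nonneg (proj P.dualK y)).eq_or_lt with h | h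
    · rw [← h]; exact norm_nonneg _
    · exact le_of_mul_le_mul_left (by nlinarith) h

theorem inner_proj_self (y : F) : ⟪proj P.dualK y, y⟫_ℝ = ‖proj P.dualK y‖ ^ 2 := by
  have h2 := P.inner_sub_proj_self y
  rw [inner_sub_left, real_inner_self_eq_norm_sq, real_inner_comm] at h2
  linarith

theorem norm_proj_le (y : F) : ‖proj P.dualK y‖ ≤ ‖y‖ := by
  have h1 := P.inner_proj_self y
  have h4 := real_inner_le_norm (proj P.dualK y) y
  rcases (norm_nonneg (proj P.dualK y)).eq_or_lt with h | h
  · rw [← h]; exact norm_nonneg _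
  · exact le_of_mul_le_mul_left (by nlinarith) h

theorem norm_proj_sub_le (y y' : F) : ‖proj P.dualK y' - proj P.dualK y‖ ≤ ‖y' - y‖ := by
  have h1 := (P.proj_dualK_spec y).2 _ (P.proj_mem y')
  have h2 := (P.proj_dualK_spec y').2 _ (P.proj_mem y)
  set a := proj P.dualK y
  set b := proj P.dualK y'
  have h3 : ‖b - a‖ ^ 2 ≤ ⟪y' - y, b - a⟫_ℝ := by
    have e1 : ⟪y' - b, a - b⟫_ℝ = -⟪y' - b, b - a⟫_ℝ := by rw [← inner_neg_right]; congr 1; abel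
    have e2 : ⟪y' - y, b - a⟫_ℝ = ⟪y' - b, b - a⟫_ℝ + ⟪b - a, b - a⟫_ℝ - ⟪y - a, b - a⟫_ℝ := by
      rw [← inner_add_left, ← inner_sub_left]; congr 1; abel
    rw [real_inner_self_eq_norm_sq] at e2
    linarith
  have h4 := real_inner_le_norm (y' - y) (b - a)
  rcases (norm_nonneg (b - a)).eq_or_lt with h | h
  · rw [← h]; exact norm_nonneg _
  · exact le_of_mul_le_mul_right (by nlinarith) h

/-- Upper quadratic estimate for `½ dist²(·, -K)`, whose gradient is the projection onto `K*`. -/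
theorem sq_norm_proj_le (y y' : F) : ‖proj P.dualK y'‖ ^ 2 ≤
    ‖proj P.dualK y‖ ^ 2 + 2 * ⟪proj P.dualK y, y' - y⟫_ℝ + ‖y' - y‖ ^ 2 := by
  have h := P.infDist_negK_le (y := y') (P.sub_proj_mem_negK y)
  rw [P.infDist_negK] at h
  have e : y' - (y - proj P.dualK y) = proj P.dualK y + (y' - y) := by abel
  rw [e] at h
  have := pow_le_pow_left₀ (norm_nonneg _) h 2
  rwa [norm_add_sq_real] at this

/-- Gradient inequality for the convex function `½ dist²(·, -K)`. -/
theorem le_sq_norm_proj (y y' : F) :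
    ‖proj P.dualK y‖ ^ 2 + 2 * ⟪proj P.dualK y, y' - y⟫_ℝ ≤ ‖proj P.dualK y'‖ ^ 2 := by
  have h1 := P.inner_proj_le_of_mem_negK y (P.sub_proj_mem_negK y')
  have h2 := P.inner_proj_self y
  rw [inner_sub_right] at h1 ⊢
  have h3 : 0 ≤ ‖proj P.dualK y' - proj P.dualK y‖ ^ 2 := by positivity
  rw [norm_sub_sq_real, real_inner_comm] at h3
  nlinarith

end Moreau

end Problem

theorem StrongConvexOn.add {E : Type u} [NormedAddCommGroup E] [InnerProductSpace ℝ E] {s : Set E}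
    {m n : ℝ} {f g : E → ℝ} (hf : StrongConvexOn s m f) (hg : StrongConvexOn s n g) :
    StrongConvexOn s (m + n) (fun z => f z + g z) := by
  refine UniformConvexOn.mono (fun r => ?_) (UniformConvexOn.add hf hg)
  simp only [Pi.add_apply]
  apply le_of_eq; ring

/-! ### Convergence of the ACG algorithm -/

namespace ACGInput

variable {E : Type u} [NormedAddCommGroup E] [InnerProductSpace ℝ E] [CompleteSpace E]

/-- What the analysis of ACG needs to know of its input: `ψₙ` is finite, continuous and
`μ`-strongly convex on the compact set `dom ψₙ`, and on that set `ψₛ` lies between its affine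
approximations and these approximations plus `M/2 ‖· - x‖²`. -/
structure Regular (I : ACGInput E) : Prop where
  M_pos : 0 < I.M
  mu_pos : 0 < I.mu
  x0_mem : I.x0 ∈ dom I.psiN
  compact : IsCompact (dom I.psiN)
  coe : ∀ z ∈ dom I.psiN, ((I.psiN z).toReal : EReal) = I.psiN z
  cont : ContinuousOn (fun z => (I.psiN z).toReal) (dom I.psiN)
  strong : StrongConvexOn (dom I.psiN) I.mu (fun z => (I.psiN z).toReal)
  lower : ∀ x ∈ dom I.psiN, ∀ z ∈ dom I.psiN, affineApprox I.psiS (dom I.psiN) x z ≤ I.psiS z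
  upper : ∀ x ∈ dom I.psiN, ∀ z ∈ dom I.psiN,
    I.psiS z ≤ affineApprox I.psiS (dom I.psiN) x z + I.M / 2 * ‖z - x‖ ^ 2

/-- The estimate-sequence invariant of ACG: `y` minimizes the strongly convex model
`A (Γ + ψₙ) + ½ ‖· - x₀‖²`, and the minimal value is at least `A ψ(x)`. -/
structure Inv (I : ACGInput E) (s : ACGState E) : Prop where
  A_nonneg : 0 ≤ s.A
  x_mem : s.x ∈ dom I.psiN
  y_mem : s.y ∈ dom I.psiN
  Gam_convex : ConvexOn ℝ (dom I.psiN) s.Gam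
  Gam_cont : Continuous s.Gam
  Gam_le : ∀ z ∈ dom I.psiN, s.A * s.Gam z ≤ s.A * I.psiS z
  model : ∀ z ∈ dom I.psiN,
    s.A * (s.Gam s.y + (I.psiN s.y).toReal) + 1 / 2 * ‖s.y - I.x0‖ ^ 2
        + (1 + I.mu * s.A) / 2 * ‖z - s.y‖ ^ 2
      ≤ s.A * (s.Gam z + (I.psiN z).toReal) + 1 / 2 * ‖z - I.x0‖ ^ 2
  value : s.A * (I.psiS s.x + (I.psiN s.x).toReal)
      ≤ s.A * (s.Gam s.y + (I.psiN s.y).toReal) + 1 / 2 * ‖s.y - I.x0‖ ^ 2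

variable {I : ACGInput E}

theorem inv_init (hI : I.Regular) : I.Inv I.init where
  A_nonneg := le_rfl
  x_mem := hI.x0_mem
  y_mem := hI.x0_mem
  Gam_convex := convexOn_const 0 hI.strong.1
  Gam_cont := continuous_const
  Gam_le := by simp [init]
  model := by simp [init]
  value := by simp [init]

/-- The step size `a = A_j - A_{j-1}` is the positive root of `M a² = (1 + μ A_{j-1}) A_j`. -/
theorem nextA_spec (hM : 0 < I.M) (hmu : 0 < I.mu) {A : ℝ} (hA : 0 ≤ A) :
    A < I.nextA A ∧ I.M * (I.nextA A - A) ^ 2 = (1 + I.mu * A) * I.nextA A ∧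
      (1 + √(I.mu / I.M)) * A ≤ I.nextA A := by
  have ht : 0 < I.mu * A + 1 := by positivity
  have hD : 0 ≤ (I.mu * A + 1) ^ 2 + 4 * I.M * (I.mu * A + 1) * A := by positivity
  set S := √((I.mu * A + 1) ^ 2 + 4 * I.M * (I.mu * A + 1) * A) with hS
  have hS2 : S ^ 2 = (I.mu * A + 1) ^ 2 + 4 * I.M * (I.mu * A + 1) * A := Real.sq_sqrt hD
  have hS0 : 0 ≤ S := Real.sqrt_nonneg _
  have ha : I.nextA A - A = (I.mu * A + 1 + S) / (2 * I.M) := by simp [nextA, hS]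
  have ha' : (I.nextA A - A) * (2 * I.M) = I.mu * A + 1 + S := by
    rw [ha]; field_simp
  have hpos : 0 < I.nextA A - A := by rw [ha]; positivity
  refine ⟨by linarith, ?_, ?_⟩
  · have : I.nextA A = A + (I.mu * A + 1 + S) / (2 * I.M) := by linarith
    rw [ha, this]
    field_simp
    nlinarith
  · have h1 : 2 * I.M * √(I.mu / I.M) * A ≤ S := by
      rw [hS]
      apply Real.le_sqrt_of_sq_le
      have : √(I.mu / I.M) ^ 2 = I.mu / I.M := Real.sq_sqrt (by positivity)
      have e : (2 * I.M * √(I.mu / I.M) * A) ^ 2 = 4 * I.M * (I.mu * A) * A := by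
        rw [mul_pow, mul_pow, this]; field_simp; ring
      rw [e]
      have : 0 ≤ I.M * A := by positivity
      nlinarith [sq_nonneg (I.mu * A + 1)]
    have h2 : √(I.mu / I.M) * A * (2 * I.M) ≤ (I.nextA A - A) * (2 * I.M) := by
      rw [ha']; linarith
    have := le_of_mul_le_mul_right h2 (by positivity)
    linarith

theorem nextA_zero (hM : 0 < I.M) : I.nextA 0 = 1 / I.M := by
  simp [nextA]; field_simp; norm_num

theorem inv_step (hI : I.Regular) {s : ACGState E} (hs : I.Inv s) : I.Inv (I.step s) := by
  set H := dom I.psiN with hH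
  have hHc : Convex ℝ H := hI.strong.1
  obtain ⟨hlt, hquad, -⟩ := nextA_spec hI.M_pos hI.mu_pos hs.A_nonneg
  set A' := I.nextA s.A with hA'
  have hA0 := hs.A_nonneg
  have hApos : 0 < A' := hA0.trans_lt hlt
  set a := A' - s.A with ha
  have hapos : 0 < a := by rw [ha]; linarith
  have hα : 0 ≤ s.A / A' := by positivity
  have hβ : 0 ≤ a / A' := by positivity
  have hαβ : s.A / A' + a / A' = 1 := by rw [ha]; field_simp; ring
  set xt : E := (s.A / A') • s.x + (a / A') • s.y with hxt
  have hxtm : xt ∈ H := hHc hs.x_mem hs.y_mem hα hβ hαβ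
  set Gam' : E → ℝ := fun z => s.A / A' * s.Gam z + a / A' * affineApprox I.psiS H xt z with hG
  have haff : ConvexOn ℝ H (affineApprox I.psiS H xt) := by
    refine ⟨hHc, fun x _ y _ p q _ _ hpq => le_of_eq ?_⟩
    have e : p • x + q • y - xt = p • (x - xt) + q • (y - xt) := by
      have : q = 1 - p := by linarith
      rw [this]; module
    simp only [affineApprox, e, inner_add_right, inner_smul_right, smul_eq_mul]
    linear_combination (-(I.psiS xt)) * hpq
  have hGconv : ConvexOn ℝ H Gam' := by
    exact (hs.Gam_convex.smul hα).add (haff.smul hβ)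
  have hGcont : Continuous Gam' := by
    have := hs.Gam_cont
    simp only [Gam', affineApprox]
    fun_prop
  set N : E → ℝ := fun z => (I.psiN z).toReal with hN
  set r : E → ℝ := fun z => Gam' z + 1 / A' / 2 * ‖z - I.x0‖ ^ 2 + N z with hr
  set y' : E := argmin fun y =>
    ((Gam' y + 1 / (2 * A') * ‖y - I.x0‖ ^ 2 : ℝ) : EReal) + I.psiN y with hy'
  have hmin : y' ∈ H ∧ ∀ u ∈ H, r y' ≤ r u := by
    apply argmin_spec hI.compact ⟨_, hI.x0_mem⟩
    · have := hI.cont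
      simp only [r, N]
      fun_prop
    · intro y hy
      rw [← hI.coe y hy, ← EReal.coe_add]
      congr 1
      simp only [r, N]
      have e : 1 / (2 * A') = 1 / A' / 2 := by field_simp
      rw [e]
    · intro y hy
      have : I.psiN y = ⊤ := by
        by_contra h
        exact hy (lt_top_iff_ne_top.2 h)
      rw [this, EReal.add_top_of_ne_bot (EReal.coe_ne_bot _)]
  obtain ⟨hym, hymin⟩ := hmin
  have hrs : StrongConvexOn H (0 + 1 / A' + I.mu) r :=
    StrongConvexOn.add (StrongConvexOn.add (strongConvexOn_zero.2 hGconv)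
      (strongConvexOn_half_sq hHc _ _)) hI.strong
  have hgrow := fun u (hu : u ∈ H) => add_half_sq_le_of_isMinOn hrs hym hymin hu
  set x' : E := (s.A / A') • s.x + (a / A') • y' with hx'
  have hx'm : x' ∈ H := hHc hs.x_mem hym hα hβ hαβ
  have hstep : I.step s = ⟨A', x', y', Gam'⟩ := rfl
  have hGA : ∀ z, A' * Gam' z = s.A * s.Gam z + a * affineApprox I.psiS H xt z := by
    intro z; simp only [Gam']; field_simp
  rw [hstep]
  refine ⟨hApos.le, hx'm, hym, hGconv, hGcont, ?_, ?_, ?_⟩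
  · intro z hz
    change A' * Gam' z ≤ A' * I.psiS z
    rw [hGA]
    have h1 := hs.Gam_le z hz
    have h2 := mul_le_mul_of_nonneg_left (hI.lower xt hxtm z hz) hapos.le
    have : A' = s.A + a := by rw [ha]; ring
    rw [this]; linarith
  · intro z hz
    have := mul_le_mul_of_nonneg_left (hgrow z hz) hApos.le
    simp only [r] at this
    field_simp at this ⊢
    simp only [N] at this
    linarith
  · change A' * (I.psiS x' + N x') ≤ A' * (Gam' y' + N y') + 1 / 2 * ‖y' - I.x0‖ ^ 2
    -- the old model bounds the new one from below at `y'`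
    have h1 := hs.model y' hym
    have h2 := hs.value
    have h3 := mul_le_mul_of_nonneg_left (hI.lower xt hxtm s.x hs.x_mem) hA0
    have h4 := mul_le_mul_of_nonneg_left (hI.upper xt hxtm x' hx'm) hApos.le
    have hNconv : A' * N x' ≤ s.A * N s.x + a * N y' := by
      have h := (hI.strong.convexOn fun _ => by have := hI.mu_pos; simp; positivity).2 hs.x_mem hym hα hβ hαβ
      have := mul_le_mul_of_nonneg_left h hApos.le
      simp only [smul_eq_mul] at this
      have e : A' * (s.A / A' * N s.x + a / A' * N y') = s.A * N s.x + a * N y' := by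
        field_simp
      linarith
    have hlin : A' * affineApprox I.psiS H xt x' =
        s.A * affineApprox I.psiS H xt s.x + a * affineApprox I.psiS H xt y' := by
      have hAa : A' = s.A + a := by rw [ha]; ring
      have e : A' • (x' - xt) = s.A • (s.x - xt) + a • (y' - xt) := by
        have : A' • x' = s.A • s.x + a • y' := by
          rw [hx', smul_add, smul_smul, smul_smul]
          congr 2 <;> field_simp
        rw [smul_sub, this, hAa]; module
      have e2 := congrArg (fun w => ⟪gradientWithin I.psiS H xt, w⟫_ℝ) e
      simp only [inner_smul_right, inner_add_right] at e2
      simp only [affineApprox]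
      rw [hAa] at e2 ⊢
      linarith
    have hdist : A' * (I.M / 2 * ‖x' - xt‖ ^ 2) = (1 + I.mu * s.A) / 2 * ‖y' - s.y‖ ^ 2 := by
      have e : x' - xt = (a / A') • (y' - s.y) := by rw [hx', hxt]; module
      rw [e, norm_smul, Real.norm_of_nonneg hβ, mul_pow]
      have : A' * (I.M / 2 * ((a / A') ^ 2 * ‖y' - s.y‖ ^ 2)) =
          (I.M * a ^ 2) / A' / 2 * ‖y' - s.y‖ ^ 2 := by field_simp
      rw [this, hquad]
      field_simp
    have e1 := hGA y'
    have hAa : A' = s.A + a := by rw [ha]; ring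
    have e3 : A' * N y' = s.A * N y' + a * N y' := by rw [hAa]; ring
    simp only [N] at *
    nlinarith

theorem inv_state (hI : I.Regular) (j : ℕ) : I.Inv (I.state j) := by
  induction j with
  | zero => exact inv_init hI
  | succ j ih =>
    rw [state, Function.iterate_succ_apply']
    exact inv_step hI ih

theorem state_succ (I : ACGInput E) (j : ℕ) : I.state (j + 1) = I.step (I.state j) := by
  rw [state, Function.iterate_succ_apply']; rfl

/-- Geometric growth of `A_j`. -/
theorem le_state_A (hI : I.Regular) (j : ℕ) :
    1 / I.M * (1 + √(I.mu / I.M)) ^ j ≤ (I.state (j + 1)).A := by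
  induction j with
  | zero =>
    rw [state_succ]
    change _ ≤ I.nextA 0
    rw [nextA_zero hI.M_pos]; simp
  | succ j ih =>
    rw [state_succ]
    change _ ≤ I.nextA (I.state (j + 1)).A
    refine le_trans ?_ (nextA_spec hI.M_pos hI.mu_pos (inv_state hI (j + 1)).A_nonneg).2.2
    rw [pow_succ, ← mul_assoc, mul_comm]
    exact mul_le_mul_of_nonneg_left ih (by positivity)

theorem state_A_pos (hI : I.Regular) {j : ℕ} (hj : 1 ≤ j) : 0 < (I.state j).A := by
  obtain ⟨i, rfl⟩ := Nat.exists_eq_add_of_le' hj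
  have := hI.M_pos
  exact lt_of_lt_of_le (by positivity) (le_state_A hI i)

theorem x_mem (hI : I.Regular) (j : ℕ) : I.x j ∈ dom I.psiN := (inv_state hI j).x_mem

/-- `u_j` is an `η_j`-subgradient of `ψ` at `x_j`. -/
theorem u_mem_epsSubdiff (hI : I.Regular) {j : ℕ} (hj : 1 ≤ j) {z : E} (hz : z ∈ dom I.psiN) :
    I.psiS (I.x j) + (I.psiN (I.x j)).toReal + ⟪I.u j, z - I.x j⟫_ℝ - I.eta j
      ≤ I.psiS z + (I.psiN z).toReal := by
  have hs := inv_state hI j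
  have hA := state_A_pos hI hj
  have h1 := hs.model z hz
  have h2 := hs.Gam_le z hz
  set s := I.state j with hs'
  have hAu : s.A • I.u j = I.x0 - s.y := by
    rw [u, ← hs', smul_smul, mul_inv_cancel₀ hA.ne', one_smul]
  have h3 : s.A * ⟪I.u j, z - s.y⟫_ℝ = ⟪I.x0 - s.y, z - s.y⟫_ℝ := by
    rw [← hAu, inner_smul_left]; rfl
  have h4 : ‖z - I.x0‖ ^ 2 = ‖z - s.y‖ ^ 2 - 2 * ⟪I.x0 - s.y, z - s.y⟫_ℝ + ‖s.y - I.x0‖ ^ 2 := by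
    have : z - I.x0 = (z - s.y) - (I.x0 - s.y) := by abel
    rw [this, norm_sub_sq_real, real_inner_comm, norm_sub_rev s.y]
  have h5 : ⟪I.u j, z - I.x j⟫_ℝ = ⟪I.u j, z - s.y⟫_ℝ - ⟪I.u j, I.x j - s.y⟫_ℝ := by
    rw [← inner_sub_right]; congr 1; abel
  have h6 : 0 ≤ I.mu * s.A / 2 * ‖z - s.y‖ ^ 2 := by have := hI.mu_pos; positivity
  have h7 : 0 ≤ s.A * (I.psiS z + (I.psiN z).toReal - (I.psiS (I.x j) + (I.psiN (I.x j)).toReal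
      + ⟪I.u j, z - I.x j⟫_ℝ - I.eta j)) := by
    rw [eta, h5, ← hs']
    nlinarith
  have := nonneg_of_mul_nonneg_right h7 hA
  linarith

theorem eta_nonneg (hI : I.Regular) {j : ℕ} (hj : 1 ≤ j) : 0 ≤ I.eta j := by
  have := u_mem_epsSubdiff hI hj (x_mem hI j)
  simp only [sub_self, inner_zero_right] at this
  linarith

/-- The basic estimate on the residual pair, `‖A_j u_j + x_j - x₀‖² + 2 A_j η_j ≤ ‖x_j - x₀‖²`. -/
theorem residual_le (hI : I.Regular) {j : ℕ} (hj : 1 ≤ j) :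
    ‖(I.state j).A • I.u j + I.x j - I.x0‖ ^ 2 + 2 * ((I.state j).A * I.eta j)
      ≤ ‖I.x j - I.x0‖ ^ 2 := by
  have hs := inv_state hI j
  have hA := state_A_pos hI hj
  have h1 := hs.value
  set s := I.state j with hs'
  have hx : I.x j = s.x := rfl
  have hAu : s.A • I.u j = I.x0 - s.y := by
    rw [u, ← hs', smul_smul, mul_inv_cancel₀ hA.ne', one_smul]
  have h3 : s.A * ⟪I.u j, I.x j - s.y⟫_ℝ = ⟪I.x0 - s.y, I.x j - s.y⟫_ℝ := by
    rw [← hAu, inner_smul_left]; rfl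
  have e1 : s.A • I.u j + I.x j - I.x0 = I.x j - s.y := by rw [hAu]; abel
  have h4 : ‖I.x j - I.x0‖ ^ 2 =
      ‖I.x j - s.y‖ ^ 2 - 2 * ⟪I.x0 - s.y, I.x j - s.y⟫_ℝ + ‖s.y - I.x0‖ ^ 2 := by
    have : I.x j - I.x0 = (I.x j - s.y) - (I.x0 - s.y) := by abel
    rw [this, norm_sub_sq_real, real_inner_comm, norm_sub_rev s.y]
  rw [e1, h4, eta, ← hs']
  rw [← hx] at h1
  nlinarith

/-- The stopping test holds as soon as `A_j` is of the order `σ̃⁻²`. -/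
theorem test_of_le (hI : I.Regular) (hσ : 0 < I.sigmaT) (hσ1 : I.sigmaT ≤ 1) {j : ℕ} (hj : 1 ≤ j)
    (hA : 8 / I.sigmaT ^ 2 ≤ (I.state j).A) : I.Test j := by
  have h1 := residual_le hI hj
  have h2 := eta_nonneg hI hj
  set A := (I.state j).A with hAdef
  have hσ2 : 0 < I.sigmaT ^ 2 := by positivity
  have hσ3 : I.sigmaT ^ 2 ≤ 1 := by nlinarith
  rw [div_le_iff₀ hσ2] at hA
  have hA8 : 8 ≤ A := by nlinarith [state_A_pos hI hj]
  set d := ‖I.x j - I.x0‖ with hd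
  have hd0 : 0 ≤ d := norm_nonneg _
  have h3 : ‖A • I.u j + I.x j - I.x0‖ ≤ d := by
    apply le_of_sq_le_sq _ hd0
    have : 0 ≤ A * I.eta j := by positivity
    linarith
  have h4 : A * ‖I.u j‖ ≤ 2 * d := by
    have e : A • I.u j = (A • I.u j + I.x j - I.x0) - (I.x j - I.x0) := by abel
    have : ‖A • I.u j‖ ≤ d + d := by
      rw [e]; exact (norm_sub_le _ _).trans (add_le_add h3 le_rfl)
    rw [norm_smul, Real.norm_of_nonneg (by linarith)] at this
    linarith
  have h5 : 2 * (A * I.eta j) ≤ d ^ 2 := by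
    have : 0 ≤ ‖A • I.u j + I.x j - I.x0‖ ^ 2 := by positivity
    linarith
  have h6 : d / 2 ≤ ‖I.x0 - I.x j + I.u j‖ := by
    have e : I.x j - I.x0 = I.u j - (I.x0 - I.x j + I.u j) := by abel
    have : d ≤ ‖I.u j‖ + ‖I.x0 - I.x j + I.u j‖ := by
      rw [hd, e]; exact norm_sub_le _ _
    nlinarith [norm_nonneg (I.u j)]
  have h7 : (d / 2) ^ 2 ≤ ‖I.x0 - I.x j + I.u j‖ ^ 2 := pow_le_pow_left₀ (by positivity) h6 2
  have h8 := mul_le_mul_of_nonneg_left h7 hσ2.le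
  rw [Test]
  refine le_trans ?_ h8
  have h9 : A ^ 2 * ‖I.u j‖ ^ 2 ≤ 4 * d ^ 2 := by
    have := pow_le_pow_left₀ (by positivity) h4 2
    nlinarith
  -- both terms on the left are `O(d² / A)`
  have h10 : A * ‖I.u j‖ ^ 2 ≤ d ^ 2 := by
    have : 8 * (A * ‖I.u j‖ ^ 2) ≤ A * (A * ‖I.u j‖ ^ 2) :=
      mul_le_mul_of_nonneg_right hA8 (by positivity)
    nlinarith
  have h11 : A * (‖I.u j‖ ^ 2 + 2 * I.eta j) ≤ A * (I.sigmaT ^ 2 * (d / 2) ^ 2) := by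
    have := mul_le_mul_of_nonneg_right hA (by positivity : 0 ≤ d ^ 2)
    nlinarith
  exact le_of_mul_le_mul_left h11 (by linarith)

theorem exists_stopsAt (hI : I.Regular) (hσ : 0 < I.sigmaT) (hσ1 : I.sigmaT ≤ 1) {n : ℕ}
    (hn : 8 / I.sigmaT ^ 2 ≤ 1 / I.M * (1 + √(I.mu / I.M)) ^ n) :
    ∃ j, I.StopsAt j ∧ j ≤ n + 1 := by
  classical
  have hex : ∃ j, 1 ≤ j ∧ I.Test j :=
    ⟨n + 1, by omega, test_of_le hI hσ hσ1 (by omega) (hn.trans (le_state_A hI n))⟩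
  refine ⟨Nat.find hex, ⟨(Nat.find_spec hex).1, (Nat.find_spec hex).2, fun i hi hlt ht =>
    Nat.find_min hex hlt ⟨hi, ht⟩⟩, Nat.find_min' hex
    ⟨by omega, test_of_le hI hσ hσ1 (by omega) (hn.trans (le_state_A hI n))⟩⟩

/-- The constant in the bound on the number of iterations of one ACG call. -/
noncomputable def iterConst (σ : ℝ) : ℝ := 4 * (Real.log (8 / σ ^ 2) + 2) + 2

theorem iterConst_pos {σ : ℝ} (hσ : 0 < σ) (hσ1 : σ ≤ 1) : 0 < iterConst σ := by
  have : 0 ≤ Real.log (8 / σ ^ 2) := by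
    apply Real.log_nonneg
    rw [le_div_iff₀ (by positivity)]; nlinarith
  unfold iterConst; linarith

theorem one_le_logOnePlus (t : ℝ) : 1 ≤ logOnePlus t := le_max_right _ _

/-- Linear convergence of ACG, for the parameters with which it is called: the number of
iterations is of the order `√L log₁⁺ L`. -/
theorem exists_stopsAt_le (hI : I.Regular) {σ L : ℝ} (hσ : 0 < σ) (hσ1 : σ ≤ 1) (hL : 1 ≤ L)
    (hM : I.M = L - 1 / 2) (hmu : I.mu = 1 / 2) (hs : I.sigmaT = σ / √L) :
    ∃ j, I.StopsAt j ∧ (j : ℝ) ≤ iterConst σ * √L * logOnePlus L := by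
  have hsL : 1 ≤ √L := by rw [Real.one_le_sqrt]; exact hL
  have hsL2 : √L ^ 2 = L := Real.sq_sqrt (by linarith)
  have hMpos := hI.M_pos
  set q := √(I.mu / I.M) with hq
  have hq0 : 0 < q := Real.sqrt_pos.2 (div_pos hI.mu_pos hMpos)
  have hq1 : q ≤ 1 := by
    rw [hq, Real.sqrt_le_iff, one_pow, div_le_one hMpos, hM, hmu]
    exact ⟨zero_le_one, by linarith⟩
  have hqL : 1 ≤ 2 * (√L * q) := by
    have : 1 / 4 ≤ L * (I.mu / I.M) := by
      rw [← mul_div_assoc, le_div_iff₀ hMpos, hM, hmu]; linarith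
    have h2 : √L * q = √(L * (I.mu / I.M)) := (Real.sqrt_mul (by linarith) _).symm
    rw [h2]
    have : (1 / 2 : ℝ) ≤ √(L * (I.mu / I.M)) := Real.le_sqrt_of_sq_le (by linarith)
    linarith
  have hlog : q / 2 ≤ Real.log (1 + q) := by
    refine le_trans ?_ (Real.one_sub_inv_le_log_of_pos (by linarith))
    have : 1 - (1 + q)⁻¹ = q / (1 + q) := by field_simp; ring
    rw [this]
    exact div_le_div_of_nonneg_left hq0.le (by linarith) (by linarith)
  set Y := 8 * L ^ 2 / σ ^ 2 with hY
  have hYpos : 0 < Y := by positivity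
  have hY1 : 1 ≤ Y := by
    rw [hY, le_div_iff₀ (by positivity)]; nlinarith
  have hlY : 0 ≤ Real.log Y := Real.log_nonneg hY1
  set n := ⌈4 * √L * Real.log Y⌉₊ with hn
  have hn1 : 4 * √L * Real.log Y ≤ n := Nat.le_ceil _
  have hn2 : (n : ℝ) < 4 * √L * Real.log Y + 1 := Nat.ceil_lt_add_one (by positivity)
  have hpow : Y ≤ (1 + q) ^ n := by
    have h1 : Real.log Y ≤ n * Real.log (1 + q) := by
      have h2 : 4 * √L * Real.log Y * (q / 2) ≤ n * Real.log (1 + q) :=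
        mul_le_mul hn1 hlog (by positivity) (by positivity)
      nlinarith
    rw [← Real.log_pow] at h1
    exact (Real.log_le_log_iff hYpos (by positivity)).1 h1
  have hsT : I.sigmaT ^ 2 = σ ^ 2 / L := by rw [hs, div_pow, hsL2]
  obtain ⟨j, hj, hjn⟩ := exists_stopsAt hI (by rw [hs]; positivity)
    (by rw [hs]; exact (div_le_one (by positivity)).2 (by linarith)) (n := n) (by
      rw [hsT]
      have h1 : 1 / L ≤ 1 / I.M := one_div_le_one_div_of_le hMpos (by rw [hM]; linarith)
      have h2 : 1 / L * Y ≤ 1 / I.M * (1 + q) ^ n := mul_le_mul h1 hpow hYpos.le (by positivity)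
      refine le_trans (le_of_eq ?_) h2
      rw [hY]; field_simp)
  refine ⟨j, hj, ?_⟩
  have hj2 : (j : ℝ) ≤ n + 1 := by exact_mod_cast hjn
  have hl1 := one_le_logOnePlus L
  have hl2 : Real.log L ≤ logOnePlus L := le_max_left _ _
  have h8 : 0 ≤ Real.log (8 / σ ^ 2) := by
    apply Real.log_nonneg
    rw [le_div_iff₀ (by positivity)]; nlinarith
  have hYlog : Real.log Y ≤ (Real.log (8 / σ ^ 2) + 2) * logOnePlus L := by
    have : Y = 8 / σ ^ 2 * L ^ 2 := by rw [hY]; ring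
    rw [this, Real.log_mul (by positivity) (by positivity), Real.log_pow]
    push_cast
    nlinarith
  have h9 : 4 * √L * Real.log Y ≤ 4 * √L * ((Real.log (8 / σ ^ 2) + 2) * logOnePlus L) :=
    mul_le_mul_of_nonneg_left hYlog (by positivity)
  have h10 : 1 ≤ √L * logOnePlus L := one_le_mul_of_one_le_of_one_le hsL hl1
  unfold iterConst
  nlinarith

end ACGInput

/-! ### The smooth part of the augmented Lagrangian -/

section Gradients

variable {E : Type u} [NormedAddCommGroup E] [InnerProductSpace ℝ E] [CompleteSpace E]

theorem HasGradientWithinAt.add {ψ χ : E → ℝ} {G G' : E} {D : Set E} {x : E}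
    (hψ : HasGradientWithinAt ψ G D x) (hχ : HasGradientWithinAt χ G' D x) :
    HasGradientWithinAt (fun z => ψ z + χ z) (G + G') D x := by
  rw [hasGradientWithinAt_iff_hasFDerivWithinAt, map_add]
  exact hψ.hasFDerivWithinAt.add hχ.hasFDerivWithinAt

theorem HasGradientWithinAt.const_mul {ψ : E → ℝ} {G : E} {D : Set E} {x : E} (a : ℝ)
    (hψ : HasGradientWithinAt ψ G D x) :
    HasGradientWithinAt (fun z => a * ψ z) (a • G) D x := by
  rw [hasGradientWithinAt_iff_hasFDerivWithinAt, map_smul]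
  exact hψ.hasFDerivWithinAt.const_mul a

/-- A first-order expansion with quadratic error determines the gradient. -/
theorem hasGradientWithinAt_of_quadratic {ψ : E → ℝ} {G : E} {D : Set E} {x : E} {C : ℝ}
    (h : ∀ z, |ψ z - ψ x - ⟪G, z - x⟫_ℝ| ≤ C * ‖z - x‖ ^ 2) : HasGradientWithinAt ψ G D x := by
  have h1 : HasFDerivAt (fun z => ψ z - ψ x - ⟪G, z - x⟫_ℝ) (0 : E →L[ℝ] ℝ) x := by
    refine Asymptotics.IsBigO.hasFDerivAt (n := 2) ?_ one_lt_two
    refine Asymptotics.IsBigO.of_bound C (Filter.Eventually.of_forall fun z => ?_)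
    simpa using h z
  have h2 : HasFDerivAt (fun z : E => ψ x + ⟪G, z - x⟫_ℝ) (innerSL ℝ G) x := by
    have h : HasFDerivAt (fun z : E => ⟪G, z - x⟫_ℝ) (innerSL ℝ G) x :=
      ((innerSL ℝ G).hasFDerivAt (x := x - x)).comp (f := fun z : E => z - x) x
        ((hasFDerivAt_id x).sub_const x)
    exact h.const_add (ψ x)
  rw [hasGradientWithinAt_iff_hasFDerivWithinAt]
  have h3 := h1.add h2
  rw [zero_add] at h3
  have h4 : (fun z => ψ z - ψ x - ⟪G, z - x⟫_ℝ) + (fun z : E => ψ x + ⟪G, z - x⟫_ℝ) = ψ := by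
    funext z; simp
  rw [h4] at h3
  exact h3.hasFDerivWithinAt

theorem hasGradientWithinAt_half_sq (m : ℝ) (c : E) (D : Set E) (x : E) :
    HasGradientWithinAt (fun z => m / 2 * ‖z - c‖ ^ 2) (m • (x - c)) D x := by
  refine hasGradientWithinAt_of_quadratic (C := |m / 2|) fun z => ?_
  have e : z - c = (z - x) + (x - c) := by abel
  have : m / 2 * ‖z - c‖ ^ 2 - m / 2 * ‖x - c‖ ^ 2 - ⟪m • (x - c), z - x⟫_ℝ =
      m / 2 * ‖z - x‖ ^ 2 := by
    rw [e, norm_add_sq_real, inner_smul_left, real_inner_comm]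
    simp only [conj_trivial]; ring
  rw [this, abs_mul, abs_of_nonneg (by positivity : 0 ≤ ‖z - x‖ ^ 2)]

end Gradients

namespace Problem

variable {E : Type u} [NormedAddCommGroup E] [InnerProductSpace ℝ E] [CompleteSpace E]
variable {F : Type v} [NormedAddCommGroup F] [InnerProductSpace ℝ F] [CompleteSpace F]
variable {P : Problem E F}

theorem h_eq_top {z : E} (hz : z ∉ P.H) : P.h z = ⊤ := by
  by_contra h; exact hz (lt_top_iff_ne_top.2 h)

theorem Dh_nonneg : 0 ≤ P.Dh := Metric.diam_nonneg

theorem inner_gradg (z d : E) (p : F) : ⟪P.gradg z p, d⟫_ℝ = ⟪p, fderiv ℝ P.g z d⟫_ℝ := by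
  rw [gradg, ContinuousLinearMap.adjoint_inner_left]

namespace Assumptions

theorem H_convexOn (hP : P.Assumptions) : ConvexOn ℝ P.H (fun z => (P.h z).toReal) :=
  convexOn_toReal_dom hP.h_conv

theorem H_convex (hP : P.Assumptions) : Convex ℝ P.H := hP.H_convexOn.1

theorem zbar_mem_H (hP : P.Assumptions) : P.zbar ∈ P.H := interior_subset hP.zbar_mem

theorem H_uniqueDiff (hP : P.Assumptions) : UniqueDiffOn ℝ P.H :=
  uniqueDiffOn_convex hP.H_convex ⟨_, hP.zbar_mem⟩

theorem h_coe (hP : P.Assumptions) {z : E} (hz : z ∈ P.H) : ((P.h z).toReal : EReal) = P.h z :=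
  EReal.coe_toReal (ne_of_lt hz) (hP.h_conv.ne_bot z)

theorem h_cont (hP : P.Assumptions) : ContinuousOn (fun z => (P.h z).toReal) P.H := by
  have : LipschitzOnWith ⟨P.Kh, hP.Kh_pos.le⟩ (fun z => (P.h z).toReal) P.H := by
    refine LipschitzOnWith.of_dist_le_mul fun x hx y hy => ?_
    rw [Real.dist_eq, dist_eq_norm]
    exact hP.h_lip y hy x hx
  exact this.continuousOn

theorem hasGradient_f (hP : P.Assumptions) {z : E} (hz : z ∈ P.H) :
    HasGradientWithinAt P.f (P.gradf z) P.H z :=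
  (hP.f_diff z hz).hasGradientWithinAt

theorem dist_le (hP : P.Assumptions) {z z' : E} (hz : z ∈ P.H) (hz' : z' ∈ P.H) :
    ‖z' - z‖ ≤ P.Dh := by
  rw [← dist_eq_norm]
  exact Metric.dist_le_diam_of_mem hP.H_compact.isBounded hz' hz

theorem norm_gradf_le (hP : P.Assumptions) {z : E} (hz : z ∈ P.H) : ‖P.gradf z‖ ≤ P.Bf1 := by
  apply le_csSup _ (Set.mem_image_of_mem (fun z => ‖P.gradf z‖) hz)
  refine ⟨‖P.gradf P.zbar‖ + P.Lf * P.Dh, ?_⟩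
  rintro _ ⟨x, hx, rfl⟩
  have h1 := hP.f_lip _ hP.zbar_mem_H x hx
  have h2 := mul_le_mul_of_nonneg_left (hP.dist_le hP.zbar_mem_H hx) hP.Lf_pos.le
  have h3 := norm_le_insert' (P.gradf x) (P.gradf P.zbar)
  simp only
  linarith

theorem norm_g_le (hP : P.Assumptions) {z : E} (hz : z ∈ P.H) : ‖P.g z‖ ≤ P.Bg0 := by
  apply le_csSup _ (Set.mem_image_of_mem (fun z => ‖P.g z‖) hz)
  exact hP.H_compact.bddAbove_image hP.g_diff.continuous.norm.continuousOn

theorem norm_gradg_le (hP : P.Assumptions) {z : E} (hz : z ∈ P.H) : ‖P.gradg z‖ ≤ P.Bg1 := by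
  apply le_csSup _ (Set.mem_image_of_mem (fun z => ‖P.gradg z‖) hz)
  refine ⟨‖P.gradg P.zbar‖ + P.Lg * P.Dh, ?_⟩
  rintro _ ⟨x, hx, rfl⟩
  have h1 := hP.g_lip P.zbar x
  have h2 := mul_le_mul_of_nonneg_left (hP.dist_le hP.zbar_mem_H hx) hP.Lg_pos.le
  have h3 := norm_le_insert' (P.gradg x) (P.gradg P.zbar)
  simp only
  linarith

theorem Bf1_nonneg (hP : P.Assumptions) : 0 ≤ P.Bf1 :=
  (norm_nonneg _).trans (hP.norm_gradf_le hP.zbar_mem_H)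

theorem Bg0_nonneg (hP : P.Assumptions) : 0 ≤ P.Bg0 :=
  (norm_nonneg _).trans (hP.norm_g_le hP.zbar_mem_H)

theorem Bg1_nonneg (hP : P.Assumptions) : 0 ≤ P.Bg1 :=
  (norm_nonneg _).trans (hP.norm_gradg_le hP.zbar_mem_H)

theorem norm_g_sub_le (hP : P.Assumptions) {z z' : E} (hz : z ∈ P.H) (hz' : z' ∈ P.H) :
    ‖P.g z' - P.g z‖ ≤ P.Bg1 * ‖z' - z‖ := by
  refine hP.H_convex.norm_image_sub_le_of_norm_hasFDerivWithin_le
    (fun x _ => (hP.g_diff x).hasFDerivAt.hasFDerivWithinAt) (fun x hx => ?_) hz hz'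
  have := hP.norm_gradg_le hx
  rwa [gradg, LinearIsometryEquiv.norm_map] at this

/-- A function on a one-point space would be convex. -/
theorem nontrivial (hP : P.Assumptions) : Nontrivial E := by
  by_contra hn
  rw [not_nontrivial_iff_subsingleton] at hn
  refine hP.f_nonconvex ⟨hP.H_convex, fun x _ y _ a b _ _ hab => ?_⟩
  rw [Subsingleton.elim y x, ← add_smul, ← add_smul, hab, one_smul, one_smul]

/-- Gradient inequality for the `K`-convex map `g`, tested with a multiplier `p ∈ K*`. -/
theorem inner_gradg_le (hP : P.Assumptions) {p : F} (hp : p ∈ P.dualK) (z z' : E) :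
    ⟪p, P.g z⟫_ℝ + ⟪P.gradg z p, z' - z⟫_ℝ ≤ ⟪p, P.g z'⟫_ℝ := by
  set w : ℝ → E := fun t => z + t • (z' - z) with hw
  set θ : ℝ → ℝ := fun t => ⟪p, P.g (w t)⟫_ℝ with hθ
  have hconv : ConvexOn ℝ Set.univ θ := by
    refine ⟨convex_univ, fun a _ b _ s t hs _ hst => ?_⟩
    have hmem := hP.g_conv (w b) (w a) s hs (by linarith)
    have ht : 1 - s = t := by linarith
    rw [ht] at hmem
    have e : w (s • a + t • b) = s • w a + t • w b := by
      simp only [hw, smul_eq_mul]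
      rw [← ht]; module
    have h1 := hp _ hmem
    rw [zero_sub, inner_neg_right, inner_sub_right, inner_sub_right, inner_smul_right,
      inner_smul_right, ← e] at h1
    simp only [hθ, smul_eq_mul] at h1 ⊢
    linarith
  have hder : HasDerivAt θ ⟪P.gradg z p, z' - z⟫_ℝ 0 := by
    rw [inner_gradg]
    have h1 : HasDerivAt w (z' - z) 0 := by
      have := ((hasDerivAt_id (0 : ℝ)).smul_const (z' - z)).const_add z
      rw [one_smul] at this
      exact this
    have h2 : HasFDerivAt P.g (fderiv ℝ P.g z) (w 0) := by
      simpa [hw] using (hP.g_diff z).hasFDerivAt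
    exact ((innerSL ℝ p).hasFDerivAt.comp _ h2).comp_hasDerivAt 0 h1
  have := hconv.le_slope_of_hasDerivAt (Set.mem_univ 0) (Set.mem_univ 1) one_pos hder
  simp only [slope_def_field, hθ, hw, one_smul, zero_smul, add_zero, add_sub_cancel] at this
  linarith

end Assumptions

/-- The gradient `∇f(z) + ∇g(z) Π_{K*}(p + c g(z))` of the smooth part of the augmented
Lagrangian. -/
noncomputable def gradAL (P : Problem E F) (c : ℝ) (p : F) (z : E) : E :=
  P.gradf z + P.gradg z (proj P.dualK (p + c • P.g z))

theorem smoothAL_eq (P : Problem E F) (c : ℝ) (p : F) (z : E) : P.smoothAL c p z =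
    P.f z + 1 / (2 * c) * (‖proj P.dualK (p + c • P.g z)‖ ^ 2 - ‖p‖ ^ 2) := by
  rw [smoothAL, infDist_negK]

namespace Assumptions

theorem hasGradient_smoothAL (hP : P.Assumptions) {c : ℝ} (hc : 0 < c) (p : F) {z : E}
    (hz : z ∈ P.H) : HasGradientWithinAt (P.smoothAL c p) (P.gradAL c p z) P.H z := by
  set y := p + c • P.g z with hy
  have h1 : HasGradientWithinAt (fun y => ‖proj P.dualK y‖ ^ 2) ((2 : ℝ) • proj P.dualK y)
      Set.univ y := by
    refine hasGradientWithinAt_of_quadratic (C := 1) fun y' => ?_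
    have h1 := P.sq_norm_proj_le y y'
    have h2 := P.le_sq_norm_proj y y'
    rw [inner_smul_left, abs_le]
    simp only [conj_trivial]
    have : 0 ≤ ‖y' - y‖ ^ 2 := by positivity
    constructor <;> linarith
  have h1' := h1.hasFDerivWithinAt.hasFDerivAt Filter.univ_mem
  have h2 : HasFDerivAt (fun z => p + c • P.g z) (c • fderiv ℝ P.g z) z :=
    ((hP.g_diff z).hasFDerivAt.const_smul c).const_add p
  have h3 := (((h1'.comp z h2).sub_const (‖p‖ ^ 2)).const_mul (1 / (2 * c))).hasFDerivWithinAt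
    (s := P.H)
  have h4 := (hP.hasGradient_f hz).hasFDerivWithinAt.add h3
  rw [hasGradientWithinAt_iff_hasFDerivWithinAt]
  refine (h4.congr (fun x _ => ?_) ?_).congr_fderiv ?_
  · rw [P.smoothAL_eq]; rfl
  · rw [P.smoothAL_eq]; rfl
  · refine ContinuousLinearMap.ext fun d => ?_
    simp only [gradAL, map_add, add_apply, InnerProductSpace.toDual_apply_apply,
      smul_apply, ContinuousLinearMap.comp_apply, inner_gradg, inner_smul_left,
      inner_smul_right, smul_eq_mul, conj_trivial, ← hy]
    field_simp

theorem gradSmoothAL_eq (hP : P.Assumptions) {c : ℝ} (hc : 0 < c) (p : F) {z : E}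
    (hz : z ∈ P.H) : P.gradSmoothAL c p z = P.gradAL c p z :=
  HasGradientWithinAt.gradientWithin_eq (hP.hasGradient_smoothAL hc p hz) (hP.H_uniqueDiff z hz)

theorem Ltilde_nonneg (hP : P.Assumptions) {c : ℝ} (hc : 0 < c) (p : F) : 0 ≤ P.Ltilde c p := by
  have := hP.Lf_pos
  have := hP.Lg_pos
  have := hP.Bg0_nonneg
  unfold Ltilde; positivity

/-- The split of the difference follows the product rule for `∇g(z) Π(p + c g(z))`. -/
theorem gradAL_lipschitz (hP : P.Assumptions) {c : ℝ} (hc : 0 < c) (p : F) {z z' : E}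
    (hz : z ∈ P.H) (hz' : z' ∈ P.H) :
    ‖P.gradAL c p z' - P.gradAL c p z‖ ≤ P.Ltilde c p * ‖z' - z‖ := by
  set q := proj P.dualK (p + c • P.g z) with hq
  set q' := proj P.dualK (p + c • P.g z') with hq'
  have e : P.gradAL c p z' - P.gradAL c p z = (P.gradf z' - P.gradf z)
      + (P.gradg z' - P.gradg z) q + P.gradg z' (q' - q) := by
    simp only [gradAL, ← hq, ← hq', sub_apply, map_sub]; abel
  have h1 := hP.f_lip z hz z' hz'
  have h2 : ‖(P.gradg z' - P.gradg z) q‖ ≤ P.Lg * ‖z' - z‖ * (‖p‖ + c * P.Bg0) := by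
    refine (ContinuousLinearMap.le_opNorm _ _).trans
      (mul_le_mul (hP.g_lip z z') ?_ (norm_nonneg _) ?_)
    · refine (P.norm_proj_le _).trans ((norm_add_le _ _).trans ?_)
      rw [norm_smul, Real.norm_of_nonneg hc.le]
      have := mul_le_mul_of_nonneg_left (hP.norm_g_le hz) hc.le
      linarith
    · exact mul_nonneg hP.Lg_pos.le (norm_nonneg _)
  have h3 : ‖P.gradg z' (q' - q)‖ ≤ P.Bg1 * (c * (P.Bg1 * ‖z' - z‖)) := by
    refine (ContinuousLinearMap.le_opNorm _ _).trans
      (mul_le_mul (hP.norm_gradg_le hz') ?_ (norm_nonneg _) hP.Bg1_nonneg)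
    refine (P.norm_proj_sub_le _ _).trans ?_
    rw [add_sub_add_left_eq_sub, ← smul_sub, norm_smul, Real.norm_of_nonneg hc.le]
    exact mul_le_mul_of_nonneg_left (hP.norm_g_sub_le hz hz') hc.le
  rw [e]
  refine (norm_add₃_le).trans ?_
  unfold Ltilde
  nlinarith

/-- The penalty term is convex, so that the smooth part of the augmented Lagrangian is no less
convex than `f`. -/
theorem le_smoothAL (hP : P.Assumptions) {c : ℝ} (hc : 0 < c) (p : F) {z z' : E}
    (hz : z ∈ P.H) (hz' : z' ∈ P.H) :
    P.smoothAL c p z + ⟪P.gradAL c p z, z' - z⟫_ℝ - P.mf / 2 * ‖z' - z‖ ^ 2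
      ≤ P.smoothAL c p z' := by
  have h1 := hP.f_curv z hz z' hz'
  have h2 := P.le_sq_norm_proj (p + c • P.g z) (p + c • P.g z')
  have h3 := hP.inner_gradg_le (P.proj_mem (p + c • P.g z)) z z'
  rw [add_sub_add_left_eq_sub, ← smul_sub, inner_smul_right, inner_sub_right] at h2
  have h4 : 1 / (2 * c) * (‖proj P.dualK (p + c • P.g z)‖ ^ 2 + 2 * (c *
      (⟪proj P.dualK (p + c • P.g z), P.g z'⟫_ℝ - ⟪proj P.dualK (p + c • P.g z), P.g z⟫_ℝ))) ≤
      1 / (2 * c) * ‖proj P.dualK (p + c • P.g z')‖ ^ 2 :=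
    mul_le_mul_of_nonneg_left h2 (by positivity)
  have h5 : 1 / (2 * c) * (‖proj P.dualK (p + c • P.g z)‖ ^ 2 + 2 * (c *
      (⟪proj P.dualK (p + c • P.g z), P.g z'⟫_ℝ - ⟪proj P.dualK (p + c • P.g z), P.g z⟫_ℝ))) =
      1 / (2 * c) * ‖proj P.dualK (p + c • P.g z)‖ ^ 2 +
      (⟪proj P.dualK (p + c • P.g z), P.g z'⟫_ℝ - ⟪proj P.dualK (p + c • P.g z), P.g z⟫_ℝ) := by
    field_simp
  rw [P.smoothAL_eq, P.smoothAL_eq, gradAL, inner_add_left]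
  linarith

theorem one_le_Lpsi (hP : P.Assumptions) {lam c : ℝ} (hlam : 0 < lam) (hc : 0 < c) (p : F) :
    1 ≤ P.Lpsi lam c p := by
  have := hP.Ltilde_nonneg hc p
  have : 0 ≤ lam * P.Ltilde c p := by positivity
  unfold Lpsi; linarith

theorem dom_psiN (hP : P.Assumptions) {lam : ℝ} (hlam : 0 < lam) (a : E → ℝ) :
    dom (fun z => (lam : EReal) * P.h z + ((a z : ℝ) : EReal)) = P.H := by
  ext z
  change (lam : EReal) * P.h z + ((a z : ℝ) : EReal) < ⊤ ↔ z ∈ P.H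
  by_cases hz : z ∈ P.H
  · rw [← hP.h_coe hz, ← EReal.coe_mul, ← EReal.coe_add]
    exact iff_of_true (EReal.coe_lt_top _) hz
  · rw [h_eq_top hz, EReal.coe_mul_top_of_pos hlam, EReal.top_add_coe]
    exact iff_of_false (lt_irrefl _) hz

theorem toReal_psiN (hP : P.Assumptions) (lam : ℝ) (a : E → ℝ) {z : E} (hz : z ∈ P.H) :
    (lam : EReal) * P.h z + ((a z : ℝ) : EReal) = ((lam * (P.h z).toReal + a z : ℝ) : EReal) := by
  rw [← hP.h_coe hz, ← EReal.coe_mul, ← EReal.coe_add, EReal.toReal_coe]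

/-- The ACG calls of the method meet the requirements of the analysis of ACG. In particular the
prox term makes `ψₛ` convex, because `λ m_f ≤ ½`. -/
theorem acg_regular (hP : P.Assumptions) {lam : ℝ} (hlam : 0 < lam) (hlam' : lam ≤ 1 / (2 * P.mf))
    (σ : ℝ) {s : OuterState E F} (hc : 0 < s.c) (hz : s.z ∈ P.H) :
    (P.acgInput lam σ s).Regular := by
  have hL := hP.one_le_Lpsi hlam hc s.p
  have hdom : dom (P.acgInput lam σ s).psiN = P.H := hP.dom_psiN hlam _
  have hlm : lam * P.mf ≤ 1 / 2 := by
    rw [le_div_iff₀ (by have := hP.mf_pos; positivity)] at hlam'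
    linarith
  have hN : ∀ z ∈ P.H, (P.acgInput lam σ s).psiN z =
      ((lam * (P.h z).toReal + 1 / 2 / 2 * ‖z - s.z‖ ^ 2 : ℝ) : EReal) := by
    intro z hz
    refine (hP.toReal_psiN lam (fun z => 1 / 4 * ‖z - s.z‖ ^ 2) hz).trans ?_
    norm_num
  have hNr : ∀ z ∈ P.H, ((P.acgInput lam σ s).psiN z).toReal =
      lam * (P.h z).toReal + 1 / 2 / 2 * ‖z - s.z‖ ^ 2 := by
    intro z hz; rw [hN z hz, EReal.toReal_coe]
  have hS : (P.acgInput lam σ s).psiS =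
      fun z => lam * P.smoothAL s.c s.p z + 1 / 2 / 2 * ‖z - s.z‖ ^ 2 := by
    funext z; simp only [acgInput]; norm_num
  have hgrad : ∀ z ∈ P.H, HasGradientWithinAt (P.acgInput lam σ s).psiS
      (lam • P.gradAL s.c s.p z + (1 / 2 : ℝ) • (z - s.z)) P.H z := by
    intro z hz
    rw [hS]
    exact HasGradientWithinAt.add
      (HasGradientWithinAt.const_mul lam (hP.hasGradient_smoothAL hc s.p hz))
      (hasGradientWithinAt_half_sq _ _ _ _)
  have haff : ∀ x ∈ P.H, ∀ z, affineApprox (P.acgInput lam σ s).psiS P.H x z =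
      (P.acgInput lam σ s).psiS x + ⟪lam • P.gradAL s.c s.p x + (1 / 2 : ℝ) • (x - s.z), z - x⟫_ℝ := by
    intro x hx z
    rw [affineApprox, HasGradientWithinAt.gradientWithin_eq (hgrad x hx) (hP.H_uniqueDiff x hx)]
  refine ⟨?_, by norm_num [acgInput], ?_, ?_, ?_, ?_, ?_, ?_, ?_⟩
  · change 0 < P.Lpsi lam s.c s.p - 1 / 2
    linarith
  · rw [hdom]; exact hz
  · rw [hdom]; exact hP.H_compact
  · rw [hdom]; intro z hz; rw [hN z hz, EReal.toReal_coe]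
  · rw [hdom]
    refine ContinuousOn.congr ?_ hNr
    have := hP.h_cont
    fun_prop
  · rw [hdom]
    have h1 : StrongConvexOn P.H (0 + 1 / 2)
        (fun z => lam * (P.h z).toReal + 1 / 2 / 2 * ‖z - s.z‖ ^ 2) :=
      StrongConvexOn.add (strongConvexOn_zero.2 (hP.H_convexOn.smul hlam.le))
        (strongConvexOn_half_sq hP.H_convex _ _)
    rw [zero_add] at h1
    refine ⟨h1.1, fun x hx y hy a b ha hb hab => ?_⟩
    simp only
    rw [hNr x hx, hNr y hy, hNr _ (h1.1 hx hy ha hb hab)]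
    exact h1.2 hx hy ha hb hab
  · rw [hdom]
    intro x hx z hz
    rw [haff x hx, hS]
    have h1 := mul_le_mul_of_nonneg_left (hP.le_smoothAL hc s.p hx hz) hlam.le
    have e : z - s.z = (z - x) + (x - s.z) := by abel
    simp only
    rw [e, norm_add_sq_real, inner_add_left, inner_smul_left, inner_smul_left,
      real_inner_comm (z - x) (x - s.z)]
    simp only [conj_trivial]
    have h2 : 0 ≤ ‖z - x‖ ^ 2 := by positivity
    nlinarith
  · rw [hdom]
    intro x hx z hz
    rw [haff x hx]
    refine le_add_half_sq_of_lipschitz_gradient hP.H_convex hgrad (fun a ha b hb => ?_) hx hz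
    have e : lam • P.gradAL s.c s.p b + (1 / 2 : ℝ) • (b - s.z)
        - (lam • P.gradAL s.c s.p a + (1 / 2 : ℝ) • (a - s.z)) =
        lam • (P.gradAL s.c s.p b - P.gradAL s.c s.p a) + (1 / 2 : ℝ) • (b - a) := by module
    rw [e]
    refine (norm_add_le _ _).trans ?_
    rw [norm_smul, norm_smul, Real.norm_of_nonneg hlam.le, Real.norm_of_nonneg (by norm_num)]
    have := mul_le_mul_of_nonneg_left (hP.gradAL_lipschitz hc s.p ha hb) hlam.le
    change _ ≤ (P.Lpsi lam s.c s.p - 1 / 2) * _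
    unfold Lpsi
    nlinarith

end Assumptions

/-! ### One outer iteration -/

/-- What an ACG call delivers: an inexact solution `(z, v, ε)` of the prox subproblem of the outer
iteration started in state `s`. -/
structure InexactProx (P : Problem E F) (lam σ : ℝ) (s : OuterState E F) (z v : E) (ε : ℝ) :
    Prop where
  mem : z ∈ P.H
  subgrad : ∀ y ∈ P.H,
    lam * P.augLag s.c z s.p + 1 / 2 * ‖z - s.z‖ ^ 2 + ⟪v, y - z⟫_ℝ - ε
      ≤ lam * P.augLag s.c y s.p + 1 / 2 * ‖y - s.z‖ ^ 2
  test : ‖v‖ ^ 2 + 2 * ε ≤ σ ^ 2 / P.Lpsi lam s.c s.p * ‖v + s.z - z‖ ^ 2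

namespace Assumptions

/-- Every ACG call terminates, with a bound on the number of its iterations. -/
theorem exists_stopsAt (hP : P.Assumptions) {lam σ : ℝ} (hlam : 0 < lam)
    (hlam' : lam ≤ 1 / (2 * P.mf)) (hσ : 0 < σ) (hσ1 : σ ≤ 1) {s : OuterState E F} (hc : 0 < s.c)
    (hz : s.z ∈ P.H) :
    ∃ j, (P.acgInput lam σ s).StopsAt j ∧ (j : ℝ) ≤ ACGInput.iterConst σ *
      √(P.Lpsi lam s.c s.p) * logOnePlus (P.Lpsi lam s.c s.p) :=
  ACGInput.exists_stopsAt_le (hP.acg_regular hlam hlam' σ hc hz) hσ hσ1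
    (hP.one_le_Lpsi hlam hc s.p) rfl rfl rfl

theorem inexactProx_of_stopsAt (hP : P.Assumptions) {lam σ : ℝ} (hlam : 0 < lam)
    (hlam' : lam ≤ 1 / (2 * P.mf)) {s : OuterState E F} (hc : 0 < s.c)
    (hz : s.z ∈ P.H) {j : ℕ} (hj : (P.acgInput lam σ s).StopsAt j) :
    P.InexactProx lam σ s ((P.acgInput lam σ s).x j) ((P.acgInput lam σ s).u j)
      ((P.acgInput lam σ s).eta j) := by
  have hI := hP.acg_regular hlam hlam' σ hc hz
  have hdom : dom (P.acgInput lam σ s).psiN = P.H := hP.dom_psiN hlam _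
  have hmem := ACGInput.x_mem hI j
  rw [hdom] at hmem
  have hN : ∀ z ∈ P.H, (P.acgInput lam σ s).psiS z + ((P.acgInput lam σ s).psiN z).toReal =
      lam * P.augLag s.c z s.p + 1 / 2 * ‖z - s.z‖ ^ 2 := by
    intro z hz
    have h1 : (P.acgInput lam σ s).psiN z = _ :=
      hP.toReal_psiN lam (fun z => 1 / 4 * ‖z - s.z‖ ^ 2) hz
    rw [h1, EReal.toReal_coe, augLag]
    simp only [acgInput]
    ring
  refine ⟨hmem, fun y hy => ?_, ?_⟩
  · have := ACGInput.u_mem_epsSubdiff hI hj.1 (z := y) (by rw [hdom]; exact hy)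
    rwa [hN _ hmem, hN _ hy] at this
  · have h1 := hj.2.1
    have hL := hP.one_le_Lpsi hlam hc s.p
    have h2 : (P.acgInput lam σ s).sigmaT ^ 2 = σ ^ 2 / P.Lpsi lam s.c s.p := by
      change (σ / √_) ^ 2 = _
      rw [div_pow, Real.sq_sqrt (by linarith)]
    rw [ACGInput.Test, h2] at h1
    have e : (P.acgInput lam σ s).x0 - (P.acgInput lam σ s).x j + (P.acgInput lam σ s).u j =
        (P.acgInput lam σ s).u j + s.z - (P.acgInput lam σ s).x j := by
      change s.z - _ + _ = _
      abel
    rwa [e] at h1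

end Assumptions

namespace InexactProx

variable {lam σ : ℝ} {s : OuterState E F} {z v : E} {ε : ℝ}

theorem eps_nonneg (h : P.InexactProx lam σ s z v ε) : 0 ≤ ε := by
  have := h.subgrad z h.mem
  simp only [sub_self, inner_zero_right] at this
  linarith

/-- The relative error criterion, with `1/L ≤ 1` dropped. -/
theorem test_le (hP : P.Assumptions) (hlam : 0 < lam) (hc : 0 < s.c)
    (h : P.InexactProx lam σ s z v ε) :
    ‖v‖ ^ 2 + 2 * ε ≤ σ ^ 2 * ‖v + s.z - z‖ ^ 2 := by
  refine h.test.trans (mul_le_mul_of_nonneg_right ?_ (by positivity))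
  exact div_le_self (by positivity) (hP.one_le_Lpsi hlam hc s.p)

theorem norm_v_le (hP : P.Assumptions) (hlam : 0 < lam) (hσ : 0 < σ) (hc : 0 < s.c)
    (h : P.InexactProx lam σ s z v ε) : ‖v‖ ≤ σ * ‖v + s.z - z‖ := by
  apply le_of_sq_le_sq _ (by positivity)
  have := h.test_le hP hlam hc
  have := h.eps_nonneg
  nlinarith

/-- `r` is bounded because `v` is small compared to `r = v + (z⁻ - z)`. -/
theorem norm_r_le (hP : P.Assumptions) (hlam : 0 < lam) (hσ : 0 < σ) (hσ1 : σ < 1) (hc : 0 < s.c)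
    (hz : s.z ∈ P.H) (h : P.InexactProx lam σ s z v ε) :
    ‖v + s.z - z‖ ≤ P.Dh / (1 - σ) := by
  rw [le_div_iff₀ (by linarith)]
  have h1 := h.norm_v_le hP hlam hσ hc
  have h2 := hP.dist_le h.mem hz
  have h3 : ‖v + s.z - z‖ ≤ ‖v‖ + ‖s.z - z‖ := by rw [add_sub_assoc]; exact norm_add_le _ _
  linarith

theorem eps_le (hP : P.Assumptions) (hlam : 0 < lam) (hσ : 0 < σ) (hσ1 : σ < 1) (hc : 0 < s.c)
    (hz : s.z ∈ P.H) (h : P.InexactProx lam σ s z v ε) :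
    ε ≤ σ ^ 2 / (2 * (1 - σ) ^ 2) * P.Dh ^ 2 := by
  have h1 := h.test_le hP hlam hc
  have h2 := pow_le_pow_left₀ (norm_nonneg _) (h.norm_r_le hP hlam hσ hσ1 hc hz) 2
  have h3 := mul_le_mul_of_nonneg_left h2 (by positivity : 0 ≤ σ ^ 2)
  have e : σ ^ 2 / (2 * (1 - σ) ^ 2) * P.Dh ^ 2 = σ ^ 2 * (P.Dh / (1 - σ)) ^ 2 / 2 := by
    rw [div_pow]; field_simp
  rw [e]
  have : 0 ≤ ‖v‖ ^ 2 := by positivity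
  linarith

/-- Descent of the augmented Lagrangian for the old multiplier. -/
theorem descent (hP : P.Assumptions) (hlam : 0 < lam) (hc : 0 < s.c) (hz : s.z ∈ P.H)
    (h : P.InexactProx lam σ s z v ε) :
    (1 - σ ^ 2) / 2 * ‖v + s.z - z‖ ^ 2 ≤
      lam * (P.augLag s.c s.z s.p - P.augLag s.c z s.p) := by
  have h1 := h.subgrad s.z hz
  have h2 := h.test_le hP hlam hc
  rw [sub_self, norm_zero, norm_sub_rev z] at h1
  have e : ‖v + s.z - z‖ ^ 2 = ‖v‖ ^ 2 + 2 * ⟪v, s.z - z⟫_ℝ + ‖s.z - z‖ ^ 2 := by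
    rw [add_sub_assoc, norm_add_sq_real]
  linarith

/-- Upper bound on the augmented Lagrangian in terms of its values at any other point. -/
theorem augLag_le (hP : P.Assumptions) (hlam : 0 < lam) (hσ : 0 < σ) (hσ1 : σ < 1) (hc : 0 < s.c)
    (hz : s.z ∈ P.H) (h : P.InexactProx lam σ s z v ε) {y : E} (hy : y ∈ P.H) :
    P.augLag s.c z s.p ≤ P.augLag s.c y s.p
      + (1 / 2 + σ / (1 - σ) + σ ^ 2 / (2 * (1 - σ) ^ 2)) * (P.Dh ^ 2 / lam) := by
  have h1 := h.subgrad y hy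
  have h2 := h.eps_le hP hlam hσ hσ1 hc hz
  have h3 : ‖y - s.z‖ ^ 2 ≤ P.Dh ^ 2 := pow_le_pow_left₀ (norm_nonneg _) (hP.dist_le hz hy) 2
  have h4 : -⟪v, y - z⟫_ℝ ≤ σ / (1 - σ) * P.Dh ^ 2 := by
    have h5 : |⟪v, y - z⟫_ℝ| ≤ ‖v‖ * ‖y - z‖ := abs_real_inner_le_norm _ _
    have h6 : ‖v‖ * ‖y - z‖ ≤ σ * (P.Dh / (1 - σ)) * P.Dh :=
      mul_le_mul ((h.norm_v_le hP hlam hσ hc).trans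
        (mul_le_mul_of_nonneg_left (h.norm_r_le hP hlam hσ hσ1 hc hz) hσ.le))
        (hP.dist_le h.mem hy) (norm_nonneg _)
        (mul_nonneg hσ.le (div_nonneg Dh_nonneg (by linarith)))
    have e : σ / (1 - σ) * P.Dh ^ 2 = σ * (P.Dh / (1 - σ)) * P.Dh := by ring
    rw [e]
    exact (neg_le_abs _).trans (h5.trans h6)
  have h7 : 0 ≤ 1 / 2 * ‖z - s.z‖ ^ 2 := by positivity
  have h8 : lam * P.augLag s.c z s.p ≤ lam * (P.augLag s.c y s.p
      + (1 / 2 + σ / (1 - σ) + σ ^ 2 / (2 * (1 - σ) ^ 2)) * (P.Dh ^ 2 / lam)) := by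
    have e : lam * (P.augLag s.c y s.p
      + (1 / 2 + σ / (1 - σ) + σ ^ 2 / (2 * (1 - σ) ^ 2)) * (P.Dh ^ 2 / lam)) =
      lam * P.augLag s.c y s.p
      + (1 / 2 + σ / (1 - σ) + σ ^ 2 / (2 * (1 - σ) ^ 2)) * P.Dh ^ 2 := by
      rw [mul_add, mul_left_comm, mul_div_cancel₀ _ hlam.ne']
    rw [e]
    linarith
  exact le_of_mul_le_mul_left h8 hlam

/-- The refinement step is a proximal gradient step at `z` with step size `1/L`: its result is
close to `z`, and its optimality condition holds exactly at `ẑ` and up to `ε` at `z`. -/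
theorem refine_spec (hP : P.Assumptions) (hlam : 0 < lam) (hσ : 0 < σ) (hc : 0 < s.c)
    (h : P.InexactProx lam σ s z v ε) :
    (P.refine lam s z v).z ∈ P.H ∧
    P.Lpsi lam s.c s.p * ‖(P.refine lam s z v).z - z‖ ≤ σ * ‖v + s.z - z‖ ∧
    (∀ y ∈ P.H, lam * (P.h (P.refine lam s z v).z).toReal
      + ⟪v + s.z - z - lam • P.gradAL s.c s.p z
          + P.Lpsi lam s.c s.p • (z - (P.refine lam s z v).z), y - (P.refine lam s z v).z⟫_ℝ
        ≤ lam * (P.h y).toReal) ∧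
    (∀ y ∈ P.H, lam * (P.h z).toReal
      + ⟪v + s.z - z - lam • P.gradAL s.c s.p z
          + P.Lpsi lam s.c s.p • (z - (P.refine lam s z v).z), y - z⟫_ℝ - ε
        ≤ lam * (P.h y).toReal) := by
  set L := P.Lpsi lam s.c s.p with hL
  set r := v + s.z - z with hr
  set G := P.gradAL s.c s.p z with hG
  set zh := (P.refine lam s z v).z with hzh
  have hL1 : 1 ≤ L := hP.one_le_Lpsi hlam hc s.p
  have hgradz : P.gradSmoothAL s.c s.p z = G := hP.gradSmoothAL_eq hc s.p h.mem
  set ρ : E → ℝ := fun y => (lam * ⟪G, y - z⟫_ℝ - ⟪r, y - z⟫_ℝ) + lam * (P.h y).toReal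
    + L / 2 * ‖y - z‖ ^ 2 with hρ
  have hmin : zh ∈ P.H ∧ ∀ y ∈ P.H, ρ zh ≤ ρ y := by
    apply argmin_spec hP.H_compact ⟨_, hP.zbar_mem_H⟩
    · have := hP.h_cont
      simp only [ρ]
      fun_prop
    · intro y hy
      rw [hgradz, ← hP.h_coe hy, ← EReal.coe_add, ← EReal.coe_mul, ← EReal.coe_add]
      congr 1
      simp only [ρ, ← hr, ← hL]
      ring
    · intro y hy
      rw [h_eq_top hy, EReal.coe_add_top, EReal.coe_mul_top_of_pos hlam,
        EReal.top_add_coe]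
  obtain ⟨hzm, hmin⟩ := hmin
  have haff : ConvexOn ℝ P.H (fun y => lam * ⟪G, y - z⟫_ℝ - ⟪r, y - z⟫_ℝ) := by
    refine ⟨hP.H_convex, fun x _ y _ p q _ _ hpq => le_of_eq ?_⟩
    have e : p • x + q • y - z = p • (x - z) + q • (y - z) := by
      have : q = 1 - p := by linarith
      rw [this]; module
    simp only [e, inner_add_right, inner_smul_right, smul_eq_mul]
    ring
  have hstrong : StrongConvexOn P.H (0 + L) ρ :=
    StrongConvexOn.add (strongConvexOn_zero.2 (haff.add (hP.H_convexOn.smul hlam.le)))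
      (strongConvexOn_half_sq hP.H_convex _ _)
  rw [zero_add] at hstrong
  have hgrow : ∀ y ∈ P.H, ρ zh + L / 2 * ‖y - zh‖ ^ 2 ≤ ρ y := fun y hy =>
    add_half_sq_le_of_isMinOn hstrong hzm hmin hy
  -- optimality at `ẑ`
  have hopt : ∀ y ∈ P.H, lam * (P.h zh).toReal + ⟪r - lam • G + L • (z - zh), y - zh⟫_ℝ
      ≤ lam * (P.h y).toReal := by
    intro y hy
    have h1 := hgrow y hy
    simp only [ρ] at h1
    have e : y - z = (y - zh) + (zh - z) := by abel
    have e2 : ⟪z - zh, y - zh⟫_ℝ = -⟪y - zh, zh - z⟫_ℝ := by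
      rw [real_inner_comm, ← inner_neg_right]; congr 1; abel
    rw [e, norm_add_sq_real, inner_add_right, inner_add_right] at h1
    rw [inner_add_left, inner_sub_left, inner_smul_left, inner_smul_left, e2]
    simp only [conj_trivial]
    linarith
  -- the model overestimates the objective of the subproblem, so that `ẑ` cannot gain more than `ε`
  have hgain : lam * (P.h z).toReal - lam * (P.h zh).toReal ≤
      ε + (lam * ⟪G, zh - z⟫_ℝ - ⟪r, zh - z⟫_ℝ) + L / 2 * ‖zh - z‖ ^ 2 := by
    have h1 := h.subgrad zh hzm
    have h2 := le_add_half_sq_of_lipschitz_gradient hP.H_convex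
      (fun y hy => hP.hasGradient_smoothAL hc s.p hy)
      (fun a ha b hb => hP.gradAL_lipschitz hc s.p ha hb) h.mem hzm
    have h3 := mul_le_mul_of_nonneg_left h2 hlam.le
    have e : zh - s.z = (zh - z) + (z - s.z) := by abel
    have e2 : ⟪r, zh - z⟫_ℝ = ⟪v, zh - z⟫_ℝ - ⟪zh - z, z - s.z⟫_ℝ := by
      rw [real_inner_comm (z - s.z), ← inner_sub_left]; congr 1; rw [hr]; abel
    rw [e, norm_add_sq_real] at h1
    have e3 : L = lam * P.Ltilde s.c s.p + 1 := rfl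
    rw [e2, e3]
    simp only [augLag] at h1
    linarith
  have hclose : L / 2 * ‖zh - z‖ ^ 2 ≤ ε := by
    have h1 := hgrow z h.mem
    simp only [ρ, sub_self, inner_zero_right, norm_zero] at h1
    rw [norm_sub_rev z] at h1
    linarith
  refine ⟨hzm, ?_, hopt, fun y hy => ?_⟩
  · apply le_of_sq_le_sq _ (by positivity)
    have h1 := h.test
    rw [← hL, ← hr, div_mul_eq_mul_div, le_div_iff₀ (by linarith)] at h1
    have h2 : 0 ≤ ‖v‖ ^ 2 * L := by positivity
    nlinarith
  · have h1 := hopt y hy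
    have e : ⟪r - lam • G + L • (z - zh), y - zh⟫_ℝ =
        ⟪r - lam • G + L • (z - zh), y - z⟫_ℝ
          - (⟪r, zh - z⟫_ℝ - lam * ⟪G, zh - z⟫_ℝ - L * ‖zh - z‖ ^ 2) := by
      have : y - zh = (y - z) - (zh - z) := by abel
      rw [this, inner_sub_right]
      congr 1
      have e3 : z - zh = -(zh - z) := by abel
      rw [e3, inner_add_left, inner_sub_left, inner_smul_left, inner_smul_left, inner_neg_left,
        real_inner_self_eq_norm_sq]
      simp only [conj_trivial]
      ring
    have h2 : 0 ≤ L / 2 * ‖zh - z‖ ^ 2 := by positivity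
    linarith

end InexactProx

namespace InexactProx

variable {lam σ : ℝ} {s : OuterState E F} {z v : E} {ε : ℝ}

theorem norm_refine_w_le (hP : P.Assumptions) (hlam : 0 < lam) (hσ : 0 < σ) (hc : 0 < s.c)
    (h : P.InexactProx lam σ s z v ε) :
    ‖(P.refine lam s z v).w‖ ≤ (1 + 2 * σ) / lam * ‖v + s.z - z‖ := by
  obtain ⟨hzm, hclose, -, -⟩ := h.refine_spec hP hlam hσ hc
  set zh := (P.refine lam s z v).z with hzh
  set L := P.Lpsi lam s.c s.p with hL
  have hL1 : 1 ≤ L := hP.one_le_Lpsi hlam hc s.p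
  have hw : (P.refine lam s z v).w = lam⁻¹ • (v + s.z - z + L • (z - zh))
      + (P.gradAL s.c s.p zh - P.gradAL s.c s.p z) := by
    rw [← hP.gradSmoothAL_eq hc s.p hzm, ← hP.gradSmoothAL_eq hc s.p h.mem, ← add_sub_assoc]
    rfl
  have h1 : ‖v + s.z - z + L • (z - zh)‖ ≤ (1 + σ) * ‖v + s.z - z‖ := by
    refine (norm_add_le _ _).trans ?_
    rw [norm_smul, Real.norm_of_nonneg (by linarith), norm_sub_rev z]
    linarith
  have h2 : ‖P.gradAL s.c s.p zh - P.gradAL s.c s.p z‖ ≤ lam⁻¹ * (σ * ‖v + s.z - z‖) := by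
    refine (hP.gradAL_lipschitz hc s.p h.mem hzm).trans ?_
    rw [inv_mul_eq_div, le_div_iff₀ hlam]
    have e : L = lam * P.Ltilde s.c s.p + 1 := rfl
    have : 0 ≤ ‖zh - z‖ := norm_nonneg _
    rw [e] at hclose
    linarith
  have h3 := mul_le_mul_of_nonneg_left h1 (inv_pos.2 hlam).le
  rw [hw]
  refine (norm_add_le _ _).trans ?_
  rw [norm_smul, Real.norm_of_nonneg (inv_pos.2 hlam).le]
  refine (add_le_add h3 h2).trans (le_of_eq ?_)
  field_simp
  ring

/-- The refined quadruple satisfies all conditions of approximate stationarity except possibly the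
bounds on its residuals. -/
theorem refine_isApproxStationary (hP : P.Assumptions) (hlam : 0 < lam) (hσ : 0 < σ)
    (hc : 0 < s.c) (h : P.InexactProx lam σ s z v ε) {rho eta : ℝ}
    (hw : ‖(P.refine lam s z v).w‖ ≤ rho) (hq : ‖(P.refine lam s z v).q‖ ≤ eta) :
    P.IsApproxStationary rho eta (P.refine lam s z v) := by
  obtain ⟨hzm, -, hopt, -⟩ := h.refine_spec hP hlam hσ hc
  have hpdef : (P.refine lam s z v).p = proj P.dualK (s.p + s.c • P.g (P.refine lam s z v).z) := rfl
  have hqdef : (P.refine lam s z v).q = s.c⁻¹ • (s.p - (P.refine lam s z v).p) := rfl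
  have hgq : P.g (P.refine lam s z v).z + (P.refine lam s z v).q =
      s.c⁻¹ • (s.p + s.c • P.g (P.refine lam s z v).z - (P.refine lam s z v).p) := by
    have e : P.g (P.refine lam s z v).z = s.c⁻¹ • (s.c • P.g (P.refine lam s z v).z) := by
      rw [smul_smul, inv_mul_cancel₀ hc.ne', one_smul]
    rw [hqdef]
    nth_rw 1 [e]
    rw [← smul_add]; congr 1; abel
  refine ⟨?_, ?_, ?_, ?_, hw, hq⟩
  · set zh := (P.refine lam s z v).z with hzh
    set L := P.Lpsi lam s.c s.p with hL
    have hwdef : (P.refine lam s z v).w - P.gradf zh - P.gradg zh (P.refine lam s z v).p =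
        lam⁻¹ • (v + s.z - z - lam • P.gradAL s.c s.p z + L • (z - zh)) := by
      have hw : (P.refine lam s z v).w = lam⁻¹ • (v + s.z - z + L • (z - zh))
          + P.gradAL s.c s.p zh - P.gradAL s.c s.p z := by
        rw [← hP.gradSmoothAL_eq hc s.p hzm, ← hP.gradSmoothAL_eq hc s.p h.mem]
        rfl
      have e : v + s.z - z - lam • P.gradAL s.c s.p z + L • (z - zh) =
          v + s.z - z + L • (z - zh) - lam • P.gradAL s.c s.p z := by abel
      have e2 : P.gradAL s.c s.p zh = P.gradf zh + P.gradg zh (P.refine lam s z v).p := rfl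
      rw [hw, e, smul_sub _ _ (lam • P.gradAL s.c s.p z), smul_smul _ lam,
        inv_mul_cancel₀ hlam.ne', one_smul, e2]
      abel
    rw [hwdef]
    intro y
    by_cases hy : y ∈ P.H
    · have h1 := hopt y hy
      rw [← hP.h_coe hzm, ← hP.h_coe hy, ← EReal.coe_add, EReal.coe_le_coe_iff, sub_zero,
        inner_smul_left]
      simp only [conj_trivial]
      have h2 := mul_le_mul_of_nonneg_left h1 (inv_pos.2 hlam).le
      rw [mul_add, inv_mul_cancel_left₀ hlam.ne', inv_mul_cancel_left₀ hlam.ne'] at h2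
      exact h2
    · rw [h_eq_top hy]; exact le_top
  · rw [hgq, inner_smul_left, hpdef, P.inner_sub_proj_self, mul_zero]
  · rw [hgq]
    change 0 - _ ∈ P.K
    rw [zero_sub, ← smul_neg]
    exact P.K.smul_mem (P.sub_proj_mem_negK _) (inv_pos.2 hc).le
  · exact P.proj_mem _

/-- Bound on the feasibility residual in terms of the multipliers. -/
theorem norm_refine_q_le (hP : P.Assumptions) (hlam : 0 < lam) (hσ : 0 < σ) (hσ1 : σ < 1)
    (hc : 0 < s.c) (hz : s.z ∈ P.H) (h : P.InexactProx lam σ s z v ε) {C : ℝ} (hp : ‖s.p‖ ≤ C)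
    (hp' : ‖proj P.dualK (s.p + s.c • P.g z)‖ ≤ C) :
    ‖(P.refine lam s z v).q‖ ≤ (σ * P.Dh / (lam * (1 - σ) * P.Bg1) + 2 * C) / s.c := by
  obtain ⟨hzm, hclose, -, -⟩ := h.refine_spec hP hlam hσ hc
  have hqdef : (P.refine lam s z v).q =
    s.c⁻¹ • (s.p - proj P.dualK (s.p + s.c • P.g (P.refine lam s z v).z)) := rfl
  set zh := (P.refine lam s z v).z with hzh
  have hB := hP.Bg1_nonneg
  have h1 : ‖proj P.dualK (s.p + s.c • P.g zh) - proj P.dualK (s.p + s.c • P.g z)‖ ≤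
      s.c * (P.Bg1 * ‖zh - z‖) := by
    refine (P.norm_proj_sub_le _ _).trans ?_
    rw [add_sub_add_left_eq_sub, ← smul_sub, norm_smul, Real.norm_of_nonneg hc.le]
    exact mul_le_mul_of_nonneg_left (hP.norm_g_sub_le h.mem hzm) hc.le
  have h2 : s.c * (P.Bg1 * ‖zh - z‖) ≤ σ * P.Dh / (lam * (1 - σ) * P.Bg1) := by
    -- for `B_g^{(1)} = 0` both sides vanish, the right one as a division by zero
    rcases hB.eq_or_lt with h0 | h0
    · rw [← h0]; simp
    · rw [le_div_iff₀ (by have : 0 < 1 - σ := by linarith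
                          positivity)]
      have h3 := h.norm_r_le hP hlam hσ hσ1 hc hz
      rw [le_div_iff₀ (by linarith)] at h3
      have h4 : lam * s.c * P.Bg1 ^ 2 ≤ P.Lpsi lam s.c s.p := by
        have := hP.Bg0_nonneg
        have := hP.Lg_pos
        have := hP.Lf_pos
        unfold Lpsi Ltilde
        have : 0 ≤ lam * (P.Lf + P.Lg * ‖s.p‖ + s.c * (P.Bg0 * P.Lg)) := by positivity
        linarith
      have h5 := mul_le_mul_of_nonneg_right h4 (norm_nonneg (zh - z))
      have h6 := mul_le_mul_of_nonneg_right (h5.trans hclose) (by linarith : 0 ≤ 1 - σ)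
      have h7 := mul_le_mul_of_nonneg_left h3 hσ.le
      linarith
  have h3 : ‖s.p - proj P.dualK (s.p + s.c • P.g zh)‖ ≤
      σ * P.Dh / (lam * (1 - σ) * P.Bg1) + 2 * C := by
    have e : s.p - proj P.dualK (s.p + s.c • P.g zh) = s.p - proj P.dualK (s.p + s.c • P.g z)
      - (proj P.dualK (s.p + s.c • P.g zh) - proj P.dualK (s.p + s.c • P.g z)) := by abel
    rw [e]
    refine (norm_sub_le _ _).trans ?_
    have := norm_sub_le s.p (proj P.dualK (s.p + s.c • P.g z))
    linarith
  rw [hqdef, norm_smul, Real.norm_of_nonneg (inv_pos.2 hc).le, inv_mul_eq_div]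
  exact div_le_div_of_nonneg_right h3 hc.le

end InexactProx

/-! ### Bounded multipliers -/

namespace Assumptions

/-- Otherwise `d̄` would be the junk value `0`. -/
theorem frontier_nonempty (hP : P.Assumptions) : (frontier P.H).Nonempty := by
  have := hP.nontrivial
  rw [nonempty_frontier_iff]
  refine ⟨⟨_, hP.zbar_mem_H⟩, fun h => ?_⟩
  have h1 := hP.H_compact
  rw [h] at h1
  have := NormedSpace.noncompactSpace ℝ E
  exact noncompact_univ E h1

theorem dbar_pos (hP : P.Assumptions) : 0 < P.dbar := by
  refine (isClosed_frontier.notMem_iff_infDist_pos hP.frontier_nonempty).1 fun h => ?_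
  exact h.2 hP.zbar_mem

/-- A ball around `z̄` which does not meet `∂ℋ` stays in `ℋ`, being connected. -/
theorem closedBall_subset (hP : P.Assumptions) : Metric.closedBall P.zbar P.dbar ⊆ P.H := by
  have hcl := hP.H_compact.isClosed
  rw [← closure_ball _ hP.dbar_pos.ne']
  refine closure_minimal ?_ hcl
  have h1 : Metric.ball P.zbar P.dbar ⊆ interior P.H := by
    refine IsPreconnected.subset_left_of_subset_union isOpen_interior hcl.isOpen_compl
      (disjoint_compl_right.mono_left interior_subset) (fun y hy => ?_)
      ⟨_, Metric.mem_ball_self hP.dbar_pos, hP.zbar_mem⟩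
      (convex_ball P.zbar P.dbar).isPreconnected
    by_contra hn
    rw [Set.mem_union, not_or, Set.notMem_compl_iff] at hn
    have hf : y ∈ frontier P.H := ⟨subset_closure hn.2, hn.1⟩
    have := Metric.infDist_le_dist_of_mem (x := P.zbar) hf
    rw [Metric.mem_ball, dist_comm] at hy
    exact absurd (lt_of_le_of_lt this hy) (lt_irrefl _)
  exact h1.trans interior_subset

theorem min_dbar_pos (hP : P.Assumptions) : 0 < min 1 P.dbar * P.tau :=
  mul_pos (lt_min one_pos hP.dbar_pos) hP.tau_pos

theorem C0_nonneg (hP : P.Assumptions) (lam σ : ℝ) (p0 : F) : 0 ≤ P.C0 lam σ p0 :=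
  div_nonneg ((norm_nonneg _).trans (le_max_left _ _)) hP.min_dbar_pos.le

theorem norm_p0_le (hP : P.Assumptions) (lam σ : ℝ) (p0 : F) : ‖p0‖ ≤ P.C0 lam σ p0 := by
  rw [C0, le_div_iff₀ hP.min_dbar_pos]
  have h1 : min 1 P.dbar * P.tau ≤ 1 :=
    mul_le_one₀ (min_le_left _ _) hP.tau_pos.le hP.tau_le
  exact (mul_le_of_le_one_right (norm_nonneg _) h1).trans (le_max_left _ _)

end Assumptions

namespace InexactProx

variable {lam σ : ℝ} {s : OuterState E F} {z v : E} {ε : ℝ}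

/-- The Slater-like condition turns the approximate optimality condition at `z` into a bound on
the new multiplier `p⁺`, in which `⟨p⁺, g(z)⟩ = ⟨p⁺, p⁺ - p⟩ / c`. -/
theorem multiplier_estimate (hP : P.Assumptions) (hlam : 0 < lam) (hσ : 0 < σ) (hσ1 : σ < 1)
    (hc : 0 < s.c) (hz : s.z ∈ P.H) (h : P.InexactProx lam σ s z v ε) :
    min 1 P.dbar * P.tau * ‖proj P.dualK (s.p + s.c • P.g z)‖
      + ‖proj P.dualK (s.p + s.c • P.g z)‖
        * (‖proj P.dualK (s.p + s.c • P.g z)‖ - ‖s.p‖) / s.c ≤ P.kappa0 lam σ := by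
  obtain ⟨hzm, hclose, -, hopt⟩ := h.refine_spec hP hlam hσ hc
  set zh := (P.refine lam s z v).z with hzh
  set L := P.Lpsi lam s.c s.p with hL
  have hL1 : 1 ≤ L := hP.one_le_Lpsi hlam hc s.p
  set p := proj P.dualK (s.p + s.c • P.g z) with hp
  have hpm : p ∈ P.dualK := P.proj_mem _
  set ω := v + s.z - z + L • (z - zh) with hω
  have hD0 : 0 ≤ P.Dh := Dh_nonneg
  have hω_le : ‖ω‖ ≤ (1 + σ) / (1 - σ) * P.Dh := by
    have h1 : ‖ω‖ ≤ (1 + σ) * ‖v + s.z - z‖ := by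
      refine (norm_add_le _ _).trans ?_
      rw [norm_smul, Real.norm_of_nonneg (by linarith), norm_sub_rev z]
      linarith
    have h2 := h.norm_r_le hP hlam hσ hσ1 hc hz
    have e : (1 + σ) / (1 - σ) * P.Dh = (1 + σ) * (P.Dh / (1 - σ)) := by ring
    rw [e]
    exact h1.trans (mul_le_mul_of_nonneg_left h2 (by linarith))
  have hε := h.eps_le hP hlam hσ hσ1 hc hz
  -- the optimality condition, solved for the term with the multiplier
  set S := (P.Kh + P.Bf1) * P.Dh + (1 + σ) / (1 - σ) * (P.Dh ^ 2 / lam)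
    + σ ^ 2 / (2 * (1 - σ) ^ 2) * (P.Dh ^ 2 / lam) with hS
  have hkey : ∀ y ∈ P.H, -⟪P.gradg z p, y - z⟫_ℝ ≤ S := by
    intro y hy
    have h1 := hopt y hy
    have e : v + s.z - z - lam • P.gradAL s.c s.p z + L • (z - zh) =
        ω - lam • P.gradf z - lam • P.gradg z p := by
      have : P.gradAL s.c s.p z = P.gradf z + P.gradg z p := rfl
      rw [this, hω, smul_add]; abel
    rw [e, inner_sub_left, inner_sub_left, inner_smul_left, inner_smul_left] at h1
    simp only [conj_trivial] at h1
    have hd := hP.dist_le h.mem hy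
    have h2 : (P.h y).toReal - (P.h z).toReal ≤ P.Kh * P.Dh :=
      (le_abs_self _).trans ((hP.h_lip z h.mem y hy).trans
        (mul_le_mul_of_nonneg_left hd hP.Kh_pos.le))
    have h3 : ⟪P.gradf z, y - z⟫_ℝ ≤ P.Bf1 * P.Dh :=
      (real_inner_le_norm _ _).trans
        (mul_le_mul (hP.norm_gradf_le h.mem) hd (norm_nonneg _) hP.Bf1_nonneg)
    have h4 : -⟪ω, y - z⟫_ℝ ≤ (1 + σ) / (1 - σ) * P.Dh ^ 2 := by
      refine (neg_le_abs _).trans ((abs_real_inner_le_norm _ _).trans ?_)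
      have : (1 + σ) / (1 - σ) * P.Dh ^ 2 = (1 + σ) / (1 - σ) * P.Dh * P.Dh := by ring
      rw [this]
      exact mul_le_mul hω_le hd (norm_nonneg _) ((norm_nonneg _).trans hω_le)
    have h5 := mul_le_mul_of_nonneg_left h2 hlam.le
    have h6 := mul_le_mul_of_nonneg_left h3 hlam.le
    have h7 : lam * -⟪P.gradg z p, y - z⟫_ℝ ≤ lam * S := by
      have e : lam * S = lam * ((P.Kh + P.Bf1) * P.Dh) + (1 + σ) / (1 - σ) * P.Dh ^ 2
          + σ ^ 2 / (2 * (1 - σ) ^ 2) * P.Dh ^ 2 := by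
        rw [hS, mul_add, mul_add, mul_left_comm lam ((1 + σ) / (1 - σ)),
          mul_left_comm lam (σ ^ 2 / (2 * (1 - σ) ^ 2)), mul_div_cancel₀ _ hlam.ne']
      rw [e]
      linarith
    exact le_of_mul_le_mul_left h7 hlam
  have hSk : S ≤ P.kappa0 lam σ := by
    have h1 : 0 ≤ (P.Kh + P.Bf1) * P.Dh :=
      mul_nonneg (add_nonneg hP.Kh_pos.le hP.Bf1_nonneg) hD0
    have h2 : 0 ≤ (1 + σ) / (1 - σ) * (P.Dh ^ 2 / lam) :=
      mul_nonneg (div_nonneg (by linarith) (by linarith)) (by positivity)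
    rw [hS, kappa0]
    linarith
  -- the test point lies in the direction opposite to `∇g(z) p`, on the sphere inscribed in `ℋ`
  set m := P.gradg z p with hm
  set y := P.zbar - (P.dbar / ‖m‖) • m with hy
  have hyb : ‖(P.dbar / ‖m‖) • m‖ ≤ P.dbar := by
    rw [norm_smul, Real.norm_of_nonneg (div_nonneg hP.dbar_pos.le (norm_nonneg _))]
    rcases (norm_nonneg m).eq_or_lt with h0 | h0
    · rw [← h0, mul_zero]; exact hP.dbar_pos.le
    · rw [div_mul_cancel₀ _ h0.ne']
  have hym : y ∈ P.H := by
    apply hP.closedBall_subset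
    rw [Metric.mem_closedBall, dist_eq_norm, hy, sub_sub_cancel_left, norm_neg]
    exact hyb
  have h1 := hkey y hym
  have h2 : ⟪m, y - z⟫_ℝ = ⟪m, P.zbar - z⟫_ℝ - P.dbar * ‖m‖ := by
    have e : y - z = (P.zbar - z) - (P.dbar / ‖m‖) • m := by rw [hy]; abel
    rw [e, inner_sub_right, inner_smul_right, real_inner_self_eq_norm_sq]
    congr 1
    rcases (norm_nonneg m).eq_or_lt with h0 | h0
    · rw [← h0]; simp
    · field_simp
  have h3 := hP.inner_gradg_le hpm z P.zbar
  rw [← hm] at h3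
  have h4 : ⟪p, P.g P.zbar⟫_ℝ ≤ 0 := by
    have h5 := hP.zbar_feas
    have h6 := hpm _ h5
    rw [zero_sub, inner_neg_right] at h6
    linarith
  have h5 : ⟪p, P.g z⟫_ℝ ≥ ‖p‖ * (‖p‖ - ‖s.p‖) / s.c := by
    have h6 := P.inner_proj_self (s.p + s.c • P.g z)
    rw [← hp, inner_add_right, inner_smul_right] at h6
    have h7 := real_inner_le_norm p s.p
    rw [ge_iff_le, div_le_iff₀ hc]
    nlinarith
  have h6 := hP.slater z h.mem p hpm
  rw [← hm] at h6
  have h7 : min 1 P.dbar * P.tau * ‖p‖ ≤ |⟪p, P.g P.zbar⟫_ℝ| + P.dbar * ‖m‖ := by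
    have hmin0 : 0 ≤ min 1 P.dbar := le_min zero_le_one hP.dbar_pos.le
    have h8 := mul_le_mul_of_nonneg_left h6 hmin0
    have h9 : min 1 P.dbar * max ‖m‖ |⟪p, P.g P.zbar⟫_ℝ| ≤ |⟪p, P.g P.zbar⟫_ℝ| + P.dbar * ‖m‖ := by
      have ha : 0 ≤ |⟪p, P.g P.zbar⟫_ℝ| := abs_nonneg _
      have hb : 0 ≤ ‖m‖ := norm_nonneg _
      rcases max_choice ‖m‖ |⟪p, P.g P.zbar⟫_ℝ| with hc | hc
      · rw [hc]
        have := mul_le_mul_of_nonneg_right (min_le_right 1 P.dbar) hb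
        linarith
      · rw [hc]
        have := mul_le_mul_of_nonneg_right (min_le_left 1 P.dbar) ha
        have := mul_nonneg hP.dbar_pos.le hb
        linarith
    rw [mul_assoc]
    exact h8.trans h9
  rw [abs_of_nonpos h4] at h7
  linarith

/-- The multipliers never leave the ball of radius `C₀`. -/
theorem norm_multiplier_le (hP : P.Assumptions) (hlam : 0 < lam) (hσ : 0 < σ) (hσ1 : σ < 1)
    (hc : 0 < s.c) (hz : s.z ∈ P.H) (h : P.InexactProx lam σ s z v ε) {p0 : F}
    (hp : ‖s.p‖ ≤ P.C0 lam σ p0) :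
    ‖proj P.dualK (s.p + s.c • P.g z)‖ ≤ P.C0 lam σ p0 := by
  by_contra hlt
  rw [not_le] at hlt
  have h1 := h.multiplier_estimate hP hlam hσ hσ1 hc hz
  have h2 : 0 ≤ ‖proj P.dualK (s.p + s.c • P.g z)‖
        * (‖proj P.dualK (s.p + s.c • P.g z)‖ - ‖s.p‖) / s.c :=
    div_nonneg (mul_nonneg (norm_nonneg _) (by linarith)) hc.le
  have h3 : P.C0 lam σ p0 * (min 1 P.dbar * P.tau) <
      ‖proj P.dualK (s.p + s.c • P.g z)‖ * (min 1 P.dbar * P.tau) :=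
    mul_lt_mul_of_pos_right hlt hP.min_dbar_pos
  rw [C0, div_mul_cancel₀ _ hP.min_dbar_pos.ne'] at h3
  have := le_max_right ‖p0‖ (P.kappa0 lam σ)
  linarith

end InexactProx

/-! ### Values of the augmented Lagrangian -/

/-- Effect of the multiplier update on the augmented Lagrangian. -/
theorem augLag_update_le (P : Problem E F) {c : ℝ} (hc : 0 < c) (z : E) (p : F) :
    P.augLag c z (proj P.dualK (p + c • P.g z)) ≤
      P.augLag c z p + 1 / c * ‖proj P.dualK (p + c • P.g z) - p‖ ^ 2 := by
  set q := proj P.dualK (p + c • P.g z) with hq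
  have h1 := P.infDist_negK_le (y := q + c • P.g z) (P.sub_proj_mem_negK (p + c • P.g z))
  have e : q + c • P.g z - (p + c • P.g z - q) = q + (q - p) := by abel
  rw [← hq, e] at h1
  have h2 := pow_le_pow_left₀ Metric.infDist_nonneg h1 2
  have h3 : ‖q + (q - p)‖ ^ 2 = 2 * ‖q - p‖ ^ 2 + 2 * ‖q‖ ^ 2 - ‖p‖ ^ 2 := by
    rw [norm_add_sq_real, norm_sub_sq_real, inner_sub_right, real_inner_self_eq_norm_sq]
    ring
  rw [augLag, augLag, smoothAL, smoothAL, P.infDist_negK (p + c • P.g z), ← hq]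
  have h4 : 1 / (2 * c) * (Metric.infDist (q + c • P.g z) P.negK ^ 2 - ‖q‖ ^ 2) ≤
      1 / (2 * c) * (2 * ‖q - p‖ ^ 2 + ‖q‖ ^ 2 - ‖p‖ ^ 2) :=
    mul_le_mul_of_nonneg_left (by linarith) (by positivity)
  have h5 : 1 / (2 * c) * (2 * ‖q - p‖ ^ 2 + ‖q‖ ^ 2 - ‖p‖ ^ 2) =
      1 / (2 * c) * (‖q‖ ^ 2 - ‖p‖ ^ 2) + 1 / c * ‖q - p‖ ^ 2 := by field_simp; ring
  linarith

/-- At feasible points the augmented Lagrangian does not exceed the objective. -/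
theorem augLag_le_of_feasible (P : Problem E F) {c : ℝ} (hc : 0 < c) {z : E} (p : F)
    (hz : P.LeK (P.g z) 0) : P.augLag c z p ≤ P.f z + (P.h z).toReal := by
  have hs : c • P.g z ∈ P.negK := by
    change -(c • P.g z) ∈ P.K
    rw [← smul_neg]
    refine P.K.smul_mem ?_ hc.le
    rw [← zero_sub]; exact hz
  have h1 := P.infDist_negK_le (y := p + c • P.g z) hs
  rw [add_sub_cancel_right] at h1
  have h2 := pow_le_pow_left₀ Metric.infDist_nonneg h1 2
  rw [augLag, smoothAL]
  have : 1 / (2 * c) * (Metric.infDist (p + c • P.g z) P.negK ^ 2 - ‖p‖ ^ 2) ≤ 0 :=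
    mul_nonpos_of_nonneg_of_nonpos (by positivity) (by linarith)
  linarith

theorem le_augLag (P : Problem E F) {c : ℝ} (hc : 0 < c) (z : E) (p : F) :
    P.f z + (P.h z).toReal - 1 / (2 * c) * ‖p‖ ^ 2 ≤ P.augLag c z p := by
  rw [augLag, smoothAL]
  have : 0 ≤ 1 / (2 * c) * Metric.infDist (p + c • P.g z) P.negK ^ 2 := by positivity
  linarith

namespace Assumptions

theorem phi_eq (hP : P.Assumptions) {z : E} (hz : z ∈ P.H) :
    P.phi z = ((P.f z + (P.h z).toReal : ℝ) : EReal) := by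
  rw [phi, EReal.coe_add, hP.h_coe hz]

/-- The infimum `φ_*` is finite and a lower bound, and `φ^*` is approximated by feasible values. -/
theorem phi_bounds (hP : P.Assumptions) :
    (∀ z ∈ P.H, P.phiLower ≤ P.f z + (P.h z).toReal) ∧ P.phiLower ≤ P.phiUpper ∧
    ∀ δ > 0, ∃ z ∈ P.H, P.LeK (P.g z) 0 ∧ P.f z + (P.h z).toReal ≤ P.phiUpper + δ := by
  have hcont : ContinuousOn (fun z => P.f z + (P.h z).toReal) P.H :=
    hP.f_diff.continuousOn.add hP.h_cont
  obtain ⟨a, ha, hmin⟩ := hP.H_compact.exists_isMinOn ⟨_, hP.zbar_mem_H⟩ hcont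
  have htop : ∀ z, z ∉ P.H → P.phi z = ⊤ := fun z hz => by
    rw [phi, h_eq_top hz, EReal.coe_add_top]
  have hlow : ∀ z, P.phi a ≤ P.phi z := by
    intro z
    by_cases hz : z ∈ P.H
    · rw [hP.phi_eq ha, hP.phi_eq hz]; exact_mod_cast hmin hz
    · rw [htop z hz]; exact le_top
  have hinf : (⨅ z : E, P.phi z) = P.phi a := le_antisymm (iInf_le _ a) (le_iInf hlow)
  have hlower : P.phiLower = P.f a + (P.h a).toReal := by
    rw [phiLower, hinf, hP.phi_eq ha, EReal.toReal_coe]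
  set U := ⨅ z ∈ {z : E | P.LeK (P.g z) 0}, P.phi z with hU
  have hU1 : P.phi a ≤ U := le_iInf₂ fun z _ => hlow z
  have hU2 : U ≤ P.phi P.zbar := iInf₂_le P.zbar hP.zbar_feas
  have hUtop : U ≠ ⊤ := by
    rw [hP.phi_eq hP.zbar_mem_H] at hU2
    exact ne_top_of_le_ne_top (EReal.coe_ne_top _) hU2
  have hUbot : U ≠ ⊥ := by
    rw [hP.phi_eq ha] at hU1
    exact ne_bot_of_le_ne_bot (EReal.coe_ne_bot _) hU1
  have hUr : ((P.phiUpper : ℝ) : EReal) = U := EReal.coe_toReal hUtop hUbot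
  refine ⟨fun z hz => ?_, ?_, fun δ hδ => ?_⟩
  · rw [hlower]; exact hmin hz
  · rw [← hUr, hP.phi_eq ha, EReal.coe_le_coe_iff, ← hlower] at hU1
    exact hU1
  · have h1 : U < ((P.phiUpper + δ : ℝ) : EReal) := by
      rw [← hUr, EReal.coe_lt_coe_iff]; linarith
    obtain ⟨z, hz⟩ := iInf_lt_iff.1 h1
    obtain ⟨hzf, hz⟩ := iInf_lt_iff.1 hz
    have hzH : z ∈ P.H := by
      by_contra hn
      rw [htop z hn] at hz
      exact absurd hz not_top_lt
    rw [hP.phi_eq hzH, EReal.coe_lt_coe_iff] at hz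
    exact ⟨z, hzH, hzf, hz.le⟩

theorem Dh_pos (hP : P.Assumptions) : 0 < P.Dh := by
  obtain ⟨y, hy⟩ := hP.frontier_nonempty
  have hcl := hP.H_compact.isClosed
  have hne : y ≠ P.zbar := fun h => hy.2 (h ▸ hP.zbar_mem)
  have := hP.dist_le hP.zbar_mem_H (hcl.frontier_subset hy)
  exact lt_of_lt_of_le (norm_pos_iff.2 (sub_ne_zero.2 hne)) this

theorem Rphi_pos (hP : P.Assumptions) {lam : ℝ} (hlam : 0 < lam) : 0 < P.Rphi lam := by
  have h1 := hP.phi_bounds.2.1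
  have h2 := hP.Dh_pos
  have : 0 < P.Dh ^ 2 / lam := by positivity
  unfold Rphi; linarith

end Assumptions

/-- Comparison of the inexact proximal point with nearly optimal feasible points. -/
theorem InexactProx.augLag_le_phiUpper (hP : P.Assumptions) {lam σ : ℝ} {s : OuterState E F}
    {z v : E} {ε : ℝ} (hlam : 0 < lam) (hσ : 0 < σ) (hσ1 : σ < 1) (hc : 0 < s.c)
    (hz : s.z ∈ P.H) (h : P.InexactProx lam σ s z v ε) :
    P.augLag s.c z s.p ≤ P.phiUpper
      + (1 / 2 + σ / (1 - σ) + σ ^ 2 / (2 * (1 - σ) ^ 2)) * (P.Dh ^ 2 / lam) := by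
  refine le_of_forall_pos_le_add fun δ hδ => ?_
  obtain ⟨y, hy, hyf, hyδ⟩ := hP.phi_bounds.2.2 δ hδ
  have h1 := h.augLag_le hP hlam hσ hσ1 hc hz hy
  have h2 := P.augLag_le_of_feasible hc s.p hyf
  linarith

/-! ### Counting outer and inner iterations -/

/-- The threshold in the test for doubling the penalty parameter. -/
noncomputable def threshold (lam σ rho : ℝ) : ℝ :=
  lam * (1 - σ ^ 2) * rho ^ 2 / (4 * (1 + 2 * σ) ^ 2)

/-- The factor of `D_h² / λ` in the upper bound on the augmented Lagrangian. -/
noncomputable def proxConst (σ : ℝ) : ℝ := 1 / 2 + σ / (1 - σ) + σ ^ 2 / (2 * (1 - σ) ^ 2)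

/-- Bound on the decrease of the augmented Lagrangian within a cycle of constant penalty. -/
noncomputable def cycleGap (P : Problem E F) (lam σ c1 : ℝ) (p0 : F) : ℝ :=
  P.phiUpper - P.phiLower + proxConst σ * (P.Dh ^ 2 / lam) + 5 * (P.C0 lam σ p0 ^ 2 / c1)

/-- Bound on the number of outer iterations in a cycle of constant penalty. -/
noncomputable def cycleLength (P : Problem E F) (lam σ c1 : ℝ) (p0 : F) (rho : ℝ) : ℝ :=
  P.cycleGap lam σ c1 p0 / threshold lam σ rho + 2

/-- The factor `λ (κ₁ + c₁ κ₂) + 1` of `𝒯`: it bounds `L^ψ` as long as the penalty is `c₁`. -/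
noncomputable def baseL (P : Problem E F) (lam σ c1 : ℝ) (p0 : F) : ℝ :=
  lam * (P.kappa1 lam σ p0 + c1 * P.kappa2) + 1

theorem threshold_pos {lam σ rho : ℝ} (hlam : 0 < lam) (hσ : 0 < σ) (hσ1 : σ < 1)
    (hrho : 0 < rho) : 0 < threshold lam σ rho := by
  have : 0 < 1 - σ ^ 2 := by nlinarith
  unfold threshold; positivity

theorem proxConst_nonneg {σ : ℝ} (hσ : 0 < σ) (hσ1 : σ < 1) : 0 ≤ proxConst σ := by
  have : 0 < 1 - σ := by linarith
  unfold proxConst; positivity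

theorem kappa1_eq (P : Problem E F) (lam σ : ℝ) (p0 : F) :
    P.kappa1 lam σ p0 = P.Lf + P.Lg * P.C0 lam σ p0 := by
  unfold kappa1 C0; ring

theorem kappa4_eq (P : Problem E F) (lam σ : ℝ) (p0 : F) :
    P.kappa4 lam σ p0 = σ * P.Dh / (lam * (1 - σ) * P.Bg1) + 2 * P.C0 lam σ p0 := by
  unfold kappa4 C0; ring

namespace Assumptions

theorem cycleGap_nonneg (hP : P.Assumptions) {lam σ c1 : ℝ} (hlam : 0 < lam) (hσ : 0 < σ)
    (hσ1 : σ < 1) (hc1 : 0 < c1) (p0 : F) : 0 ≤ P.cycleGap lam σ c1 p0 := by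
  have h1 := hP.phi_bounds.2.1
  have h2 := proxConst_nonneg hσ hσ1
  have h3 : 0 ≤ proxConst σ * (P.Dh ^ 2 / lam) := by positivity
  have h4 : 0 ≤ 5 * (P.C0 lam σ p0 ^ 2 / c1) := by positivity
  unfold cycleGap; linarith

theorem two_le_cycleLength (hP : P.Assumptions) {lam σ c1 rho : ℝ} (hlam : 0 < lam) (hσ : 0 < σ)
    (hσ1 : σ < 1) (hc1 : 0 < c1) (hrho : 0 < rho) (p0 : F) :
    2 ≤ P.cycleLength lam σ c1 p0 rho := by
  have := div_nonneg (hP.cycleGap_nonneg hlam hσ hσ1 hc1 p0)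
    (threshold_pos hlam hσ hσ1 hrho).le
  unfold cycleLength; linarith

theorem kappa3_eq (hP : P.Assumptions) (lam σ : ℝ) (p0 : F) :
    P.kappa3 lam σ p0 =
      4 * P.C0 lam σ p0 ^ 2 * (4 * (1 + 2 * σ) ^ 2) / (lam * (1 - σ ^ 2)) := by
  have h : min 1 (P.dbar ^ 2) = (min 1 P.dbar) ^ 2 := by
    rcases le_total 1 P.dbar with h | h
    · rw [min_eq_left h, min_eq_left (by nlinarith), one_pow]
    · rw [min_eq_right h, min_eq_right (by nlinarith [hP.dbar_pos])]
  have h1 : min 1 P.dbar ≠ 0 := (lt_min one_pos hP.dbar_pos).ne'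
  have h2 := hP.tau_pos.ne'
  unfold kappa3 C0
  rw [h, div_pow, mul_pow, mul_div_assoc', div_mul_eq_mul_div, div_div]
  congr 1 <;> ring

theorem kappa2_nonneg (hP : P.Assumptions) : 0 ≤ P.kappa2 := by
  have := hP.Bg0_nonneg
  have := hP.Lg_pos
  unfold kappa2; positivity

theorem kappa3_nonneg (hP : P.Assumptions) {lam σ : ℝ} (hlam : 0 < lam) (hσ : 0 < σ)
    (hσ1 : σ < 1) (p0 : F) : 0 ≤ P.kappa3 lam σ p0 := by
  have : 0 < 1 - σ ^ 2 := by nlinarith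
  rw [hP.kappa3_eq]; positivity

theorem kappa4_nonneg (hP : P.Assumptions) {lam σ : ℝ} (hlam : 0 < lam) (hσ : 0 < σ)
    (hσ1 : σ < 1) (p0 : F) : 0 ≤ P.kappa4 lam σ p0 := by
  have := hP.C0_nonneg lam σ p0
  have := hP.Bg1_nonneg
  have : 0 ≤ P.Dh := Dh_nonneg
  have : 0 < 1 - σ := by linarith
  rw [kappa4_eq]; positivity

theorem one_le_baseL (hP : P.Assumptions) {lam σ c1 : ℝ} (hlam : 0 < lam) (hc1 : 0 < c1)
    (p0 : F) : 1 ≤ P.baseL lam σ c1 p0 := by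
  have := hP.kappa2_nonneg
  have := hP.C0_nonneg lam σ p0
  have := hP.Lf_pos
  have := hP.Lg_pos
  have : 0 ≤ lam * (P.Lf + P.Lg * P.C0 lam σ p0 + c1 * P.kappa2) := by positivity
  unfold baseL; rw [kappa1_eq]; linarith

/-- `L^ψ` grows at most linearly with the penalty parameter. -/
theorem Lpsi_le (hP : P.Assumptions) {lam σ c1 c : ℝ} (hlam : 0 < lam) (hc1 : 0 < c1)
    (hc : c1 ≤ c) {p p0 : F} (hp : ‖p‖ ≤ P.C0 lam σ p0) :
    P.Lpsi lam c p ≤ P.baseL lam σ c1 p0 * (c / c1) := by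
  have h0 : 1 ≤ c / c1 := (one_le_div hc1).2 hc
  have h1 := hP.kappa2_nonneg
  have h2 := hP.C0_nonneg lam σ p0
  have h3 := hP.Lf_pos
  have h4 := mul_le_mul_of_nonneg_left hp hP.Lg_pos.le
  have h5 : 0 ≤ P.Lg * P.C0 lam σ p0 := mul_nonneg hP.Lg_pos.le h2
  have e : P.baseL lam σ c1 p0 * (c / c1) =
      (lam * (P.Lf + P.Lg * P.C0 lam σ p0) + 1) * (c / c1) + lam * (c * P.kappa2) := by
    unfold baseL; rw [kappa1_eq]; field_simp; ring
  have h6 : lam * (P.Lf + P.Lg * P.C0 lam σ p0) + 1 ≤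
      (lam * (P.Lf + P.Lg * P.C0 lam σ p0) + 1) * (c / c1) :=
    le_mul_of_one_le_right (by positivity) h0
  have h7 : P.Lpsi lam c p = lam * (P.Lf + P.Lg * ‖p‖) + 1 + lam * (c * P.kappa2) := by
    unfold Lpsi Ltilde kappa2; ring
  have h8 := mul_le_mul_of_nonneg_left h4 hlam.le
  rw [e, h7]
  linarith

end Assumptions

theorem logOnePlus_mono {a b : ℝ} (ha : 0 < a) (hab : a ≤ b) : logOnePlus a ≤ logOnePlus b :=
  max_le_max_right _ (Real.log_le_log ha hab)

/-- Once the penalty parameter has reached `c̄`, an outer iteration in which the method does not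
stop decreases the augmented Lagrangian by more than the threshold. -/
theorem InexactProx.threshold_lt (hP : P.Assumptions) {lam σ : ℝ} {s : OuterState E F}
    {z v : E} {ε : ℝ} (hlam : 0 < lam) (hσ : 0 < σ) (hσ1 : σ < 1) (hc : 0 < s.c)
    (hz : s.z ∈ P.H) (h : P.InexactProx lam σ s z v ε) {p0 : F} (hp : ‖s.p‖ ≤ P.C0 lam σ p0)
    {rho eta : ℝ} (hrho : 0 < rho) (heta : 0 < eta) (hcb : P.cbar lam σ p0 rho eta ≤ s.c)
    (hcont : ¬ (‖(P.refine lam s z v).w‖ ≤ rho ∧ ‖(P.refine lam s z v).q‖ ≤ eta)) :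
    threshold lam σ rho < P.augLag s.c s.z s.p
      - P.augLag s.c z (proj P.dualK (s.p + s.c • P.g z)) := by
  have hσ2 : 0 < 1 - σ ^ 2 := by nlinarith
  have hp' := h.norm_multiplier_le hP hlam hσ hσ1 hc hz hp
  have hk3 := hP.kappa3_nonneg hlam hσ hσ1 p0
  have hk4 := hP.kappa4_nonneg hlam hσ hσ1 p0
  have hk3' : 0 ≤ P.kappa3 lam σ p0 / rho ^ 2 := by positivity
  have hk4' : 0 ≤ P.kappa4 lam σ p0 / eta := by positivity
  rw [cbar] at hcb
  have hq : ‖(P.refine lam s z v).q‖ ≤ eta := by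
    refine (h.norm_refine_q_le hP hlam hσ hσ1 hc hz hp hp').trans ?_
    rw [← kappa4_eq, div_le_iff₀ hc, mul_comm, ← div_le_iff₀ heta]
    linarith
  have hw : rho < ‖(P.refine lam s z v).w‖ := by
    by_contra hn; exact hcont ⟨not_lt.1 hn, hq⟩
  have h1 := hw.trans_le (h.norm_refine_w_le hP hlam hσ hc)
  have h2 : lam * rho / (1 + 2 * σ) < ‖v + s.z - z‖ := by
    rw [div_lt_iff₀ (by linarith)]
    rw [div_mul_eq_mul_div, lt_div_iff₀ hlam] at h1
    linarith
  have h3 := pow_lt_pow_left₀ h2 (by positivity) two_ne_zero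
  have h4 := h.descent hP hlam hc hz
  have h5 : lam * (2 * threshold lam σ rho) <
      lam * (P.augLag s.c s.z s.p - P.augLag s.c z s.p) := by
    refine lt_of_lt_of_le ?_ h4
    have e : lam * (2 * threshold lam σ rho) =
        (1 - σ ^ 2) / 2 * (lam * rho / (1 + 2 * σ)) ^ 2 := by
      unfold threshold; field_simp; ring
    rw [e]
    exact mul_lt_mul_of_pos_left h3 (by linarith)
  have h6 := lt_of_mul_lt_mul_left h5 hlam.le
  have h7 := P.augLag_update_le hc z s.p
  have h8 : ‖proj P.dualK (s.p + s.c • P.g z) - s.p‖ ≤ 2 * P.C0 lam σ p0 := by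
    refine (norm_sub_le _ _).trans ?_; linarith
  have h9 := pow_le_pow_left₀ (norm_nonneg _) h8 2
  have h10 : 1 / s.c * ‖proj P.dualK (s.p + s.c • P.g z) - s.p‖ ^ 2 ≤ threshold lam σ rho := by
    rw [one_div_mul_eq_div, div_le_iff₀ hc]
    refine h9.trans ?_
    have h11 : P.kappa3 lam σ p0 / rho ^ 2 ≤ s.c := by linarith
    have h12 := mul_le_mul_of_nonneg_left h11 (threshold_pos hlam hσ hσ1 hrho).le
    refine le_trans (le_of_eq ?_) h12
    rw [hP.kappa3_eq]
    unfold threshold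
    field_simp
    ring
  linarith

/-- The invariant of the outer iterations, as long as the method has not stopped. -/
structure OuterInv (P : Problem E F) (lam σ c1 : ℝ) (p0 : F) (rho eta : ℝ) (s : OuterState E F) :
    Prop where
  z_mem : s.z ∈ P.H
  le_c : c1 ≤ s.c
  c_le : s.c ≤ max c1 (2 * P.cbar lam σ p0 rho eta)
  p_le : ‖s.p‖ ≤ P.C0 lam σ p0
  kHat_lt : s.kHat + 1 ≤ s.k
  length : (s.k : ℝ) - s.kHat ≤ P.cycleLength lam σ c1 p0 rho
  ref_le : s.kHat + 1 < s.k → P.augLag s.c s.zRef s.pRef ≤ P.phiUpper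
    + proxConst σ * (P.Dh ^ 2 / lam) + 4 * (P.C0 lam σ p0 ^ 2 / c1)
  decrease : s.kHat + 1 < s.k → P.cbar lam σ p0 rho eta ≤ s.c →
    ((s.k : ℝ) - s.kHat - 2) * threshold lam σ rho ≤
      P.augLag s.c s.zRef s.pRef - P.augLag s.c s.z s.p

/-- A potential which grows by at least the number of inner iterations in each outer iteration:
a cycle has at most `cycleLength` outer iterations, each with at most `K √(c / c₁)` inner ones. -/
noncomputable def potential (K len c1 : ℝ) (s : OuterState E F) : ℝ :=
  K * √(s.c / c1) * (3 * len + ((s.k : ℝ) - s.kHat - 1))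

/-- One outer iteration without stopping preserves the invariant and raises the potential. -/
theorem OuterInv.step (hP : P.Assumptions) {lam σ c1 : ℝ} {p0 : F} {rho eta : ℝ}
    {s : OuterState E F} {z v : E} {ε : ℝ} (hlam : 0 < lam) (hσ : 0 < σ) (hσ1 : σ < 1)
    (hc1 : 0 < c1) (hrho : 0 < rho) (heta : 0 < eta)
    (hs : P.OuterInv lam σ c1 p0 rho eta s) (h : P.InexactProx lam σ s z v ε)
    (hcont : ¬ (‖(P.refine lam s z v).w‖ ≤ rho ∧ ‖(P.refine lam s z v).q‖ ≤ eta)) :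
    P.OuterInv lam σ c1 p0 rho eta (P.nextState lam σ rho s z) ∧
    ∀ K : ℝ, 0 ≤ K → potential K (P.cycleLength lam σ c1 p0 rho) c1 s + K * √(s.c / c1) ≤
      potential K (P.cycleLength lam σ c1 p0 rho) c1 (P.nextState lam σ rho s z) := by
  have hc : 0 < s.c := hc1.trans_le hs.le_c
  have hthr := threshold_pos hlam hσ hσ1 hrho
  have hlen2 := hP.two_le_cycleLength hlam hσ hσ1 hc1 hrho p0
  set pk := proj P.dualK (s.p + s.c • P.g z) with hpk
  have hpk_le : ‖pk‖ ≤ P.C0 lam σ p0 := h.norm_multiplier_le hP hlam hσ hσ1 hc hs.z_mem hs.p_le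
  have hC0 := hP.C0_nonneg lam σ p0
  have hdiv : P.C0 lam σ p0 ^ 2 / s.c ≤ P.C0 lam σ p0 ^ 2 / c1 :=
    div_le_div_of_nonneg_left (by positivity) hc1 hs.le_c
  rcases hs.kHat_lt.eq_or_lt with hk | hk
  · -- the first iteration of a cycle
    have hnext : P.nextState lam σ rho s z = ⟨s.k + 1, s.kHat, s.c, z, pk, z, pk⟩ := by
      simp only [nextState, ← hk, lt_irrefl, false_and, if_false, if_true, ← hpk]
    rw [hnext]
    have hk' : (s.k : ℝ) = s.kHat + 1 := by exact_mod_cast hk.symm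
    refine ⟨⟨h.mem, hs.le_c, hs.c_le, hpk_le, by simp only; omega, ?_, fun _ => ?_,
      fun _ _ => ?_⟩, fun K hK => ?_⟩
    · push_cast; rw [hk']; linarith
    · have h1 := h.augLag_le_phiUpper hP hlam hσ hσ1 hc hs.z_mem
      have h2 := P.augLag_update_le hc z s.p
      have h8 : ‖pk - s.p‖ ≤ 2 * P.C0 lam σ p0 := by
        refine (norm_sub_le _ _).trans ?_; linarith [hs.p_le]
      have h9 := pow_le_pow_left₀ (norm_nonneg _) h8 2
      have h10 : 1 / s.c * ‖pk - s.p‖ ^ 2 ≤ 4 * (P.C0 lam σ p0 ^ 2 / s.c) := by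
        have := mul_le_mul_of_nonneg_left h9 (by positivity : 0 ≤ 1 / s.c)
        refine this.trans (le_of_eq ?_)
        ring
      unfold proxConst
      simp only
      rw [← hpk] at h2
      linarith
    · push_cast; rw [hk']; simp only [sub_self]
      apply le_of_eq; ring
    · unfold potential
      push_cast; rw [hk']
      apply le_of_eq; ring
  · have hkne : ¬ s.k = s.kHat + 1 := by omega
    have hkR : (s.kHat : ℝ) + 1 < s.k := by exact_mod_cast hk
    have hkpos : 0 < (s.k : ℝ) - s.kHat - 1 := by linarith
    by_cases hΔ : 1 / ((s.k : ℝ) - s.kHat - 1) * (P.augLag s.c s.zRef s.pRef - P.augLag s.c z pk) ≤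
        threshold lam σ rho
    · -- the end of a cycle
      have hnext : P.nextState lam σ rho s z = ⟨s.k + 1, s.k, 2 * s.c, z, pk, s.zRef, s.pRef⟩ := by
        have hΔ' := hΔ
        unfold threshold at hΔ'
        simp only [nextState, hkne, if_false, ← hpk]
        rw [if_pos ⟨hk, hΔ'⟩]
      rw [hnext]
      have hclt : s.c < P.cbar lam σ p0 rho eta := by
        by_contra hn
        rw [not_lt] at hn
        have h1 := h.threshold_lt hP hlam hσ hσ1 hc hs.z_mem hs.p_le hrho heta hn hcont
        have h2 := hs.decrease hk hn
        rw [one_div_mul_eq_div, div_le_iff₀ hkpos] at hΔ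
        rw [← hpk] at h1
        linarith
      refine ⟨⟨h.mem, by simp only; linarith [hs.le_c], ?_, hpk_le, le_rfl, ?_,
        fun hlt => absurd hlt (lt_irrefl _), fun hlt => absurd hlt (lt_irrefl _)⟩, fun K hK => ?_⟩
      · exact le_max_of_le_right (by simp only; linarith)
      · push_cast; linarith
      · -- `4 √c ≤ 3 √(2c)` lets the new cycle pay for all previous ones
        unfold potential
        push_cast
        have h1 : √(2 * s.c / c1) = √2 * √(s.c / c1) := by
          rw [mul_div_assoc, Real.sqrt_mul (by norm_num)]
        have h2 : (4 / 3 : ℝ) ≤ √2 := Real.le_sqrt_of_sq_le (by norm_num)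
        have h3 : 0 ≤ K * √(s.c / c1) := by positivity
        have h4 : K * √(s.c / c1) * ((s.k : ℝ) - s.kHat) ≤
            K * √(s.c / c1) * P.cycleLength lam σ c1 p0 rho :=
          mul_le_mul_of_nonneg_left hs.length h3
        have h5 : 4 / 3 * (K * √(s.c / c1) * (3 * P.cycleLength lam σ c1 p0 rho)) ≤
            √2 * (K * √(s.c / c1) * (3 * P.cycleLength lam σ c1 p0 rho)) :=
          mul_le_mul_of_nonneg_right h2 (mul_nonneg h3 (by linarith))
        rw [h1]
        linarith
    · have hnext : P.nextState lam σ rho s z = ⟨s.k + 1, s.kHat, s.c, z, pk, s.zRef, s.pRef⟩ := by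
        have hΔ' := hΔ
        unfold threshold at hΔ'
        simp only [nextState, hkne, if_false, ← hpk]
        rw [if_neg (fun hh => hΔ' hh.2)]
      rw [hnext]
      have href := hs.ref_le hk
      refine ⟨⟨h.mem, hs.le_c, hs.c_le, hpk_le, by simp only; omega, ?_, fun _ => href,
        fun _ hcb => ?_⟩, fun K hK => ?_⟩
      · rw [not_le, one_div_mul_eq_div, lt_div_iff₀ hkpos] at hΔ
        have h1 := P.le_augLag hc z pk
        have h2 := hP.phi_bounds.1 z h.mem
        have h3 : 1 / (2 * s.c) * ‖pk‖ ^ 2 ≤ P.C0 lam σ p0 ^ 2 / c1 := by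
          have h4 := pow_le_pow_left₀ (norm_nonneg _) hpk_le 2
          have h5 := mul_le_mul_of_nonneg_left h4 (by positivity : 0 ≤ 1 / (2 * s.c))
          have h6 : 1 / (2 * s.c) * P.C0 lam σ p0 ^ 2 = P.C0 lam σ p0 ^ 2 / s.c / 2 := by
            field_simp
          have h7 : 0 ≤ P.C0 lam σ p0 ^ 2 / s.c := by positivity
          linarith
        have h4 : ((s.k : ℝ) - s.kHat - 1) ≤ P.cycleGap lam σ c1 p0 / threshold lam σ rho := by
          rw [le_div_iff₀ hthr, cycleGap]
          linarith
        unfold cycleLength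
        push_cast
        linarith
      · have h1 := h.threshold_lt hP hlam hσ hσ1 hc hs.z_mem hs.p_le hrho heta hcb hcont
        have h2 := hs.decrease hk hcb
        rw [← hpk] at h1
        push_cast
        linarith
      · unfold potential
        push_cast
        apply le_of_eq; ring

theorem outerInv_initState (hP : P.Assumptions) {lam σ c1 : ℝ} {rho eta : ℝ}
    (hlam : 0 < lam) (hσ : 0 < σ) (hσ1 : σ < 1) (hc1 : 0 < c1) (hrho : 0 < rho)
    {z0 : E} (hz0 : z0 ∈ P.H) (p0 : F) :
    P.OuterInv lam σ c1 p0 rho eta (initState c1 z0 p0) := by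
  have := hP.two_le_cycleLength hlam hσ hσ1 hc1 hrho p0
  refine ⟨hz0, le_rfl, le_max_left _ _, hP.norm_p0_le lam σ p0, le_rfl, ?_,
    fun h => absurd h (lt_irrefl _), fun h => absurd h (lt_irrefl _)⟩
  simp only [initState, Nat.cast_one, Nat.cast_zero]
  linarith

/-- Bound on the number of inner iterations in one outer iteration, relative to the penalty. -/
theorem OuterInv.exists_stopsAt (hP : P.Assumptions) {lam σ c1 : ℝ} {p0 : F} {rho eta : ℝ}
    {s : OuterState E F} (hlam : 0 < lam) (hlam' : lam ≤ 1 / (2 * P.mf)) (hσ : 0 < σ)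
    (hσ1 : σ < 1) (hc1 : 0 < c1) (hs : P.OuterInv lam σ c1 p0 rho eta s) :
    ∃ j, (P.acgInput lam σ s).StopsAt j ∧ (j : ℝ) ≤ ACGInput.iterConst σ *
      √(P.baseL lam σ c1 p0) * logOnePlus (P.T lam σ c1 p0 rho eta) * √(s.c / c1) := by
  have hc : 0 < s.c := hc1.trans_le hs.le_c
  obtain ⟨j, hj, hjle⟩ := hP.exists_stopsAt hlam hlam' hσ hσ1.le hc hs.z_mem
  refine ⟨j, hj, hjle.trans ?_⟩
  have hL1 := hP.one_le_Lpsi hlam hc s.p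
  have h1 := hP.Lpsi_le hlam hc1 hs.le_c hs.p_le
  have hB := hP.one_le_baseL (σ := σ) hlam hc1 p0
  have h2 : P.Lpsi lam s.c s.p ≤ P.T lam σ c1 p0 rho eta :=
    h1.trans (mul_le_mul_of_nonneg_left (div_le_div_of_nonneg_right hs.c_le hc1.le)
      (by linarith))
  have h3 := logOnePlus_mono (by linarith) h2
  have h4 : √(P.Lpsi lam s.c s.p) ≤ √(P.baseL lam σ c1 p0) * √(s.c / c1) := by
    rw [← Real.sqrt_mul (by linarith)]
    exact Real.sqrt_le_sqrt h1
  have h5 := (ACGInput.iterConst_pos hσ hσ1.le).le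
  have h6 := ACGInput.one_le_logOnePlus (P.Lpsi lam s.c s.p)
  calc _ ≤ ACGInput.iterConst σ * (√(P.baseL lam σ c1 p0) * √(s.c / c1))
        * logOnePlus (P.T lam σ c1 p0 rho eta) := by gcongr
    _ = _ := by ring

/-- The method terminates, and the total number of inner iterations is at most a multiple of the
length of a cycle times `√𝒯 log₁⁺ 𝒯`: cycles with smaller penalties only contribute to the
constant. The proof is an induction on the amount by which the potential can still grow. -/
theorem exists_run (hP : P.Assumptions) {lam σ c1 : ℝ} {rho eta : ℝ}
    (hlam : 0 < lam) (hlam' : lam ≤ 1 / (2 * P.mf)) (hσ : 0 < σ)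
    (hσ1 : σ < 1) (hc1 : 0 < c1) (hrho : 0 < rho) (heta : 0 < eta)
    {z0 : E} (hz0 : z0 ∈ P.H) (p0 : F) :
    ∃ (N : ℕ) (Q : Quadruple E F), P.Run lam σ rho eta (initState c1 z0 p0) N Q ∧
      P.IsApproxStationary rho eta Q ∧
      (N : ℝ) ≤ 4 * ACGInput.iterConst σ * P.cycleLength lam σ c1 p0 rho *
        (√(P.T lam σ c1 p0 rho eta) * logOnePlus (P.T lam σ c1 p0 rho eta)) := by
  set len := P.cycleLength lam σ c1 p0 rho with hlen
  have hlen2 : 2 ≤ len := hP.two_le_cycleLength hlam hσ hσ1 hc1 hrho p0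
  set K := ACGInput.iterConst σ * √(P.baseL lam σ c1 p0) *
    logOnePlus (P.T lam σ c1 p0 rho eta) with hK
  have hK0 : 0 ≤ K := by
    have := (ACGInput.iterConst_pos hσ hσ1.le).le
    have := ACGInput.one_le_logOnePlus (P.T lam σ c1 p0 rho eta)
    positivity
  set cm := max c1 (2 * P.cbar lam σ p0 rho eta) with hcm
  set B := K * √(cm / c1) * (4 * len) with hB
  have hlast : ∀ s, P.OuterInv lam σ c1 p0 rho eta s →
      potential K len c1 s + K * √(s.c / c1) ≤ B := by
    intro s hs
    have h1 : K * √(s.c / c1) ≤ K * √(cm / c1) :=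
      mul_le_mul_of_nonneg_left (Real.sqrt_le_sqrt
        (div_le_div_of_nonneg_right hs.c_le hc1.le)) hK0
    have h2 : 3 * len + ((s.k : ℝ) - s.kHat) ≤ 4 * len := by linarith [hs.length]
    have h3 : (s.kHat : ℝ) + 1 ≤ s.k := by exact_mod_cast hs.kHat_lt
    have h4 := mul_le_mul h1 h2 (by linarith) (by positivity)
    unfold potential
    linarith
  have hmain : ∀ n : ℕ, ∀ s, P.OuterInv lam σ c1 p0 rho eta s → B - potential K len c1 s < n →
      ∃ (N : ℕ) (Q : Quadruple E F), P.Run lam σ rho eta s N Q ∧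
        P.IsApproxStationary rho eta Q ∧ potential K len c1 s + N ≤ B := by
    intro n
    induction n with
    | zero =>
      intro s hs hn
      have := hlast s hs
      have : 0 ≤ K * √(s.c / c1) := by positivity
      push_cast at hn
      linarith
    | succ n ih =>
      intro s hs hn
      have hc : 0 < s.c := hc1.trans_le hs.le_c
      obtain ⟨j, hj, hjle⟩ := hs.exists_stopsAt hP hlam hlam' hσ hσ1 hc1
      have hprox := hP.inexactProx_of_stopsAt hlam hlam' hc hs.z_mem hj
      have hj1 : (1 : ℝ) ≤ j := by exact_mod_cast hj.1
      by_cases hdone : ‖(P.refine lam s ((P.acgInput lam σ s).x j)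
          ((P.acgInput lam σ s).u j)).w‖ ≤ rho ∧
        ‖(P.refine lam s ((P.acgInput lam σ s).x j) ((P.acgInput lam σ s).u j)).q‖ ≤ eta
      · refine ⟨j, _, Run.done s j hj hdone.1 hdone.2,
          hprox.refine_isApproxStationary hP hlam hσ hc hdone.1 hdone.2, ?_⟩
        have := hlast s hs
        linarith
      · obtain ⟨hs', hpot⟩ := hs.step hP hlam hσ hσ1 hc1 hrho heta hprox hdone
        have hpot := hpot K hK0
        obtain ⟨N, Q, hrun, hQ, hN⟩ := ih _ hs' (by push_cast at hn; linarith)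
        refine ⟨j + N, Q, Run.proceed s j N Q hj hdone hrun, hQ, ?_⟩
        push_cast
        linarith
  have hinit := outerInv_initState (eta := eta) hP hlam hσ hσ1 hc1 hrho hz0 p0
  obtain ⟨n, hn⟩ := exists_nat_gt (B - potential K len c1 (initState c1 z0 p0))
  obtain ⟨N, Q, hrun, hQ, hN⟩ := hmain n _ hinit hn
  refine ⟨N, Q, hrun, hQ, ?_⟩
  have h1 : 0 ≤ potential K len c1 (initState (E := E) c1 z0 p0) := by
    unfold potential
    refine mul_nonneg (by positivity) ?_
    simp only [initState, Nat.cast_one, Nat.cast_zero]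
    linarith
  have h2 : √(P.T lam σ c1 p0 rho eta) = √(P.baseL lam σ c1 p0) * √(cm / c1) := by
    rw [← Real.sqrt_mul (by linarith [hP.one_le_baseL (σ := σ) hlam hc1 p0])]
    rfl
  have h3 : B = 4 * ACGInput.iterConst σ * len *
      (√(P.T lam σ c1 p0 rho eta) * logOnePlus (P.T lam σ c1 p0 rho eta)) := by
    rw [h2, hB, hK]; ring
  linarith

/-! ### The complexity bounds -/

/-- The factor of `R_φ / (λ ρ̂²)` in the bound on the length of a cycle, when both `C₀² / c₁` and
`λ ρ̂²` are at most `M R_φ`. -/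
noncomputable def cycleConst (σ M : ℝ) : ℝ :=
  4 * (1 + 2 * σ) ^ 2 / (1 - σ ^ 2) * (1 + proxConst σ + 5 * |M|) + 2 * |M|

theorem cycleConst_nonneg {σ : ℝ} (hσ : 0 < σ) (hσ1 : σ < 1) (M : ℝ) : 0 ≤ cycleConst σ M := by
  have : 0 < 1 - σ ^ 2 := by nlinarith
  have := proxConst_nonneg hσ hσ1
  unfold cycleConst; positivity

theorem cycleLength_le (hP : P.Assumptions) {lam σ c1 rho M : ℝ} (hlam : 0 < lam) (hσ : 0 < σ)
    (hσ1 : σ < 1) (hrho : 0 < rho) {p0 : F}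
    (hM : P.C0 lam σ p0 ^ 2 / c1 ≤ M * P.Rphi lam) (hM' : lam * rho ^ 2 ≤ M * P.Rphi lam) :
    P.cycleLength lam σ c1 p0 rho ≤ cycleConst σ M * (P.Rphi lam / (lam * rho ^ 2)) := by
  have hR := hP.Rphi_pos hlam
  have hσ2 : 0 < 1 - σ ^ 2 := by nlinarith
  have hκ := proxConst_nonneg hσ hσ1
  have h0 : M * P.Rphi lam ≤ |M| * P.Rphi lam := mul_le_mul_of_nonneg_right (le_abs_self M) hR.le
  have h1 : P.cycleGap lam σ c1 p0 ≤ (1 + proxConst σ + 5 * |M|) * P.Rphi lam := by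
    have h2 := hP.phi_bounds.2.1
    have h3 : P.Dh ^ 2 / lam ≤ P.Rphi lam := by unfold Rphi; linarith
    have h4 : 0 ≤ P.Dh ^ 2 / lam := by positivity
    have h5 : P.phiUpper - P.phiLower ≤ P.Rphi lam := by unfold Rphi; linarith
    have h6 := mul_le_mul_of_nonneg_left h3 hκ
    unfold cycleGap
    linarith
  have h2 := div_le_div_of_nonneg_right h1 (threshold_pos hlam hσ hσ1 hrho).le
  have h3 : (1 + proxConst σ + 5 * |M|) * P.Rphi lam / threshold lam σ rho =
      4 * (1 + 2 * σ) ^ 2 / (1 - σ ^ 2) * (1 + proxConst σ + 5 * |M|) *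
        (P.Rphi lam / (lam * rho ^ 2)) := by
    unfold threshold; field_simp
  have h4 : 1 ≤ |M| * (P.Rphi lam / (lam * rho ^ 2)) := by
    rw [← mul_div_assoc, one_le_div (by positivity)]; linarith
  unfold cycleLength cycleConst
  linarith

theorem exists_run_le (hP : P.Assumptions) {lam σ c1 M : ℝ} {rho eta : ℝ}
    (hlam : 0 < lam) (hlam' : lam ≤ 1 / (2 * P.mf)) (hσ : 0 < σ)
    (hσ1 : σ < 1) (hc1 : 0 < c1) (hrho : 0 < rho) (heta : 0 < eta)
    {z0 : E} (hz0 : z0 ∈ P.H) (p0 : F)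
    (hM : P.C0 lam σ p0 ^ 2 / c1 ≤ M * P.Rphi lam) (hM' : lam * rho ^ 2 ≤ M * P.Rphi lam) :
    ∃ (N : ℕ) (Q : Quadruple E F), P.Run lam σ rho eta (initState c1 z0 p0) N Q ∧
      P.IsApproxStationary rho eta Q ∧
      (N : ℝ) ≤ (4 * ACGInput.iterConst σ * cycleConst σ M + 1) * (1 + P.Rphi lam / (lam * rho ^ 2)
          * √(P.T lam σ c1 p0 rho eta) * logOnePlus (P.T lam σ c1 p0 rho eta)) := by
  obtain ⟨N, Q, hrun, hQ, hN⟩ := exists_run hP hlam hlam' hσ hσ1 hc1 hrho heta hz0 p0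
  refine ⟨N, Q, hrun, hQ, hN.trans ?_⟩
  have h1 := cycleLength_le hP hlam hσ hσ1 hrho hM hM'
  have h2 := (ACGInput.iterConst_pos hσ hσ1.le).le
  have h3 := ACGInput.one_le_logOnePlus (P.T lam σ c1 p0 rho eta)
  have h4 := cycleConst_nonneg hσ hσ1 M
  have h5 := hP.Rphi_pos hlam
  set X := √(P.T lam σ c1 p0 rho eta) * logOnePlus (P.T lam σ c1 p0 rho eta) with hX
  have hX0 : 0 ≤ X := by positivity
  have h6 : 4 * ACGInput.iterConst σ * P.cycleLength lam σ c1 p0 rho * X ≤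
      4 * ACGInput.iterConst σ * (cycleConst σ M * (P.Rphi lam / (lam * rho ^ 2))) * X := by
    gcongr
  have h7 : 0 ≤ P.Rphi lam / (lam * rho ^ 2) * X := by positivity
  have h8 : 0 ≤ 4 * ACGInput.iterConst σ * cycleConst σ M := by positivity
  rw [mul_assoc (P.Rphi lam / (lam * rho ^ 2)), ← hX]
  linarith

/-- The factor `𝒯` for a fixed problem, as a function of the tolerances. -/
theorem T_le (hP : P.Assumptions) {lam σ c1 : ℝ} (hlam : 0 < lam) (hσ : 0 < σ)
    (hσ1 : σ < 1) (hc1 : 0 < c1) (p0 : F) :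
    ∃ A : ℝ, 1 ≤ A ∧ ∀ rho eta : ℝ, 0 < rho → 0 < eta → 1 ≤ P.T lam σ c1 p0 rho eta ∧
      P.T lam σ c1 p0 rho eta ≤ A * (1 + 1 / rho ^ 2 + 1 / eta) := by
  have hB := hP.one_le_baseL (σ := σ) hlam hc1 p0
  have h3 := hP.kappa3_nonneg hlam hσ hσ1 p0
  have h4 := hP.kappa4_nonneg hlam hσ hσ1 p0
  set B := P.baseL lam σ c1 p0 with hBdef
  set k3 := P.kappa3 lam σ p0 with hk3
  set k4 := P.kappa4 lam σ p0 with hk4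
  set A' := 1 + 2 * (k3 + k4) / c1 with hA'
  have hq : 0 ≤ 2 * (k3 + k4) / c1 := by positivity
  have hA1 : 1 ≤ A' := by rw [hA']; linarith
  refine ⟨B * A', one_le_mul_of_one_le_of_one_le hB hA1, fun rho eta hrho heta => ?_⟩
  have hT : P.T lam σ c1 p0 rho eta = B * (max c1 (2 * P.cbar lam σ p0 rho eta) / c1) := rfl
  have hm1 : 1 ≤ max c1 (2 * P.cbar lam σ p0 rho eta) / c1 :=
    (one_le_div hc1).2 (le_max_left _ _)
  refine ⟨by rw [hT]; exact one_le_mul_of_one_le_of_one_le hB hm1, ?_⟩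
  rw [hT, mul_assoc]
  refine mul_le_mul_of_nonneg_left ?_ (by linarith)
  rw [div_le_iff₀ hc1]
  set a := 1 / rho ^ 2 with ha
  set b := 1 / eta with hb
  have ha0 : 0 < a := by positivity
  have hb0 : 0 < b := by positivity
  have hcb : P.cbar lam σ p0 rho eta = k3 * a + k4 * b := by
    unfold cbar; rw [ha, hb]; ring
  have e : A' * (1 + a + b) * c1 = c1 * (1 + a + b) + 2 * (k3 + k4) * (1 + a + b) := by
    rw [hA']; field_simp
  rw [e]
  have hk : 0 ≤ k3 + k4 := by linarith
  apply max_le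
  · have : 0 ≤ c1 * (a + b) := by positivity
    have : 0 ≤ 2 * (k3 + k4) * (1 + a + b) := by positivity
    linarith
  · rw [hcb]
    have : 0 ≤ c1 * (1 + a + b) := by positivity
    have : 0 ≤ k3 * (1 + b) := by positivity
    have : 0 ≤ k4 * (1 + a) := by positivity
    linarith

/-- The general bound, for `𝒯 ≤ A (1 + ρ⁻² + η⁻¹)` and bounded `ρ`, in terms of the tolerances.
Lower powers of `1/ρ` are absorbed by `ρ ≤ ρ_max`, and `log 𝒯` by `𝒯 ≤ A ((ρ_max + 1) S)²`, where
`S = 1/ρ + 1/η`. -/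
theorem tolerance_bound {rhoMax A K : ℝ} (hmax : 0 < rhoMax) (hA : 1 ≤ A) (hK : 0 ≤ K)
    {rho eta T : ℝ} (hrho : 0 < rho) (hle : rho ≤ rhoMax) (heta : 0 < eta) (hT1 : 1 ≤ T)
    (hT : T ≤ A * (1 + 1 / rho ^ 2 + 1 / eta)) :
    1 + K / rho ^ 2 * √T * logOnePlus T ≤
      (rhoMax ^ 3 + K * (√A * (rhoMax + 1)) * (Real.log A + 2 * Real.log (rhoMax + 1) + 2)) *
        ((1 / (√eta * rho ^ 2) + 1 / rho ^ 3) * logOnePlus (1 / rho + 1 / eta)) := by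
  set X := 1 / (√eta * rho ^ 2) + 1 / rho ^ 3 with hX
  set S := 1 / rho + 1 / eta with hS
  set G := logOnePlus S with hG
  set A2 := Real.log A + 2 * Real.log (rhoMax + 1) + 2 with hA2
  have hG1 : 1 ≤ G := ACGInput.one_le_logOnePlus S
  have hse : 0 < √eta := Real.sqrt_pos.2 heta
  have hX0 : 0 < X := by positivity
  have hlA : 0 ≤ Real.log A := Real.log_nonneg hA
  have hlm : 0 ≤ Real.log (rhoMax + 1) := Real.log_nonneg (by linarith)
  have hS0 : 0 < S := by positivity
  have h1 : 1 ≤ rhoMax ^ 3 * (X * G) := by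
    have h2 : 1 ≤ rhoMax ^ 3 * (1 / rho ^ 3) := by
      rw [mul_one_div, one_le_div (by positivity)]
      exact pow_le_pow_left₀ hrho.le hle 3
    have h3 : 1 / rho ^ 3 ≤ X * G := by
      have : 0 ≤ 1 / (√eta * rho ^ 2) := by positivity
      have : X ≤ X * G := le_mul_of_one_le_right hX0.le hG1
      linarith
    exact h2.trans (mul_le_mul_of_nonneg_left h3 (by positivity))
  have h2 : √T ≤ √A * (1 + 1 / rho + 1 / √eta) := by
    have h3 : √T ≤ √(A * (1 + 1 / rho + 1 / √eta) ^ 2) := by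
      apply Real.sqrt_le_sqrt
      refine hT.trans (mul_le_mul_of_nonneg_left ?_ (by linarith))
      have e : 1 / eta = (1 / √eta) ^ 2 := by rw [div_pow, Real.sq_sqrt heta.le, one_pow]
      have e2 : 1 / rho ^ 2 = (1 / rho) ^ 2 := by rw [div_pow, one_pow]
      rw [e, e2]
      have ha : 0 < 1 / rho := by positivity
      have hb : 0 < 1 / √eta := by positivity
      nlinarith [mul_pos ha hb]
    rwa [Real.sqrt_mul (by linarith), Real.sqrt_sq (by positivity)] at h3
  have h3 : 1 / rho ^ 2 * √T ≤ √A * (rhoMax + 1) * X := by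
    have h4 := mul_le_mul_of_nonneg_left h2 (by positivity : 0 ≤ 1 / rho ^ 2)
    refine h4.trans ?_
    have h5 : 1 / rho ^ 2 ≤ rhoMax * (1 / rho ^ 3) := by
      rw [mul_one_div, div_le_div_iff₀ (by positivity) (by positivity)]
      nlinarith [pow_pos hrho 2]
    have h6 : 1 / rho ^ 2 * (1 + 1 / rho + 1 / √eta) ≤ (rhoMax + 1) * X := by
      have e : 1 / rho ^ 2 * (1 + 1 / rho + 1 / √eta) = 1 / rho ^ 2 + X := by
        rw [hX]; field_simp; ring
      rw [e]
      have : 0 ≤ rhoMax * (1 / (√eta * rho ^ 2)) := by positivity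
      have e2 : (rhoMax + 1) * X = rhoMax * (1 / (√eta * rho ^ 2)) + rhoMax * (1 / rho ^ 3) + X := by
        rw [hX]; ring
      linarith
    have := mul_le_mul_of_nonneg_left h6 (Real.sqrt_nonneg A)
    linarith
  have h4 : logOnePlus T ≤ A2 * G := by
    have hlog : Real.log S ≤ G := le_max_left _ _
    have h5 : T ≤ A * ((rhoMax + 1) * S) ^ 2 := by
      refine hT.trans (mul_le_mul_of_nonneg_left ?_ (by linarith))
      have h6 : 1 ≤ rhoMax * S := by
        have : 1 ≤ rhoMax * (1 / rho) := by
          rw [mul_one_div, one_le_div hrho]; exact hle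
        have h7 : 0 ≤ rhoMax * (1 / eta) := by positivity
        rw [hS, mul_add]; linarith
      have h7 : 1 + S ≤ (rhoMax + 1) * S := by linarith
      have h8 := pow_le_pow_left₀ (by positivity) h7 2
      refine le_trans ?_ h8
      have e2 : 1 / rho ^ 2 = (1 / rho) ^ 2 := by rw [div_pow, one_pow]
      rw [hS, e2]
      have ha : 0 < 1 / rho := by positivity
      have hb : 0 < 1 / eta := by positivity
      nlinarith [mul_pos ha hb]
    have h6 := Real.log_le_log (by linarith) h5
    rw [Real.log_mul (by linarith) (by positivity), Real.log_pow,
      Real.log_mul (by linarith) hS0.ne'] at h6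
    push_cast at h6
    have h7 : 0 ≤ Real.log A + 2 * Real.log (rhoMax + 1) := by linarith
    have h8 : Real.log A + 2 * Real.log (rhoMax + 1) ≤
      (Real.log A + 2 * Real.log (rhoMax + 1)) * G := le_mul_of_one_le_right h7 hG1
    refine max_le ?_ ?_ <;> rw [hA2] <;> linarith
  have h5 : K / rho ^ 2 * √T * logOnePlus T ≤ K * (√A * (rhoMax + 1) * X) * (A2 * G) := by
    have e : K / rho ^ 2 * √T = K * (1 / rho ^ 2 * √T) := by ring
    rw [e]
    have h6 := mul_le_mul_of_nonneg_left h3 hK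
    exact mul_le_mul h6 h4 (zero_le_one.trans (ACGInput.one_le_logOnePlus T)) (by positivity)
  calc _ ≤ rhoMax ^ 3 * (X * G) + K * (√A * (rhoMax + 1) * X) * (A2 * G) := add_le_add h1 h5
    _ = _ := by ring

end Problem

end NLIAPIAL

/-- First part: the bound `O₁((R_φ / (λ ρ̂²)) √𝒯 log₁⁺ 𝒯)`; its constant depends only on `σ` and on
an upper bound `M` for `C₀² / (c₁ R_φ)` and `λ ρ̂² / R_φ`. Second part: the bound in terms of the
tolerances, for a fixed problem and fixed parameters, with `ρ̂` in a bounded range. -/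
theorem theorem3p4 (σ : ℝ) (hσ : 0 < σ) (hσ' : σ ≤ 1 / √2) :
    (∀ M : ℝ, ∃ C : ℝ, 0 < C ∧
      ∀ (n l : ℕ) (P : NLIAPIAL.Problem (EuclideanSpace ℝ (Fin n)) (EuclideanSpace ℝ (Fin l))),
      P.Assumptions →
      ∀ lam : ℝ, 0 < lam → lam ≤ 1 / (2 * P.mf) →
      ∀ c1 : ℝ, 0 < c1 →
      ∀ z0 ∈ P.H, ∀ (p0 : EuclideanSpace ℝ (Fin l)) (rho eta : ℝ), 0 < rho → 0 < eta →
      P.C0 lam σ p0 ^ 2 / c1 ≤ M * P.Rphi lam →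
      lam * rho ^ 2 ≤ M * P.Rphi lam →
      ∃ (N : ℕ) (Q : NLIAPIAL.Quadruple (EuclideanSpace ℝ (Fin n)) (EuclideanSpace ℝ (Fin l))),
        P.Run lam σ rho eta (NLIAPIAL.Problem.initState c1 z0 p0) N Q ∧
        P.IsApproxStationary rho eta Q ∧
        (N : ℝ) ≤ C * (1 + P.Rphi lam / (lam * rho ^ 2)
          * √(P.T lam σ c1 p0 rho eta) * NLIAPIAL.logOnePlus (P.T lam σ c1 p0 rho eta))) ∧
    (∀ (n l : ℕ) (P : NLIAPIAL.Problem (EuclideanSpace ℝ (Fin n)) (EuclideanSpace ℝ (Fin l))),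
      P.Assumptions →
      ∀ lam : ℝ, 0 < lam → lam ≤ 1 / (2 * P.mf) →
      ∀ c1 : ℝ, 0 < c1 →
      ∀ (p0 : EuclideanSpace ℝ (Fin l)) (rhoMax : ℝ), 0 < rhoMax →
      ∃ C : ℝ, 0 < C ∧ ∀ z0 ∈ P.H, ∀ rho eta : ℝ, 0 < rho → rho ≤ rhoMax → 0 < eta →
      ∃ (N : ℕ) (Q : NLIAPIAL.Quadruple (EuclideanSpace ℝ (Fin n)) (EuclideanSpace ℝ (Fin l))),
        P.Run lam σ rho eta (NLIAPIAL.Problem.initState c1 z0 p0) N Q ∧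
        P.IsApproxStationary rho eta Q ∧
        (N : ℝ) ≤ C * ((1 / (√eta * rho ^ 2) + 1 / rho ^ 3)
          * NLIAPIAL.logOnePlus (1 / rho + 1 / eta))) := by
  have hσ1 : σ < 1 := by
    refine hσ'.trans_lt ((div_lt_one (by positivity)).2 ?_)
    exact Real.lt_sqrt_of_sq_lt (by norm_num)
  have hpos : ∀ M, 0 < 4 * NLIAPIAL.ACGInput.iterConst σ * NLIAPIAL.Problem.cycleConst σ M + 1 := by
    intro M
    have := NLIAPIAL.ACGInput.iterConst_pos hσ hσ1.le
    have := NLIAPIAL.Problem.cycleConst_nonneg hσ hσ1 M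
    positivity
  constructor
  · intro M
    refine ⟨_, hpos M, ?_⟩
    intro n l P hP lam hlam hlam' c1 hc1 z0 hz0 p0 rho eta hrho heta hM hM'
    exact NLIAPIAL.Problem.exists_run_le hP hlam hlam' hσ hσ1 hc1 hrho heta hz0 p0 hM hM'
  · intro n l P hP lam hlam hlam' c1 hc1 p0 rhoMax hmax
    have hR := hP.Rphi_pos hlam
    have hC0 := hP.C0_nonneg lam σ p0
    obtain ⟨A, hA, hT⟩ := NLIAPIAL.Problem.T_le hP hlam hσ hσ1 hc1 p0
    -- for a fixed problem both hypotheses of the general bound hold with this `M`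
    set M := (P.C0 lam σ p0 ^ 2 / c1 + lam * rhoMax ^ 2) / P.Rphi lam with hM
    have hMR : M * P.Rphi lam = P.C0 lam σ p0 ^ 2 / c1 + lam * rhoMax ^ 2 :=
      div_mul_cancel₀ _ hR.ne'
    have hq : 0 ≤ P.C0 lam σ p0 ^ 2 / c1 := by positivity
    have hK : 0 ≤ P.Rphi lam / lam := by positivity
    refine ⟨(4 * NLIAPIAL.ACGInput.iterConst σ * NLIAPIAL.Problem.cycleConst σ M + 1) *
      (rhoMax ^ 3 + P.Rphi lam / lam * (√A * (rhoMax + 1)) *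
        (Real.log A + 2 * Real.log (rhoMax + 1) + 2)), mul_pos (hpos M) ?_, ?_⟩
    · have := Real.log_nonneg hA
      have : 0 ≤ Real.log (rhoMax + 1) := Real.log_nonneg (by linarith)
      positivity
    · intro z0 hz0 rho eta hrho hle heta
      obtain ⟨N, Q, hrun, hQ, hN⟩ := NLIAPIAL.Problem.exists_run_le (M := M) hP hlam hlam' hσ hσ1
        hc1 hrho heta hz0 p0
        (by rw [hMR]; have : 0 ≤ lam * rhoMax ^ 2 := by positivity
            linarith)
        (by rw [hMR]
            have := mul_le_mul_of_nonneg_left (pow_le_pow_left₀ hrho.le hle 2) hlam.le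
            linarith)
      refine ⟨N, Q, hrun, hQ, hN.trans ?_⟩
      obtain ⟨hT1, hT2⟩ := hT rho eta hrho heta
      have := NLIAPIAL.Problem.tolerance_bound hmax hA hK hrho hle heta hT1 hT2
      rw [div_div] at this
      rw [mul_assoc (4 * NLIAPIAL.ACGInput.iterConst σ * NLIAPIAL.Problem.cycleConst σ M + 1)]
      exact mul_le_mul_of_nonneg_left this (hpos M).le
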